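/- Let $k,h>0$. Let $\sqrt{\cdot}$ be the principal square root (branch cut along the negative real axis, non-negative real part, non-negative imaginary part on the cut), $\mathrm{Log}$ the principal logarithm, and $\mu(\xi)=\sqrt{k^2-\xi^2}$. Let $\mathcal L=\{s+i\ell(s):s\in\mathbb R\}$, oriented by increasing $s$, where $\ell\in C^\infty(\mathbb R;\mathbb R)$ has bounded derivative, $\ell(0)=0$, $\ell>0$ on $(-\infty,0)$, $\ell<0$ on $(0,\infty)$ and $\ell(s)\to0$ as $s\to\pm\infty$. Let $\mathcal C^{+}$ and $\mathcal C^-$ be the open regions above and below $\mathcal L$. Let $x^*=(x_1^*,x_2^*)\in\mathbb R^2$ with $x_2^*>0$, or with $x_2^*=0$ and $x_1^*>0$. Put $$K^{\pm}(\xi)=\exp\Big\{\pm\frac1{2\pi i}\int_{\mathcal L}\frac{\mathrm{Log}(1-e^{2i\mu(t)h})}{t-\xi}\,dt\Big\}\quad(\xi\in\mathcal C^{\pm}),$$ $$K^{\pm}(\xi)=\sqrt{1-e^{2i\mu(\xi)h}}\,\exp\Big\{\pm\frac1{2\pi i}\,\mathrm{p.v.}\!\int_{\mathcal L}\frac{\mathrm{Log}(1-e^{2i\mu(t)h})}{t-\xi}\,dt\Big\}\quad(\xi\in\mathcal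 L),$$ and, with $g(t)=e^{itx_1^*+i\mu(t)x_2^*}K^-(t)/\sqrt{k-t}$ for $t\in\mathcal L$, $$H^+(\xi;x^*)=\frac1{2\pi i}\int_{\mathcal L}\frac{g(t)}{t-\xi}\,dt\quad(\xi\in\mathcal C^+),\qquad H^+(\xi;x^*)=\frac{g(\xi)}2+\frac1{2\pi i}\,\mathrm{p.v.}\!\int_{\mathcal L}\frac{g(t)}{t-\xi}\,dt\quad(\xi\in\mathcal L),$$ $$\hat f^+(\xi;x^*)=\frac{H^+(\xi;x^*)\,K^+(\xi)}{2i\sqrt{k+\xi}}\qquad(\xi\in\overline{\mathcal C^+}).$$ Then there is a function $F:\mathbb C\to\mathbb C$ with $F=\hat f^+(\cdot\,;x^*)$ on $\overline{\mathcal C^+}$ such that $F$ is holomorphic in $\mathbb C\setminus(-\infty,-k]$ and its restriction to $$\overline{\{\operatorname{Re}\xi>0,\ \operatorname{Im}\xi<0\}}\cup\overline{\{\operatorname{Re}\xi<0,\ \operatorname{Im}\xi>0\}}$$ is continuous. Moreover, on the real axis $|F(\xi)|=O(|\xi|^{-1/2-\eta})$ as $|\xi|\to\infty$, $\xi\in\mathbb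 R$, for every $\eta\in(0,1)$ if $x_2^*>0$, and for every $\eta\in(0,\tfrac12)$ if $x_2^*=0$ (the implied constant may depend on $\eta,k,h,\mathcal L,x^*$). -/

import Mathlib

open scoped Topology ContDiff

noncomputable section

namespace WienerHopf

/-- The principal square root: branch cut on the negative real axis, non-negative real part;
on the cut it takes the values with non-negative imaginary part. -/
def csqrt (z : ℂ) : ℂ := Complex.sqrt z

/-- `μ(ξ) = √(k² - ξ²)`. -/
def mu (k : ℝ) (ξ : ℂ) : ℂ := csqrt ((k : ℂ) ^ 2 - ξ ^ 2)

/-- `1 - exp(2 i μ(ξ) h)`. -/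
def symb (k h : ℝ) (ξ : ℂ) : ℂ := 1 - Complex.exp (2 * Complex.I * mu k ξ * (h : ℂ))

/-- The admissible integration paths `𝓛`, written as graphs `Im ξ = ℓ (Re ξ)`: smooth paths from
`-∞ + 0i` to `+∞ - 0i` through the origin, above the negative real axis and below the positive
real axis. The slope is bounded, so that arc length is comparable with `d(Re ξ)`. -/
structure IsContour (ℓ : ℝ → ℝ) : Prop where
  smooth : ContDiff ℝ ∞ ℓ
  zero : ℓ 0 = 0
  pos_of_neg : ∀ s < 0, 0 < ℓ s
  neg_of_pos : ∀ s > 0, ℓ s < 0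
  tendsto_atBot : Filter.Tendsto ℓ Filter.atBot (𝓝 0)
  tendsto_atTop : Filter.Tendsto ℓ Filter.atTop (𝓝 0)
  slope_bdd : ∃ C : ℝ, ∀ s, |deriv ℓ s| ≤ C

/-- The point of `𝓛` with real part `s`. -/
def path (ℓ : ℝ → ℝ) (s : ℝ) : ℂ := (s : ℂ) + (ℓ s : ℂ) * Complex.I

/-- The derivative of the parametrization `path ℓ`. -/
def pathDeriv (ℓ : ℝ → ℝ) (s : ℝ) : ℂ := 1 + ((deriv ℓ s : ℝ) : ℂ) * Complex.I

/-- `∫_𝓛 φ(t) / (t - ξ) dt`, for `ξ` off the path. -/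
def cauchyInt (ℓ : ℝ → ℝ) (φ : ℂ → ℂ) (ξ : ℂ) : ℂ :=
  ∫ s : ℝ, φ (path ℓ s) / (path ℓ s - ξ) * pathDeriv ℓ s

/-- `p.v. ∫_𝓛 φ(t) / (t - ξ) dt`, for `ξ` on the path: the limit as `ε → 0+` of the integral over
the part of the path outside the disk of radius `ε` around `ξ`. -/
def pvInt (ℓ : ℝ → ℝ) (φ : ℂ → ℂ) (ξ : ℂ) : ℂ :=
  Filter.limUnder (𝓝[>] (0 : ℝ)) fun ε : ℝ =>
    ∫ s in {s : ℝ | ε < ‖path ℓ s - ξ‖}, φ (path ℓ s) / (path ℓ s - ξ) * pathDeriv ℓ s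

/-- The closed region `closure 𝓒⁺` on and above `𝓛`. -/
def closedUpper (ℓ : ℝ → ℝ) : Set ℂ := {ξ | ℓ ξ.re ≤ ξ.im}

open Classical in
/-- `K⁺`, for `ξ` above `𝓛` (Cauchy integral) or on `𝓛` (principal value). -/
def Kplus (k h : ℝ) (ℓ : ℝ → ℝ) (ξ : ℂ) : ℂ :=
  if ξ.im = ℓ ξ.re then
    csqrt (symb k h ξ) * Complex.exp
      (1 / (2 * (Real.pi : ℂ) * Complex.I) * pvInt ℓ (fun t => Complex.log (symb k h t)) ξ)
  else
    Complex.exp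
      (1 / (2 * (Real.pi : ℂ) * Complex.I) * cauchyInt ℓ (fun t => Complex.log (symb k h t)) ξ)

open Classical in
/-- `K⁻`, for `ξ` below `𝓛` (Cauchy integral) or on `𝓛` (principal value). -/
def Kminus (k h : ℝ) (ℓ : ℝ → ℝ) (ξ : ℂ) : ℂ :=
  if ξ.im = ℓ ξ.re then
    csqrt (symb k h ξ) * Complex.exp
      (-(1 / (2 * (Real.pi : ℂ) * Complex.I) * pvInt ℓ (fun t => Complex.log (symb k h t)) ξ))
  else
    Complex.exp
      (-(1 / (2 * (Real.pi : ℂ) * Complex.I) * cauchyInt ℓ (fun t => Complex.log (symb k h t)) ξ))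

/-- The density `exp(i t x₁* + i μ(t) x₂*) K⁻(t) / √(k - t)` on `𝓛`. -/
def density (k h : ℝ) (ℓ : ℝ → ℝ) (x₁ x₂ : ℝ) (t : ℂ) : ℂ :=
  Complex.exp (Complex.I * t * (x₁ : ℂ) + Complex.I * mu k t * (x₂ : ℂ)) * Kminus k h ℓ t
    / csqrt ((k : ℂ) - t)

open Classical in
/-- `H⁺(ξ; x*)`, for `ξ` above `𝓛` (Cauchy integral) or on `𝓛` (principal value). For `x₂* = 0`
the integrals still converge absolutely at infinity, and give the limit as `x₂* → 0+`. -/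
def Hplus (k h : ℝ) (ℓ : ℝ → ℝ) (x₁ x₂ : ℝ) (ξ : ℂ) : ℂ :=
  if ξ.im = ℓ ξ.re then
    density k h ℓ x₁ x₂ ξ / 2
      + 1 / (2 * (Real.pi : ℂ) * Complex.I) * pvInt ℓ (density k h ℓ x₁ x₂) ξ
  else
    1 / (2 * (Real.pi : ℂ) * Complex.I) * cauchyInt ℓ (density k h ℓ x₁ x₂) ξ

/-- `f̂⁺(ξ; x*) = H⁺(ξ; x*) K⁺(ξ) / (2 i √(k + ξ))` on `closedUpper ℓ`. -/
def fhatPlus (k h : ℝ) (ℓ : ℝ → ℝ) (x₁ x₂ : ℝ) (ξ : ℂ) : ℂ :=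
  Hplus k h ℓ x₁ x₂ ξ * Kplus k h ℓ ξ / (2 * Complex.I * csqrt ((k : ℂ) + ξ))

/-- The ray `(-∞, -k]` of the real axis. -/
def cut (k : ℝ) : Set ℂ := {ξ | ξ.im = 0 ∧ ξ.re ≤ -k}

/-- The open quadrant `Re ξ > 0`, `Im ξ < 0`. -/
def quadrantPM : Set ℂ := {ξ | 0 < ξ.re ∧ ξ.im < 0}

/-- The open quadrant `Re ξ < 0`, `Im ξ > 0`. -/
def quadrantMP : Set ℂ := {ξ | ξ.re < 0 ∧ 0 < ξ.im}

end WienerHopf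

end

open MeasureTheory Filter Metric Set

noncomputable section

namespace WienerHopf

/-! ### Parameter integrals, Cauchy estimates and the geometry of the path -/

section

/-! A Cauchy transform over the path continues across the path as far as its density is holomorphic.
Indeed f(t)/(t - ξ) is the sum of a kernel whose singularity at t = ξ is removable and of f(ξ) times
(t - ξ)⁻¹ - (t + i)⁻¹; the point -i lies below every admissible path, and the factor t + i gives
convergence at infinity for slowly decaying f. The second summand integrates to 2πi, πi (principal
value) or 0 according as ξ is above, on or below the path. So one function, `minusPart`, holomorphic
wherever f is (`subtractedInt_differentiableOn`), describes the normalized transform as `minusPart`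
+ f, `minusPart` + f/2 and `minusPart` in the three cases (`cauchyInt_above`, `pvInt_on`,
`cauchyInt_below`).

For f = log(1 - exp(2iμh)) this yields K⁺ = exp(`minusPart` + f) and K⁻ = exp(-`minusPart`), hence
K⁺K⁻ = 1 - exp(2iμh), and each factor continues across the path as the symbol divided by the other
one. Away from 0 the path lies in quadrants where Im μ > 0, so that the symbol has positive real
part and its logarithm is harmless. At 0 the symbol vanishes if kh is a multiple of π. Then a
logarithm of t²/(t² + 1), whose Cauchy transform is explicit, is split off, and both factors prove
to be holomorphic at 0 (`factors_near_zero`).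

Likewise H⁺ continues below the path as its Cauchy integral plus the density
(`fhatExt_eq_on_cutPlane`). There the symbol equals μ q(μ) with q entire and μ = √(k-ξ) √(k+ξ), so
√(k+ξ) cancels against the denominator of f̂⁺. What remains has no singularity at -k and is
discontinuous across the cut only through μ, which is continuous from the upper side
(`fhatExt_continuousWithinAt_cut`).

For the decay, μ = iν in these quadrants, and ν = √(ξ² - k²) is holomorphic across the real axis
near infinity. The densities thus extend to strips, where decay |ξ|^(-α) of a density gives decay
|ξ|^(-η) of `minusPart` for each η < α (`minusPart_decay`). The logarithm of the symbol has α = 1,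
so the factors stay bounded; the density of H⁺ has α = 1 or α = 1/2, and 1/√(k+ξ) supplies the
additional 1/2. -/

/-- Holomorphic dependence on a parameter under a locally uniform integrable bound. -/
theorem differentiableAt_integral_of_bound {α : Type*} [MeasurableSpace α] {μ : Measure α}
    {F : ℂ → α → ℂ} {x₀ : ℂ} {r : ℝ} {bound : α → ℝ} (hr : 0 < r)
    (hm : ∀ x ∈ ball x₀ r, AEStronglyMeasurable (F x) μ)
    (hb : ∀ᵐ a ∂μ, ∀ x ∈ ball x₀ r, ‖F x a‖ ≤ bound a) (hi : Integrable bound μ)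
    (hd : ∀ᵐ a ∂μ, DifferentiableOn ℂ (fun x => F x a) (ball x₀ r)) :
    DifferentiableAt ℂ (fun x => ∫ a, F x a ∂μ) x₀ := by
  have hx₀ : x₀ ∈ ball x₀ r := mem_ball_self hr
  have hderiv : ∀ᵐ a ∂μ, ∀ x ∈ ball x₀ (r / 2),
      HasDerivAt (fun x => F x a) (deriv (fun x => F x a) x) x := by
    filter_upwards [hd] with a ha x hx
    have hx' : x ∈ ball x₀ r := ball_subset_ball (by linarith) hx
    exact ((ha x hx').differentiableAt (isOpen_ball.mem_nhds hx')).hasDerivAt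
  -- On the half ball, circles of radius r/4 stay inside the ball where the bound holds, so Cauchy's
  -- estimate dominates the derivative by `bound a / (r / 4)`.
  refine (hasDerivAt_integral_of_dominated_loc_of_deriv_le (s := ball x₀ (r / 2))
    (F' := fun x a => deriv (fun x => F x a) x) (bound := fun a => bound a / (r / 4))
    (ball_mem_nhds _ (by linarith))
    (eventually_of_mem (ball_mem_nhds _ hr) hm) ?_ ?_ ?_ (hi.div_const _)
    hderiv).2.differentiableAt
  · exact hi.mono' (hm _ hx₀) (hb.mono fun a ha => ha x₀ hx₀)
  -- Measurability of the derivative in `a` is not assumed; it follows because the derivative is a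
  -- limit of difference quotients along a sequence.
  · have hseq : Tendsto (fun n : ℕ => ((r / 2 : ℝ) : ℂ) * (1 / ((n : ℂ) + 1))) atTop (𝓝[≠] 0) := by
      refine tendsto_nhdsWithin_iff.2 ⟨?_, Eventually.of_forall fun n => ?_⟩
      · simpa using (tendsto_one_div_add_atTop_nhds_zero_nat (𝕜 := ℂ)).const_mul ((r / 2 : ℝ) : ℂ)
      · have h1 : ((n : ℂ) + 1) ≠ 0 := by exact_mod_cast Nat.succ_ne_zero n
        have h2 : ((r / 2 : ℝ) : ℂ) ≠ 0 := by exact_mod_cast (by positivity : (r / 2) ≠ 0)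
        exact mul_ne_zero h2 (one_div_ne_zero h1)
    refine aestronglyMeasurable_of_tendsto_ae atTop
      (f := fun (n : ℕ) a => (((r / 2 : ℝ) : ℂ) * (1 / ((n : ℂ) + 1)))⁻¹ •
        (F (x₀ + ((r / 2 : ℝ) : ℂ) * (1 / ((n : ℂ) + 1))) a - F x₀ a)) (fun n => ?_) ?_
    · refine AEStronglyMeasurable.const_smul (AEStronglyMeasurable.sub (hm _ ?_) (hm _ hx₀))
        (((r / 2 : ℝ) : ℂ) * (1 / ((n : ℂ) + 1)))⁻¹
      rw [mem_ball, dist_eq_norm, add_sub_cancel_left, norm_mul, Complex.norm_real,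
        Real.norm_of_nonneg (by positivity)]
      have h3 : ‖(1 : ℂ) / ((n : ℂ) + 1)‖ ≤ 1 := by
        rw [norm_div, norm_one]
        have : ‖(n : ℂ) + 1‖ = (n : ℝ) + 1 := by
          rw [show (n : ℂ) + 1 = ((n + 1 : ℕ) : ℂ) by push_cast; ring, Complex.norm_natCast]
          push_cast; ring
        rw [this]
        exact (div_le_one (by positivity)).2 (by linarith [Nat.cast_nonneg (α := ℝ) n])
      nlinarith
    · filter_upwards [hderiv] with a ha
      exact (hasDerivAt_iff_tendsto_slope_zero.1 (ha x₀ (mem_ball_self (by linarith)))).comp hseq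
  · filter_upwards [hb, hd] with a ha hda x hx
    have hsub : closedBall x (r / 4) ⊆ ball x₀ r := by
      intro y hy
      rw [mem_closedBall] at hy
      rw [mem_ball] at hx ⊢
      linarith [dist_triangle y x x₀]
    refine Complex.norm_deriv_le_of_forall_mem_sphere_norm_le (by linarith) ?_
      fun z hz => ha z (hsub (sphere_subset_closedBall hz))
    exact (hda.mono hsub).diffContOnCl_ball subset_rfl

/-- Cauchy's estimate on discs of radius r/2 bounds ψ' on the middle ball; since that ball is
convex, the mean value inequality passes this to difference quotients. The bound is uniform in both
points, so it survives when a point of the path approaches ξ. -/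
theorem norm_dslope_le_of_ball {ψ : ℂ → ℂ} {c : ℂ} {r M : ℝ} (hr : 0 < r)
    (hd : DifferentiableOn ℂ ψ (ball c (3 * r))) (hM : ∀ z ∈ ball c (3 * r), ‖ψ z‖ ≤ M)
    {z w : ℂ} (hz : z ∈ ball c (2 * r)) (hw : w ∈ ball c (2 * r)) :
    ‖dslope ψ z w‖ ≤ M / (r / 2) := by
  have hsub : ∀ x ∈ ball c (2 * r), closedBall x (r / 2) ⊆ ball c (3 * r) := by
    intro x hx y hy
    rw [mem_closedBall] at hy
    rw [mem_ball] at hx ⊢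
    linarith [dist_triangle y x c]
  have hderiv : ∀ x ∈ ball c (2 * r), ‖deriv ψ x‖ ≤ M / (r / 2) := fun x hx =>
    Complex.norm_deriv_le_of_forall_mem_sphere_norm_le (by linarith)
      ((hd.mono (hsub x hx)).diffContOnCl_ball subset_rfl)
      fun y hy => hM y (hsub x hx (sphere_subset_closedBall hy))
  rcases eq_or_ne w z with rfl | hne
  · rw [dslope_same]; exact hderiv _ hz
  · rw [dslope_of_ne _ hne, slope_def_field, norm_div,
      div_le_iff₀ (norm_pos_iff.2 (sub_ne_zero.2 hne))]
    refine (convex_ball c (2 * r)).norm_image_sub_le_of_norm_deriv_le (fun x hx => ?_) hderiv hz hw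
    have hx' : x ∈ ball c (3 * r) := ball_subset_ball (by linarith) hx
    exact (hd x hx').differentiableAt (isOpen_ball.mem_nhds hx')

/-! ### Geometry of the contour -/

variable {ℓ : ℝ → ℝ}

@[simp] theorem path_re (ℓ : ℝ → ℝ) (s : ℝ) : (path ℓ s).re = s := by simp [path]

@[simp] theorem path_im (ℓ : ℝ → ℝ) (s : ℝ) : (path ℓ s).im = ℓ s := by simp [path]

theorem eq_path_of_im_eq {ξ : ℂ} (h : ξ.im = ℓ ξ.re) : ξ = path ℓ ξ.re :=
  Complex.ext (by simp) (by simp [h])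

theorem IsContour.continuous (hℓ : IsContour ℓ) : Continuous ℓ := hℓ.smooth.continuous

theorem IsContour.hasDerivAt (hℓ : IsContour ℓ) (s : ℝ) : HasDerivAt ℓ (deriv ℓ s) s :=
  (hℓ.smooth.differentiable (by simp) s).hasDerivAt

theorem IsContour.hasDerivAt_path (hℓ : IsContour ℓ) (s : ℝ) :
    HasDerivAt (path ℓ) (pathDeriv ℓ s) s := by
  have h1 : HasDerivAt (fun s : ℝ => (s : ℂ)) 1 s := by
    simpa using (hasDerivAt_id s).ofReal_comp
  exact h1.add ((hℓ.hasDerivAt s).ofReal_comp.mul_const Complex.I)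

theorem IsContour.continuous_path (hℓ : IsContour ℓ) : Continuous (path ℓ) :=
  continuous_iff_continuousAt.2 fun s => (hℓ.hasDerivAt_path s).continuousAt

theorem IsContour.continuous_pathDeriv (hℓ : IsContour ℓ) : Continuous (pathDeriv ℓ) := by
  have h : Continuous (deriv ℓ) := hℓ.smooth.continuous_deriv (by simp)
  unfold pathDeriv
  fun_prop

theorem IsContour.exists_norm_pathDeriv_le (hℓ : IsContour ℓ) :
    ∃ B : ℝ, 1 ≤ B ∧ ∀ s, ‖pathDeriv ℓ s‖ ≤ B := by
  obtain ⟨C, hC⟩ := hℓ.slope_bdd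
  refine ⟨1 + C, by linarith [abs_nonneg (deriv ℓ 0), hC 0], fun s => ?_⟩
  unfold pathDeriv
  refine (norm_add_le _ _).trans ?_
  simpa using hC s

theorem abs_sub_le_norm_path_sub (ℓ : ℝ → ℝ) (s : ℝ) (ξ : ℂ) : |s - ξ.re| ≤ ‖path ℓ s - ξ‖ := by
  simpa using Complex.abs_re_le_norm (path ℓ s - ξ)

theorem norm_path_sub_path_le {B : ℝ} (hℓ : IsContour ℓ) (hB : ∀ s, ‖pathDeriv ℓ s‖ ≤ B)
    (s t : ℝ) : ‖path ℓ s - path ℓ t‖ ≤ B * |s - t| := by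
  refine convex_univ.norm_image_sub_le_of_norm_hasDerivWithin_le (𝕜 := ℝ)
    (fun x _ => (hℓ.hasDerivAt_path x).hasDerivWithinAt) (fun x _ => hB x) (mem_univ _) (mem_univ _)

/-- The distance from `ξ` to the points of the path outside a disk grows linearly. -/
theorem one_add_abs_le_of_le_norm {ξ : ℂ} {r : ℝ} (hr : 0 < r) {s : ℝ}
    (h : r ≤ ‖path ℓ s - ξ‖) : 1 + |s| ≤ (1 + (1 + ‖ξ‖) / r) * ‖path ℓ s - ξ‖ := by
  have h1 : |s| ≤ |s - ξ.re| + ‖ξ‖ := by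
    have := abs_add_le (s - ξ.re) ξ.re
    rw [sub_add_cancel] at this
    linarith [Complex.abs_re_le_norm ξ]
  have h2 := abs_sub_le_norm_path_sub ℓ s ξ
  have h3 : (1 + ‖ξ‖) ≤ (1 + ‖ξ‖) / r * ‖path ℓ s - ξ‖ := by
    rw [div_mul_eq_mul_div, le_div_iff₀ hr]
    exact mul_le_mul_of_nonneg_left h (by positivity)
  linarith

theorem IsContour.isOpen_off (hℓ : IsContour ℓ) : IsOpen {ξ : ℂ | ξ.im ≠ ℓ ξ.re} :=
  isOpen_ne_fun Complex.continuous_im (hℓ.continuous.comp Complex.continuous_re)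

theorem IsContour.isOpen_below (hℓ : IsContour ℓ) : IsOpen {ξ : ℂ | ξ.im < ℓ ξ.re} :=
  isOpen_lt Complex.continuous_im (hℓ.continuous.comp Complex.continuous_re)

theorem IsContour.isOpen_above (hℓ : IsContour ℓ) : IsOpen {ξ : ℂ | ℓ ξ.re < ξ.im} :=
  isOpen_lt (hℓ.continuous.comp Complex.continuous_re) Complex.continuous_im

theorem path_sub_ne_zero {ξ : ℂ} (h : ξ.im ≠ ℓ ξ.re) (s : ℝ) : path ℓ s - ξ ≠ 0 := by
  intro h0
  rw [sub_eq_zero] at h0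
  exact h (by rw [← h0]; simp)

theorem path_sub_ne_zero_of_re_ne {ξ : ℂ} {s : ℝ} (h : s ≠ ξ.re) : path ℓ s - ξ ≠ 0 := by
  intro h0
  rw [sub_eq_zero] at h0
  exact h (by rw [← h0]; simp)

theorem IsContour.exists_one_add_abs_le (hℓ : IsContour ℓ) {ξ : ℂ} (h : ξ.im ≠ ℓ ξ.re) :
    ∃ A : ℝ, 0 < A ∧ ∀ s, 1 + |s| ≤ A * ‖path ℓ s - ξ‖ := by
  obtain ⟨r, hr, hb⟩ := Metric.isOpen_iff.1 hℓ.isOpen_off ξ h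
  refine ⟨1 + (1 + ‖ξ‖) / r, by positivity, fun s => one_add_abs_le_of_le_norm hr ?_⟩
  by_contra! hlt
  have : path ℓ s ∈ {ξ : ℂ | ξ.im ≠ ℓ ξ.re} := hb (by rwa [mem_ball, dist_eq_norm])
  simp at this

theorem IsContour.neg_I_off (hℓ : IsContour ℓ) : (-Complex.I).im ≠ ℓ (-Complex.I).re := by
  simp [hℓ.zero]

theorem IsContour.path_add_I_ne_zero (hℓ : IsContour ℓ) (s : ℝ) : path ℓ s + Complex.I ≠ 0 := by
  simpa using path_sub_ne_zero hℓ.neg_I_off s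

theorem IsContour.exists_one_add_abs_le_add_I (hℓ : IsContour ℓ) :
    ∃ A : ℝ, 0 < A ∧ ∀ s, 1 + |s| ≤ A * ‖path ℓ s + Complex.I‖ := by
  simpa using hℓ.exists_one_add_abs_le hℓ.neg_I_off

end

section

variable {ℓ : ℝ → ℝ} {f g : ℂ → ℂ}

/-! ### Cauchy integrals with the singularity subtracted -/

/-- The densities for which Cauchy integrals over the path converge absolutely. -/
def Admissible (ℓ : ℝ → ℝ) (f : ℂ → ℂ) : Prop :=
  Integrable fun s : ℝ => f (path ℓ s) / ((1 + |s| : ℝ) : ℂ)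

/-- The integrand of `subtractedInt`. -/
def subtractedKernel (ℓ : ℝ → ℝ) (f : ℂ → ℂ) (ξ : ℂ) (s : ℝ) : ℂ :=
  dslope (fun t => f t * (t + Complex.I)) (path ℓ s) ξ / (path ℓ s + Complex.I) * pathDeriv ℓ s

/-- `∫_𝓛 (f(t) (t + i) - f(ξ) (ξ + i)) / ((t - ξ) (t + i)) dt`, a regularized Cauchy integral. -/
def subtractedInt (ℓ : ℝ → ℝ) (f : ℂ → ℂ) (ξ : ℂ) : ℂ := ∫ s : ℝ, subtractedKernel ℓ f ξ s

theorem integrable_inv_one_add_abs_sq : Integrable fun s : ℝ => ((1 + |s|) ^ 2)⁻¹ := by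
  have h := integrable_one_add_norm (E := ℝ) (μ := volume) (r := 2) (by simp)
  refine h.congr (Eventually.of_forall fun s => ?_)
  simp only [Real.norm_eq_abs]
  rw [Real.rpow_neg (by positivity)]
  norm_cast

theorem Admissible.norm_integrable (hf : Admissible ℓ f) :
    Integrable fun s : ℝ => ‖f (path ℓ s)‖ / (1 + |s|) := by
  refine hf.norm.congr (Eventually.of_forall fun s => ?_)
  simp only [norm_div, Complex.norm_real, Real.norm_eq_abs]
  rw [abs_of_pos (by positivity : (0 : ℝ) < 1 + |s|)]

theorem Admissible.aestronglyMeasurable (hf : Admissible ℓ f) :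
    AEStronglyMeasurable (fun s => f (path ℓ s)) := by
  have h2 : Continuous fun s : ℝ => ((1 + |s| : ℝ) : ℂ) := by fun_prop
  refine ((Integrable.aestronglyMeasurable hf).mul h2.aestronglyMeasurable).congr
    (Eventually.of_forall fun s => ?_)
  have : ((1 + |s| : ℝ) : ℂ) ≠ 0 := by
    exact_mod_cast (by positivity : (0 : ℝ) < 1 + |s|).ne'
  simp only [Pi.mul_apply]
  exact div_mul_cancel₀ _ this

theorem subtractedKernel_of_ne {ξ : ℂ} {s : ℝ} (h : path ℓ s - ξ ≠ 0) :
    subtractedKernel ℓ f ξ s = (f (path ℓ s) * (path ℓ s + Complex.I) - f ξ * (ξ + Complex.I))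
      / (path ℓ s - ξ) / (path ℓ s + Complex.I) * pathDeriv ℓ s := by
  have h' : ξ ≠ path ℓ s := fun h0 => h (by rw [← h0, sub_self])
  rw [subtractedKernel, dslope_of_ne _ h', slope_def_field, ← neg_sub ξ (path ℓ s),
    ← neg_sub (f ξ * (ξ + Complex.I)), neg_div_neg_eq]

theorem ae_path_sub_ne_zero (ℓ : ℝ → ℝ) (ξ : ℂ) : ∀ᵐ s : ℝ, path ℓ s - ξ ≠ 0 := by
  have h : ∀ᵐ s : ℝ, s ≠ ξ.re := by simp [ae_iff]
  filter_upwards [h] with s hs using path_sub_ne_zero_of_re_ne hs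

theorem subtractedKernel_aestronglyMeasurable (hℓ : IsContour ℓ) (hf : Admissible ℓ f) (ξ : ℂ) :
    AEStronglyMeasurable (subtractedKernel ℓ f ξ) := by
  have hp := hℓ.continuous_path
  have h2 : AEStronglyMeasurable fun s => (f (path ℓ s) * (path ℓ s + Complex.I)
      - f ξ * (ξ + Complex.I)) * (path ℓ s - ξ)⁻¹ * (path ℓ s + Complex.I)⁻¹ * pathDeriv ℓ s := by
    refine (((((hf.aestronglyMeasurable.mul
      (hp.add continuous_const).aestronglyMeasurable).sub aestronglyMeasurable_const).mul ?_).mul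
      ?_).mul hℓ.continuous_pathDeriv.aestronglyMeasurable)
    · exact ((hp.sub continuous_const).measurable.inv).aestronglyMeasurable
    · exact ((hp.add continuous_const).measurable.inv).aestronglyMeasurable
  refine h2.congr ?_
  filter_upwards [ae_path_sub_ne_zero ℓ ξ] with s hs
  rw [subtractedKernel_of_ne hs, div_eq_mul_inv, div_eq_mul_inv]

/-- Bound for the kernel away from the singularity. -/
theorem norm_subtractedKernel_le (hℓ : IsContour ℓ) {B A A' : ℝ}
    (hB : ∀ s, ‖pathDeriv ℓ s‖ ≤ B) {ξ : ℂ} {s : ℝ}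
    (hA0 : 0 < A) (hA : 1 + |s| ≤ A * ‖path ℓ s + Complex.I‖)
    (hA0' : 0 < A') (hA' : 1 + |s| ≤ A' * ‖path ℓ s - ξ‖) :
    ‖subtractedKernel ℓ f ξ s‖ ≤ B * (A' * (‖f (path ℓ s)‖ / (1 + |s|))
      + A * A' * ‖f ξ * (ξ + Complex.I)‖ * ((1 + |s|) ^ 2)⁻¹) := by
  have hs : (0 : ℝ) < 1 + |s| := by positivity
  have hz : path ℓ s - ξ ≠ 0 := by
    intro h0; rw [h0, norm_zero] at hA'; linarith
  have hI := hℓ.path_add_I_ne_zero s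
  have e : subtractedKernel ℓ f ξ s = (f (path ℓ s) / (path ℓ s - ξ)
      - f ξ * (ξ + Complex.I) / ((path ℓ s - ξ) * (path ℓ s + Complex.I))) * pathDeriv ℓ s := by
    rw [subtractedKernel_of_ne hz]; field_simp
  have h1 : ‖path ℓ s - ξ‖⁻¹ ≤ A' / (1 + |s|) := by
    rw [inv_le_comm₀ (norm_pos_iff.2 hz) (by positivity), inv_div, div_le_iff₀ hA0']
    linarith
  have h2 : ‖path ℓ s + Complex.I‖⁻¹ ≤ A / (1 + |s|) := by
    rw [inv_le_comm₀ (norm_pos_iff.2 hI) (by positivity), inv_div, div_le_iff₀ hA0]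
    linarith
  rw [e, norm_mul, mul_comm]
  have hB0 : 0 ≤ B := (norm_nonneg _).trans (hB s)
  refine mul_le_mul (hB s) ?_ (norm_nonneg _) hB0
  refine (norm_sub_le _ _).trans (add_le_add ?_ ?_)
  · rw [norm_div, div_eq_mul_inv]
    calc _ ≤ ‖f (path ℓ s)‖ * (A' / (1 + |s|)) := by gcongr
      _ = _ := by ring
  · rw [norm_div (f ξ * (ξ + Complex.I)), norm_mul (path ℓ s - ξ), div_eq_mul_inv, mul_inv]
    calc _ ≤ ‖f ξ * (ξ + Complex.I)‖ * ((A' / (1 + |s|)) * (A / (1 + |s|))) := by gcongr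
      _ = _ := by field_simp

theorem subtractedKernel_integrable_of_off (hℓ : IsContour ℓ) (hf : Admissible ℓ f) {ξ : ℂ}
    (hξ : ξ.im ≠ ℓ ξ.re) : Integrable (subtractedKernel ℓ f ξ) := by
  obtain ⟨B, hB1, hB⟩ := hℓ.exists_norm_pathDeriv_le
  obtain ⟨A, hA0, hA⟩ := hℓ.exists_one_add_abs_le_add_I
  obtain ⟨A', hA0', hA'⟩ := hℓ.exists_one_add_abs_le hξ
  exact (((hf.norm_integrable.const_mul _).add
    (integrable_inv_one_add_abs_sq.const_mul _)).const_mul B).mono'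
    (subtractedKernel_aestronglyMeasurable hℓ hf ξ)
    (Eventually.of_forall fun s => norm_subtractedKernel_le hℓ hB hA0 (hA s) hA0' (hA' s))

/-- Locally uniform bound for the kernel where the density is holomorphic, even on the path. -/
theorem exists_norm_subtractedKernel_le (hℓ : IsContour ℓ) {U : Set ℂ} (hU : IsOpen U)
    (hd : DifferentiableOn ℂ f U) {ξ₀ : ℂ} (h₀ : ξ₀ ∈ U) :
    ∃ r > 0, ball ξ₀ r ⊆ U ∧ ∃ K₁ K₂ : ℝ,
      (∀ ξ ∈ ball ξ₀ r, ∀ s, ‖subtractedKernel ℓ f ξ s‖ ≤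
        K₁ * (‖f (path ℓ s)‖ / (1 + |s|)) + K₂ * ((1 + |s|) ^ 2)⁻¹) ∧
      ∀ s, DifferentiableOn ℂ (fun ξ => subtractedKernel ℓ f ξ s) (ball ξ₀ r) := by
  obtain ⟨B, hB1, hB⟩ := hℓ.exists_norm_pathDeriv_le
  obtain ⟨A, hA0, hA⟩ := hℓ.exists_one_add_abs_le_add_I
  obtain ⟨ρ, hρ, hρU⟩ := Metric.isOpen_iff.1 hU ξ₀ h₀
  set ψ : ℂ → ℂ := fun t => f t * (t + Complex.I) with hψ
  have hψd : DifferentiableOn ℂ ψ U := hd.mul (by fun_prop)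
  -- The radius leaves room for nested balls r, 2r, 3r: the variable ξ stays in the first, path
  -- points count as near in the second, and the density is controlled on the third.
  set r := ρ / 6 with hr
  have hr0 : 0 < r := by positivity
  have hcU : closedBall ξ₀ (3 * r) ⊆ U := (closedBall_subset_ball (by linarith)).trans hρU
  obtain ⟨M, hM⟩ := (isCompact_closedBall ξ₀ (3 * r)).exists_bound_of_continuousOn
    (hψd.continuousOn.mono hcU)
  have hM0 : 0 ≤ M := (norm_nonneg _).trans (hM ξ₀ (mem_closedBall_self (by positivity)))
  have hbU : ball ξ₀ (3 * r) ⊆ U := ball_subset_closedBall.trans hcU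
  set A' : ℝ := 1 + (1 + (‖ξ₀‖ + r)) / r with hA'
  have hA'0 : 0 < A' := by positivity
  refine ⟨r, hr0, (ball_subset_ball (by linarith)).trans hρU, B * A',
    B * (A * A' * M) + M / (r / 2) * A * (1 + (‖ξ₀‖ + 2 * r)) * B, fun ξ hξ s => ?_, fun s => ?_⟩
  · have hs : (0 : ℝ) < 1 + |s| := by positivity
    have hξ2 : ξ ∈ ball ξ₀ (2 * r) := ball_subset_ball (by linarith) hξ
    have hsq : (0 : ℝ) ≤ ((1 + |s|) ^ 2)⁻¹ := by positivity
    -- Near points are handled by the difference quotient; the others are at distance at least r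
    -- from ξ, so the two terms of the kernel can be estimated separately.
    by_cases hn : path ℓ s ∈ ball ξ₀ (2 * r)
    · have h1 := norm_dslope_le_of_ball hr0 (hψd.mono hbU)
        (fun z hz => hM z (ball_subset_closedBall hz)) hn hξ2
      have h2 : ‖path ℓ s + Complex.I‖⁻¹ ≤ A / (1 + |s|) := by
        rw [inv_le_comm₀ (norm_pos_iff.2 (hℓ.path_add_I_ne_zero s)) (by positivity), inv_div,
          div_le_iff₀ hA0]
        linarith [hA s]
      have h3 : 1 + |s| ≤ 1 + (‖ξ₀‖ + 2 * r) := by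
        rw [mem_ball, dist_eq_norm] at hn
        have h4 := abs_sub_le_norm_path_sub ℓ s ξ₀
        have h5 := abs_add_le (s - ξ₀.re) ξ₀.re
        rw [sub_add_cancel] at h5
        linarith [Complex.abs_re_le_norm ξ₀]
      calc ‖subtractedKernel ℓ f ξ s‖
          = ‖dslope ψ (path ℓ s) ξ‖ * ‖path ℓ s + Complex.I‖⁻¹ * ‖pathDeriv ℓ s‖ := by
            rw [subtractedKernel, norm_mul, norm_div, div_eq_mul_inv]
        _ ≤ M / (r / 2) * (A / (1 + |s|)) * B := by
            gcongr
            exact hB s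
        _ = M / (r / 2) * A * (1 + |s|) * B * ((1 + |s|) ^ 2)⁻¹ := by field_simp
        _ ≤ M / (r / 2) * A * (1 + (‖ξ₀‖ + 2 * r)) * B * ((1 + |s|) ^ 2)⁻¹ := by gcongr
        _ ≤ _ := by
            have h6 : 0 ≤ B * A' * (‖f (path ℓ s)‖ / (1 + |s|)) := by positivity
            have h7 : 0 ≤ B * (A * A' * M) * ((1 + |s|) ^ 2)⁻¹ := by positivity
            nlinarith
    · have hfar : r ≤ ‖path ℓ s - ξ‖ := by
        rw [mem_ball, not_lt] at hn
        rw [mem_ball, dist_comm] at hξ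
        rw [← dist_eq_norm]
        have := dist_triangle (path ℓ s) ξ ξ₀
        rw [dist_comm ξ] at this
        linarith
      have h1 : 1 + |s| ≤ A' * ‖path ℓ s - ξ‖ := by
        refine (one_add_abs_le_of_le_norm hr0 hfar).trans ?_
        have : ‖ξ‖ ≤ ‖ξ₀‖ + r := by
          rw [mem_ball, dist_eq_norm] at hξ
          have := norm_add_le (ξ - ξ₀) ξ₀
          rw [sub_add_cancel] at this
          linarith
        rw [hA']
        gcongr
      refine (norm_subtractedKernel_le hℓ hB hA0 (hA s) hA'0 h1).trans ?_
      have h2 : ‖f ξ * (ξ + Complex.I)‖ ≤ M :=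
        hM ξ (ball_subset_closedBall (ball_subset_ball (by linarith) hξ))
      have h3 : 0 ≤ M / (r / 2) * A * (1 + (‖ξ₀‖ + 2 * r)) * B * ((1 + |s|) ^ 2)⁻¹ := by positivity
      have h4 : A * A' * ‖f ξ * (ξ + Complex.I)‖ * ((1 + |s|) ^ 2)⁻¹
          ≤ A * A' * M * ((1 + |s|) ^ 2)⁻¹ := by gcongr
      nlinarith
  · refine DifferentiableOn.mul_const (DifferentiableOn.div_const ?_ _) _
    -- If the pole lies in the domain of holomorphy, its singularity is removable; otherwise it is
    -- outside the small ball and nothing has to be removed.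
    by_cases hn : path ℓ s ∈ ball ξ₀ (3 * r)
    · exact ((Complex.differentiableOn_dslope (isOpen_ball.mem_nhds hn)).2
        (hψd.mono hbU)).mono (ball_subset_ball (by linarith))
    · have hn' : path ℓ s ∉ ball ξ₀ r := fun h => hn (ball_subset_ball (by linarith) h)
      exact (differentiableOn_dslope_of_notMem hn').2
        (hψd.mono ((ball_subset_ball (by linarith)).trans hbU))

theorem subtractedKernel_integrable (hℓ : IsContour ℓ) (hf : Admissible ℓ f) {U : Set ℂ}
    (hU : IsOpen U) (hd : DifferentiableOn ℂ f U) {ξ : ℂ} (hξ : ξ ∈ U) :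
    Integrable (subtractedKernel ℓ f ξ) := by
  obtain ⟨r, hr, -, K₁, K₂, hK, -⟩ := exists_norm_subtractedKernel_le hℓ hU hd hξ
  exact ((hf.norm_integrable.const_mul _).add (integrable_inv_one_add_abs_sq.const_mul _)).mono'
    (subtractedKernel_aestronglyMeasurable hℓ hf ξ)
    (Eventually.of_forall fun s => hK ξ (mem_ball_self hr) s)

/-- The position of the path relative to U plays no role, as the singularity of the integrand is
removable at each point of U. This is the source of every continuation across the path. -/
theorem subtractedInt_differentiableOn (hℓ : IsContour ℓ) (hf : Admissible ℓ f) {U : Set ℂ}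
    (hU : IsOpen U) (hd : DifferentiableOn ℂ f U) : DifferentiableOn ℂ (subtractedInt ℓ f) U := by
  intro ξ₀ h₀
  obtain ⟨r, hr, -, K₁, K₂, hK, hD⟩ := exists_norm_subtractedKernel_le hℓ hU hd h₀
  exact (differentiableAt_integral_of_bound hr
    (fun ξ _ => subtractedKernel_aestronglyMeasurable hℓ hf ξ)
    (Eventually.of_forall fun s ξ hξ => hK ξ hξ s)
    ((hf.norm_integrable.const_mul _).add (integrable_inv_one_add_abs_sq.const_mul _))
    (Eventually.of_forall hD)).differentiableWithinAt

/-- Only almost all values on the path and the single value at ξ matter, so a density may be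
replaced by whichever extension is holomorphic near ξ. -/
theorem subtractedInt_congr {ξ : ℂ} (h : ∀ᵐ s : ℝ, f (path ℓ s) = g (path ℓ s)) (hξ : f ξ = g ξ) :
    subtractedInt ℓ f ξ = subtractedInt ℓ g ξ := by
  refine integral_congr_ae ?_
  filter_upwards [h, ae_path_sub_ne_zero ℓ ξ] with s hs hs'
  rw [subtractedKernel_of_ne hs', subtractedKernel_of_ne hs', hs, hξ]

theorem cauchyInt_congr {ξ : ℂ} (h : ∀ᵐ s : ℝ, f (path ℓ s) = g (path ℓ s)) :
    cauchyInt ℓ f ξ = cauchyInt ℓ g ξ := by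
  refine integral_congr_ae ?_
  filter_upwards [h] with s hs
  rw [hs]

theorem Admissible.congr (hf : Admissible ℓ f) (h : ∀ᵐ s : ℝ, f (path ℓ s) = g (path ℓ s)) :
    Admissible ℓ g := by
  refine Integrable.congr hf ?_
  filter_upwards [h] with s hs
  rw [hs]

/-! ### The Cauchy kernel itself -/

/-- The Cauchy kernel at `ξ`, compared with the one at `-i`. -/
def comparisonKernel (ℓ : ℝ → ℝ) (ξ : ℂ) (s : ℝ) : ℂ :=
  ((path ℓ s - ξ)⁻¹ - (path ℓ s + Complex.I)⁻¹) * pathDeriv ℓ s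

theorem comparisonKernel_eq (hℓ : IsContour ℓ) {ξ : ℂ} {s : ℝ} (h : path ℓ s - ξ ≠ 0) :
    comparisonKernel ℓ ξ s
      = (ξ + Complex.I) / ((path ℓ s - ξ) * (path ℓ s + Complex.I)) * pathDeriv ℓ s := by
  have hI := hℓ.path_add_I_ne_zero s
  rw [comparisonKernel]
  congr 1
  field_simp
  ring

theorem comparisonKernel_measurable (hℓ : IsContour ℓ) (ξ : ℂ) :
    Measurable (comparisonKernel ℓ ξ) := by
  have hp := hℓ.continuous_path
  exact ((hp.sub continuous_const).measurable.inv.sub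
    (hp.add continuous_const).measurable.inv).mul hℓ.continuous_pathDeriv.measurable

theorem norm_comparisonKernel_le (hℓ : IsContour ℓ) {B A A' : ℝ}
    (hB : ∀ s, ‖pathDeriv ℓ s‖ ≤ B) {ξ : ℂ} {s : ℝ}
    (hA0 : 0 < A) (hA : 1 + |s| ≤ A * ‖path ℓ s + Complex.I‖)
    (hA0' : 0 < A') (hA' : 1 + |s| ≤ A' * ‖path ℓ s - ξ‖) :
    ‖comparisonKernel ℓ ξ s‖ ≤ B * (A * A' * ‖ξ + Complex.I‖) * ((1 + |s|) ^ 2)⁻¹ := by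
  have hz : path ℓ s - ξ ≠ 0 := by
    intro h0; rw [h0, norm_zero] at hA'; linarith [abs_nonneg s]
  have hI := hℓ.path_add_I_ne_zero s
  have h1 : ‖path ℓ s - ξ‖⁻¹ ≤ A' / (1 + |s|) := by
    rw [inv_le_comm₀ (norm_pos_iff.2 hz) (by positivity), inv_div, div_le_iff₀ hA0']
    linarith
  have h2 : ‖path ℓ s + Complex.I‖⁻¹ ≤ A / (1 + |s|) := by
    rw [inv_le_comm₀ (norm_pos_iff.2 hI) (by positivity), inv_div, div_le_iff₀ hA0]
    linarith
  have hB0 : 0 ≤ B := (norm_nonneg _).trans (hB s)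
  rw [comparisonKernel_eq hℓ hz, norm_mul, norm_div, norm_mul, div_eq_mul_inv, mul_inv]
  calc _ ≤ ‖ξ + Complex.I‖ * ((A' / (1 + |s|)) * (A / (1 + |s|))) * B := by
        gcongr
        exact hB s
    _ = _ := by field_simp

theorem comparisonKernel_integrable (hℓ : IsContour ℓ) {ξ : ℂ} (hξ : ξ.im ≠ ℓ ξ.re) :
    Integrable (comparisonKernel ℓ ξ) := by
  obtain ⟨B, hB1, hB⟩ := hℓ.exists_norm_pathDeriv_le
  obtain ⟨A, hA0, hA⟩ := hℓ.exists_one_add_abs_le_add_I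
  obtain ⟨A', hA0', hA'⟩ := hℓ.exists_one_add_abs_le hξ
  exact (integrable_inv_one_add_abs_sq.const_mul _).mono'
    (comparisonKernel_measurable hℓ ξ).aestronglyMeasurable
    (Eventually.of_forall fun s => norm_comparisonKernel_le hℓ hB hA0 (hA s) hA0' (hA' s))

/-- The identity holds pointwise for the integrands. It isolates the jump of the transform in an
elementary integral that no longer involves the density. -/
theorem cauchyInt_eq_subtractedInt (hℓ : IsContour ℓ) (hf : Admissible ℓ f) {ξ : ℂ}
    (hξ : ξ.im ≠ ℓ ξ.re) :
    cauchyInt ℓ f ξ = subtractedInt ℓ f ξ + f ξ * ∫ s, comparisonKernel ℓ ξ s := by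
  rw [subtractedInt, ← integral_const_mul, ← integral_add
    (subtractedKernel_integrable_of_off hℓ hf hξ) ((comparisonKernel_integrable hℓ hξ).const_mul _)]
  refine integral_congr_ae (Eventually.of_forall fun s => ?_)
  have hz := path_sub_ne_zero hξ s
  have hI := hℓ.path_add_I_ne_zero s
  simp only
  rw [subtractedKernel_of_ne hz, comparisonKernel_eq hℓ hz]
  field_simp
  ring

theorem cauchyInt_differentiableOn (hℓ : IsContour ℓ) (hf : Admissible ℓ f) :
    DifferentiableOn ℂ (cauchyInt ℓ f) {ξ | ξ.im ≠ ℓ ξ.re} := by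
  classical
  -- Off the path the density is arbitrary. Setting it to zero there makes it holomorphic on the
  -- complement and makes the subtracted term vanish.
  set g : ℂ → ℂ := fun ξ => if ξ.im = ℓ ξ.re then f ξ else 0 with hg
  have hfg : ∀ᵐ s : ℝ, f (path ℓ s) = g (path ℓ s) := Eventually.of_forall fun s => by simp [hg]
  have hg0 : DifferentiableOn ℂ g {ξ | ξ.im ≠ ℓ ξ.re} :=
    (differentiableOn_const (c := (0 : ℂ))).congr fun ξ hξ => if_neg hξ
  refine (subtractedInt_differentiableOn hℓ (hf.congr hfg) hℓ.isOpen_off hg0).congr fun ξ hξ => ?_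
  rw [cauchyInt_congr hfg, cauchyInt_eq_subtractedInt hℓ (hf.congr hfg) hξ, hg]
  simp only
  rw [if_neg hξ, zero_mul, add_zero]

end

section

variable {ℓ : ℝ → ℝ} {f g : ℂ → ℂ}

/-! ### Values of the Cauchy kernel integral -/

theorem I_mul_mem_slitPlane {z : ℂ} (h : z.im < 0 ∨ z.re ≠ 0) :
    Complex.I * z ∈ Complex.slitPlane := by
  rw [Complex.mem_slitPlane_iff]; simpa using h

theorem neg_I_mul_mem_slitPlane {z : ℂ} (h : 0 < z.im ∨ z.re ≠ 0) :
    -Complex.I * z ∈ Complex.slitPlane := by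
  rw [Complex.mem_slitPlane_iff]; simpa using h

theorem hasDerivAt_log_path (hℓ : IsContour ℓ) {w ξ : ℂ} (hw : w ≠ 0) {s : ℝ}
    (h : w * (path ℓ s - ξ) ∈ Complex.slitPlane) :
    HasDerivAt (fun s => Complex.log (w * (path ℓ s - ξ)))
      ((path ℓ s - ξ)⁻¹ * pathDeriv ℓ s) s := by
  have h1 := (((hℓ.hasDerivAt_path s).sub_const ξ).const_mul w).clog_real h
  have h2 : path ℓ s - ξ ≠ 0 := right_ne_zero_of_mul (Complex.slitPlane_ne_zero h)
  convert h1 using 1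
  field_simp

theorem tendsto_path_sub_div_atTop (hℓ : IsContour ℓ) (ξ : ℂ) :
    Tendsto (fun s : ℝ => (path ℓ s - ξ) * (s : ℂ)⁻¹) atTop (𝓝 1) := by
  have h1 : Tendsto (fun s : ℝ => ((s⁻¹ : ℝ) : ℂ)) atTop (𝓝 0) := by
    exact_mod_cast (Complex.continuous_ofReal.tendsto 0).comp tendsto_inv_atTop_zero
  have h2 : Tendsto (fun s : ℝ => ((ℓ s : ℝ) : ℂ)) atTop (𝓝 0) := by
    exact_mod_cast (Complex.continuous_ofReal.tendsto 0).comp hℓ.tendsto_atTop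
  have h3 : Tendsto (fun s : ℝ => 1 + (((ℓ s : ℝ) : ℂ) * Complex.I - ξ) * ((s⁻¹ : ℝ) : ℂ)) atTop
      (𝓝 (1 + (0 * Complex.I - ξ) * 0)) :=
    (((h2.mul_const _).sub_const _).mul h1).const_add 1
  rw [mul_zero, add_zero] at h3
  refine h3.congr' ?_
  filter_upwards [eventually_gt_atTop 0] with s hs
  have : (s : ℂ) ≠ 0 := by exact_mod_cast hs.ne'
  rw [path]; push_cast; field_simp; ring

theorem tendsto_path_sub_div_atBot (hℓ : IsContour ℓ) (ξ : ℂ) :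
    Tendsto (fun s : ℝ => (path ℓ s - ξ) * (s : ℂ)⁻¹) atBot (𝓝 1) := by
  have h1 : Tendsto (fun s : ℝ => ((s⁻¹ : ℝ) : ℂ)) atBot (𝓝 0) := by
    exact_mod_cast (Complex.continuous_ofReal.tendsto 0).comp tendsto_inv_atBot_zero
  have h2 : Tendsto (fun s : ℝ => ((ℓ s : ℝ) : ℂ)) atBot (𝓝 0) := by
    exact_mod_cast (Complex.continuous_ofReal.tendsto 0).comp hℓ.tendsto_atBot
  have h3 : Tendsto (fun s : ℝ => 1 + (((ℓ s : ℝ) : ℂ) * Complex.I - ξ) * ((s⁻¹ : ℝ) : ℂ)) atBot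
      (𝓝 (1 + (0 * Complex.I - ξ) * 0)) :=
    (((h2.mul_const _).sub_const _).mul h1).const_add 1
  rw [mul_zero, add_zero] at h3
  refine h3.congr' ?_
  filter_upwards [eventually_lt_atBot 0] with s hs
  have : (s : ℂ) ≠ 0 := by exact_mod_cast hs.ne
  rw [path]; push_cast; field_simp; ring

/-- The path is asymptotic to the real axis, so w (path - ξ) is |s| times a quantity tending to wσ,
where σ is the sign of s. A positive factor splits off the principal logarithm without changing the
branch. -/
theorem tendsto_log_path_sub_log {l : Filter ℝ} {σ : ℝ} (hσ : ∀ᶠ s in l, |s| = σ * s ∧ 0 < |s|)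
    {ξ : ℂ} (hl : Tendsto (fun s : ℝ => (path ℓ s - ξ) * (s : ℂ)⁻¹) l (𝓝 1)) (hσ1 : σ * σ = 1)
    {w : ℂ} (hw : w * σ ∈ Complex.slitPlane) :
    Tendsto (fun s => Complex.log (w * (path ℓ s - ξ)) - (Real.log |s| : ℂ)) l
      (𝓝 (Complex.log (w * σ))) := by
  have h1 : Tendsto (fun s : ℝ => w * σ * ((path ℓ s - ξ) * (s : ℂ)⁻¹)) l (𝓝 (w * σ)) := by
    simpa using hl.const_mul (w * σ)
  have h2 := (continuousAt_clog hw).tendsto.comp h1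
  refine h2.congr' ?_
  have hne := h1.eventually_ne (Complex.slitPlane_ne_zero hw)
  filter_upwards [hσ, hne] with s ⟨hs, hs0⟩ hs1
  have hs2 : (s : ℂ) ≠ 0 := by exact_mod_cast abs_pos.1 hs0
  have hσ2 : (σ : ℂ) * σ = 1 := by exact_mod_cast hσ1
  have e : w * (path ℓ s - ξ) = ((|s| : ℝ) : ℂ) * (w * σ * ((path ℓ s - ξ) * (s : ℂ)⁻¹)) := by
    rw [hs]; push_cast; field_simp
    linear_combination (-(w * (path ℓ s - ξ))) * hσ2
  rw [e, Complex.log_ofReal_mul hs0 hs1]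
  simp

theorem tendsto_log_path_sub_log_atTop (hℓ : IsContour ℓ) (ξ : ℂ) {w : ℂ}
    (hw : w ∈ Complex.slitPlane) :
    Tendsto (fun s => Complex.log (w * (path ℓ s - ξ)) - (Real.log |s| : ℂ)) atTop
      (𝓝 (Complex.log w)) := by
  have h := tendsto_log_path_sub_log (σ := 1) (w := w) ?_ (tendsto_path_sub_div_atTop hℓ ξ)
    (by norm_num) (by simpa using hw)
  · simpa using h
  · filter_upwards [eventually_gt_atTop 0] with s hs
    rw [abs_of_pos hs, one_mul]; exact ⟨rfl, hs⟩

theorem tendsto_log_path_sub_log_atBot (hℓ : IsContour ℓ) (ξ : ℂ) {w : ℂ}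
    (hw : -w ∈ Complex.slitPlane) :
    Tendsto (fun s => Complex.log (w * (path ℓ s - ξ)) - (Real.log |s| : ℂ)) atBot
      (𝓝 (Complex.log (-w))) := by
  have h := tendsto_log_path_sub_log (σ := -1) (w := w) ?_ (tendsto_path_sub_div_atBot hℓ ξ)
    (by norm_num) (by simpa using hw)
  · simpa using h
  · filter_upwards [eventually_lt_atBot 0] with s hs
    rw [abs_of_neg hs, neg_one_mul]; exact ⟨rfl, by linarith⟩

theorem I_mem_slitPlane : Complex.I ∈ Complex.slitPlane := by simp [Complex.mem_slitPlane_iff]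

theorem neg_I_mem_slitPlane : -Complex.I ∈ Complex.slitPlane := by
  simp [Complex.mem_slitPlane_iff]

/-- A primitive of `comparisonKernel`. -/
def logRatio (ℓ : ℝ → ℝ) (w ξ : ℂ) (s : ℝ) : ℂ :=
  Complex.log (w * (path ℓ s - ξ)) - Complex.log (-Complex.I * (path ℓ s - -Complex.I))

theorem IsContour.neg_I_mul_mem (hℓ : IsContour ℓ) (s : ℝ) :
    -Complex.I * (path ℓ s - -Complex.I) ∈ Complex.slitPlane := by
  refine neg_I_mul_mem_slitPlane ?_
  by_cases hs : s = 0
  · left; simp [hs, hℓ.zero]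
  · right; simpa using hs

theorem hasDerivAt_logRatio (hℓ : IsContour ℓ) {w ξ : ℂ} (hw : w ≠ 0) {s : ℝ}
    (h : w * (path ℓ s - ξ) ∈ Complex.slitPlane) :
    HasDerivAt (logRatio ℓ w ξ) (comparisonKernel ℓ ξ s) s := by
  have h1 := (hasDerivAt_log_path hℓ hw h).sub
    (hasDerivAt_log_path hℓ (neg_ne_zero.2 Complex.I_ne_zero) (hℓ.neg_I_mul_mem s))
  refine h1.congr_deriv ?_
  rw [comparisonKernel, sub_neg_eq_add, sub_mul]

theorem tendsto_logRatio_atTop (hℓ : IsContour ℓ) (ξ : ℂ) {w : ℂ} (hw : w ∈ Complex.slitPlane) :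
    Tendsto (logRatio ℓ w ξ) atTop (𝓝 (Complex.log w - Complex.log (-Complex.I))) := by
  refine ((tendsto_log_path_sub_log_atTop hℓ ξ hw).sub
    (tendsto_log_path_sub_log_atTop hℓ (-Complex.I) neg_I_mem_slitPlane)).congr fun s => ?_
  rw [logRatio]; ring

theorem tendsto_logRatio_atBot (hℓ : IsContour ℓ) (ξ : ℂ) {w : ℂ} (hw : -w ∈ Complex.slitPlane) :
    Tendsto (logRatio ℓ w ξ) atBot (𝓝 (Complex.log (-w) - Complex.log Complex.I)) := by
  have h := tendsto_log_path_sub_log_atBot hℓ (-Complex.I) (w := -Complex.I)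
    (by simpa using I_mem_slitPlane)
  rw [neg_neg] at h
  refine ((tendsto_log_path_sub_log_atBot hℓ ξ hw).sub h).congr fun s => ?_
  rw [logRatio]; ring

/-- With w = i the curve i (path - ξ) avoids the cut: it can be real only above or below ξ, and the
path passes below ξ, where the value is positive. The limits at both ends then differ by 2πi,
through the logarithms of i and -i. -/
theorem integral_comparisonKernel_above (hℓ : IsContour ℓ) {ξ : ℂ} (h : ℓ ξ.re < ξ.im) :
    ∫ s, comparisonKernel ℓ ξ s = 2 * Real.pi * Complex.I := by
  rw [integral_of_hasDerivAt_of_tendsto (fun s => hasDerivAt_logRatio hℓ Complex.I_ne_zero ?_)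
    (comparisonKernel_integrable hℓ h.ne') (tendsto_logRatio_atBot hℓ ξ neg_I_mem_slitPlane)
    (tendsto_logRatio_atTop hℓ ξ I_mem_slitPlane)]
  · rw [Complex.log_I, Complex.log_neg_I]; ring
  · refine I_mul_mem_slitPlane ?_
    by_cases hs : s = ξ.re
    · left; simp only [Complex.sub_im, path_im, hs]; linarith
    · right; simpa [sub_eq_zero] using hs

/-- Now ξ and -i are on the same side, so w = -i serves both logarithms and the limits of their
difference vanish at both ends. -/
theorem integral_comparisonKernel_below (hℓ : IsContour ℓ) {ξ : ℂ} (h : ξ.im < ℓ ξ.re) :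
    ∫ s, comparisonKernel ℓ ξ s = 0 := by
  rw [integral_of_hasDerivAt_of_tendsto
    (fun s => hasDerivAt_logRatio hℓ (neg_ne_zero.2 Complex.I_ne_zero) ?_)
    (comparisonKernel_integrable hℓ h.ne)
    (tendsto_logRatio_atBot hℓ ξ (by simpa using I_mem_slitPlane))
    (tendsto_logRatio_atTop hℓ ξ neg_I_mem_slitPlane)]
  · simp
  · refine neg_I_mul_mem_slitPlane ?_
    by_cases hs : s = ξ.re
    · left; simp only [Complex.sub_im, path_im, hs]; linarith
    · right; simpa [sub_eq_zero] using hs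

theorem comparisonKernel_integrableOn (hℓ : IsContour ℓ) {ξ : ℂ} {r : ℝ} (hr : 0 < r) {S : Set ℝ}
    (hSm : MeasurableSet S) (hS : ∀ s ∈ S, r ≤ ‖path ℓ s - ξ‖) :
    IntegrableOn (comparisonKernel ℓ ξ) S := by
  obtain ⟨B, hB1, hB⟩ := hℓ.exists_norm_pathDeriv_le
  obtain ⟨A, hA0, hA⟩ := hℓ.exists_one_add_abs_le_add_I
  refine (integrable_inv_one_add_abs_sq.const_mul
    (B * (A * (1 + (1 + ‖ξ‖) / r) * ‖ξ + Complex.I‖))).integrableOn.mono'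
    (comparisonKernel_measurable hℓ ξ).aestronglyMeasurable.restrict
    ((ae_restrict_iff' hSm).2 (Eventually.of_forall fun s hs => ?_))
  exact norm_comparisonKernel_le hℓ hB hA0 (hA s) (by positivity)
    (one_add_abs_le_of_le_norm hr (hS s hs))

/-- Once the parameter of the singular point is removed, path - ξ has nonzero real part, so one
branch of the logarithm is a primitive on both sides. The ends at infinity give 2πi as above, and
the inner ends give the bracket. -/
theorem integral_comparisonKernel_symmetric (hℓ : IsContour ℓ) (s₀ : ℝ) {δ : ℝ} (hδ : 0 < δ) :
    ∫ s in {s : ℝ | δ < |s - s₀|}, comparisonKernel ℓ (path ℓ s₀) s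
      = 2 * Real.pi * Complex.I
        + (logRatio ℓ Complex.I (path ℓ s₀) (s₀ - δ)
          - logRatio ℓ Complex.I (path ℓ s₀) (s₀ + δ)) := by
  have hset : {s : ℝ | δ < |s - s₀|} = Iio (s₀ - δ) ∪ Ioi (s₀ + δ) := by
    ext s
    simp only [mem_ofPred_eq, mem_union, mem_Iio, mem_Ioi, lt_abs]
    constructor
    · rintro (h | h)
      · right; linarith
      · left; linarith
    · rintro (h | h)
      · right; linarith
      · left; linarith
  have hd : ∀ s : ℝ, s ≠ s₀ → HasDerivAt (logRatio ℓ Complex.I (path ℓ s₀))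
      (comparisonKernel ℓ (path ℓ s₀) s) s := fun s hs =>
    hasDerivAt_logRatio hℓ Complex.I_ne_zero
      (I_mul_mem_slitPlane (Or.inr (by simpa [sub_eq_zero] using hs)))
  have hint : ∀ S : Set ℝ, MeasurableSet S → (∀ s ∈ S, δ ≤ |s - s₀|) →
      IntegrableOn (comparisonKernel ℓ (path ℓ s₀)) S := fun S hSm hS =>
    comparisonKernel_integrableOn hℓ hδ hSm fun s hs =>
      (hS s hs).trans (by simpa using abs_sub_le_norm_path_sub ℓ s (path ℓ s₀))
  have hI1 : IntegrableOn (comparisonKernel ℓ (path ℓ s₀)) (Iic (s₀ - δ)) :=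
    hint _ measurableSet_Iic fun s hs => by
      rw [mem_Iic] at hs; rw [abs_sub_comm]; exact le_trans (by linarith) (le_abs_self _)
  have hI2 : IntegrableOn (comparisonKernel ℓ (path ℓ s₀)) (Ioi (s₀ + δ)) :=
    hint _ measurableSet_Ioi fun s hs => by
      rw [mem_Ioi] at hs; exact le_trans (by linarith) (le_abs_self _)
  rw [hset, setIntegral_union (by
      rw [Set.disjoint_left]; intro s hs hs'; rw [mem_Iio] at hs; rw [mem_Ioi] at hs'; linarith)
    measurableSet_Ioi (hI1.mono_set Iio_subset_Iic_self) hI2, ← integral_Iic_eq_integral_Iio,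
    integral_Iic_of_hasDerivAt_of_tendsto
      (hd _ (by linarith)).continuousAt.continuousWithinAt
      (fun s hs => hd s (by rw [mem_Iio] at hs; linarith)) hI1
      (tendsto_logRatio_atBot hℓ _ neg_I_mem_slitPlane),
    integral_Ioi_of_hasDerivAt_of_tendsto
      (hd _ (by linarith)).continuousAt.continuousWithinAt
      (fun s hs => hd s (by rw [mem_Ioi] at hs; linarith)) hI2
      (tendsto_logRatio_atTop hℓ _ I_mem_slitPlane), Complex.log_I, Complex.log_neg_I]
  ring

theorem pathDeriv_re (ℓ : ℝ → ℝ) (s : ℝ) : (pathDeriv ℓ s).re = 1 := by simp [pathDeriv]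

theorem tendsto_path_slope (hℓ : IsContour ℓ) (s₀ : ℝ) :
    Tendsto (fun δ : ℝ => ((δ : ℂ))⁻¹ * (path ℓ (s₀ + δ) - path ℓ s₀)) (𝓝[≠] 0)
      (𝓝 (pathDeriv ℓ s₀)) := by
  refine (hasDerivAt_iff_tendsto_slope_zero.1 (hℓ.hasDerivAt_path s₀)).congr fun δ => ?_
  rw [Complex.real_smul]; push_cast; rfl

/-- To first order the inner ends are i times ∓δ times the tangent vector. The positive factor δ
cancels between the two logarithms, and what is left compares log(-z) with log z for Im z > 0, since
the tangent has real part 1; the difference is -πi. -/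
theorem tendsto_logRatio_jump (hℓ : IsContour ℓ) (s₀ : ℝ) :
    Tendsto (fun δ : ℝ => logRatio ℓ Complex.I (path ℓ s₀) (s₀ - δ)
      - logRatio ℓ Complex.I (path ℓ s₀) (s₀ + δ)) (𝓝[>] 0) (𝓝 (-(Real.pi * Complex.I))) := by
  have hp := pathDeriv_re ℓ s₀
  have hreg : Tendsto (fun δ : ℝ =>
      Complex.log (-Complex.I * (path ℓ (s₀ + δ) - -Complex.I))
      - Complex.log (-Complex.I * (path ℓ (s₀ - δ) - -Complex.I))) (𝓝[>] 0) (𝓝 0) := by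
    have hc : ContinuousAt (fun s => Complex.log (-Complex.I * (path ℓ s - -Complex.I))) s₀ :=
      (hasDerivAt_log_path hℓ (neg_ne_zero.2 Complex.I_ne_zero) (hℓ.neg_I_mul_mem s₀)).continuousAt
    have h1 : Tendsto (fun δ : ℝ => s₀ + δ) (𝓝[>] 0) (𝓝 s₀) := by
      have : Tendsto (fun δ : ℝ => s₀ + δ) (𝓝 0) (𝓝 (s₀ + 0)) :=
        Continuous.tendsto (f := fun δ : ℝ => s₀ + δ) (by fun_prop) 0
      rw [add_zero] at this
      exact this.mono_left nhdsWithin_le_nhds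
    have h2 : Tendsto (fun δ : ℝ => s₀ - δ) (𝓝[>] 0) (𝓝 s₀) := by
      have : Tendsto (fun δ : ℝ => s₀ - δ) (𝓝 0) (𝓝 (s₀ - 0)) :=
        Continuous.tendsto (f := fun δ : ℝ => s₀ - δ) (by fun_prop) 0
      rw [sub_zero] at this
      exact this.mono_left nhdsWithin_le_nhds
    simpa using (hc.tendsto.comp h1).sub (hc.tendsto.comp h2)
  have hmain : ∀ σ : ℝ, σ ≠ 0 → Tendsto (fun δ : ℝ =>
      Complex.log (Complex.I * σ * (((σ * δ : ℝ) : ℂ)⁻¹ * (path ℓ (s₀ + σ * δ) - path ℓ s₀))))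
      (𝓝[>] 0) (𝓝 (Complex.log (Complex.I * σ * pathDeriv ℓ s₀))) := by
    intro σ hσ
    have h1 : Tendsto (fun δ : ℝ => σ * δ) (𝓝[>] 0) (𝓝[≠] 0) := by
      refine tendsto_nhdsWithin_iff.2 ⟨?_, ?_⟩
      · have : Tendsto (fun δ : ℝ => σ * δ) (𝓝 0) (𝓝 (σ * 0)) :=
          Continuous.tendsto (f := fun δ : ℝ => σ * δ) (by fun_prop) 0
        rw [mul_zero] at this
        exact this.mono_left nhdsWithin_le_nhds
      · filter_upwards [self_mem_nhdsWithin] with δ hδ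
        exact mul_ne_zero hσ (ne_of_gt hδ)
    refine (continuousAt_clog ?_).tendsto.comp
      (((tendsto_path_slope hℓ s₀).comp h1).const_mul _)
    rw [mul_assoc]
    refine I_mul_mem_slitPlane (Or.inr ?_)
    simpa [hp] using hσ
  have h := ((hmain (-1) (by norm_num)).sub (hmain 1 one_ne_zero)).add hreg
  have hval : Complex.log (Complex.I * ((-1 : ℝ) : ℂ) * pathDeriv ℓ s₀)
      - Complex.log (Complex.I * ((1 : ℝ) : ℂ) * pathDeriv ℓ s₀) + 0 = -(Real.pi * Complex.I) := by
    have e1 : Complex.I * ((-1 : ℝ) : ℂ) * pathDeriv ℓ s₀ = -(Complex.I * pathDeriv ℓ s₀) := by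
      push_cast; ring
    have e2 : Complex.I * ((1 : ℝ) : ℂ) * pathDeriv ℓ s₀ = Complex.I * pathDeriv ℓ s₀ := by
      push_cast; ring
    have him : 0 < (Complex.I * pathDeriv ℓ s₀).im := by simp [hp]
    rw [e1, e2, Complex.log, Complex.log, norm_neg, Complex.arg_neg_eq_arg_sub_pi_of_im_pos him]
    push_cast; ring
  rw [hval] at h
  refine h.congr' ?_
  filter_upwards [self_mem_nhdsWithin] with δ hδ
  have hδ' : (0 : ℝ) < δ := hδ
  have hδc : (δ : ℂ) ≠ 0 := by exact_mod_cast hδ'.ne'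
  have hlog : ∀ z : ℂ, z ≠ 0 → Complex.log (Complex.I * (((δ : ℝ) : ℂ)⁻¹ * z))
      = Complex.log (Complex.I * z) - Real.log δ := by
    intro z hz
    have e : Complex.I * z = ((δ : ℝ) : ℂ) * (Complex.I * (((δ : ℝ) : ℂ)⁻¹ * z)) := by field_simp
    rw [e, Complex.log_ofReal_mul hδ' (by simp [hz, hδ'.ne'])]
    simp
  have e1 : Complex.I * ((-1 : ℝ) : ℂ) * ((((-1) * δ : ℝ) : ℂ)⁻¹
      * (path ℓ (s₀ + (-1) * δ) - path ℓ s₀))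
      = Complex.I * (((δ : ℝ) : ℂ)⁻¹ * (path ℓ (s₀ - δ) - path ℓ s₀)) := by
    rw [show s₀ + (-1) * δ = s₀ - δ by ring]; push_cast; field_simp
  have e2 : Complex.I * ((1 : ℝ) : ℂ) * (((1 * δ : ℝ) : ℂ)⁻¹
      * (path ℓ (s₀ + 1 * δ) - path ℓ s₀))
      = Complex.I * (((δ : ℝ) : ℂ)⁻¹ * (path ℓ (s₀ + δ) - path ℓ s₀)) := by
    rw [one_mul]; push_cast; ring
  rw [e1, e2, hlog _ (path_sub_ne_zero_of_re_ne (by simp [hδ'.ne'])),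
    hlog _ (path_sub_ne_zero_of_re_ne (by simp [hδ'.ne'])), logRatio, logRatio]
  ring

theorem tendsto_integral_comparisonKernel_symmetric (hℓ : IsContour ℓ) (s₀ : ℝ) :
    Tendsto (fun δ : ℝ => ∫ s in {s : ℝ | δ < |s - s₀|}, comparisonKernel ℓ (path ℓ s₀) s)
      (𝓝[>] 0) (𝓝 (Real.pi * Complex.I)) := by
  have h := (tendsto_logRatio_jump hℓ s₀).const_add (2 * Real.pi * Complex.I)
  rw [show 2 * (Real.pi : ℂ) * Complex.I + -(Real.pi * Complex.I) = Real.pi * Complex.I by ring]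
    at h
  refine h.congr' ?_
  filter_upwards [self_mem_nhdsWithin] with δ hδ
  exact (integral_comparisonKernel_symmetric hℓ s₀ hδ).symm

end

/-! ### Principal values and the Plemelj formulas -/

section

variable {ℓ : ℝ → ℝ} {f g : ℂ → ℂ}

theorem measurableSet_path_far (hℓ : IsContour ℓ) (ξ : ℂ) (ε : ℝ) :
    MeasurableSet {s : ℝ | ε < ‖path ℓ s - ξ‖} :=
  measurableSet_lt measurable_const (hℓ.continuous_path.sub continuous_const).norm.measurable

theorem measurableSet_abs_far (s₀ δ : ℝ) : MeasurableSet {s : ℝ | δ < |s - s₀|} :=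
  measurableSet_lt measurable_const (continuous_id.sub continuous_const).abs.measurable

/-- The difference of the truncations by disks and by symmetric intervals. -/
def truncationDiff (ℓ : ℝ → ℝ) (s₀ c ε s : ℝ) : ℂ :=
  {s : ℝ | ε < ‖path ℓ s - path ℓ s₀‖}.indicator (comparisonKernel ℓ (path ℓ s₀)) s
    - {s : ℝ | c * ε < |s - s₀|}.indicator (comparisonKernel ℓ (path ℓ s₀)) s

theorem truncationDiff_eq_zero {s₀ c ε s : ℝ}
    (h : ε < ‖path ℓ s - path ℓ s₀‖ ↔ c * ε < |s - s₀|) : truncationDiff ℓ s₀ c ε s = 0 := by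
  by_cases h1 : ε < ‖path ℓ s - path ℓ s₀‖
  · rw [truncationDiff, indicator_of_mem (show s ∈ _ from h1),
      indicator_of_mem (show s ∈ {s : ℝ | c * ε < |s - s₀|} from h.1 h1), sub_self]
  · rw [truncationDiff, indicator_of_notMem (show s ∉ _ from h1),
      indicator_of_notMem (show s ∉ {s : ℝ | c * ε < |s - s₀|} from fun h2 => h1 (h.2 h2)),
      sub_self]

theorem norm_truncationDiff_le (ℓ : ℝ → ℝ) (s₀ c ε s : ℝ) :
    ‖truncationDiff ℓ s₀ c ε s‖ ≤ ‖comparisonKernel ℓ (path ℓ s₀) s‖ := by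
  rw [truncationDiff]
  by_cases h1 : s ∈ {s : ℝ | ε < ‖path ℓ s - path ℓ s₀‖} <;>
  by_cases h2 : s ∈ {s : ℝ | c * ε < |s - s₀|} <;>
  simp only [indicator_of_mem, indicator_of_notMem, h1, h2, not_false_eq_true] <;> simp

theorem one_le_norm_pathDeriv (ℓ : ℝ → ℝ) (s : ℝ) : 1 ≤ ‖pathDeriv ℓ s‖ := by
  have := Complex.abs_re_le_norm (pathDeriv ℓ s)
  rwa [pathDeriv_re, abs_one] at this

theorem tendsto_norm_path_slope (hℓ : IsContour ℓ) (s₀ : ℝ) {u : ℝ} (hu : u ≠ 0) :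
    Tendsto (fun ε : ℝ => ‖path ℓ (s₀ + ε * u) - path ℓ s₀‖ / ε) (𝓝[>] 0)
      (𝓝 (|u| * ‖pathDeriv ℓ s₀‖)) := by
  have h1 : Tendsto (fun ε : ℝ => ε * u) (𝓝[>] 0) (𝓝[≠] 0) := by
    refine tendsto_nhdsWithin_iff.2 ⟨?_, ?_⟩
    · have : Tendsto (fun ε : ℝ => ε * u) (𝓝 0) (𝓝 (0 * u)) :=
        Continuous.tendsto (f := fun ε : ℝ => ε * u) (by fun_prop) 0
      rw [zero_mul] at this
      exact this.mono_left nhdsWithin_le_nhds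
    · filter_upwards [self_mem_nhdsWithin] with ε hε
      exact mul_ne_zero (ne_of_gt hε) hu
  refine (((tendsto_path_slope hℓ s₀).comp h1).norm.const_mul |u|).congr' ?_
  filter_upwards [self_mem_nhdsWithin] with ε hε
  have hε' : (0 : ℝ) < ε := hε
  have hu' : |u| ≠ 0 := abs_ne_zero.2 hu
  simp only [Function.comp, norm_mul, norm_inv, Complex.norm_real, Real.norm_eq_abs,
    abs_of_pos hε']
  field_simp

/-- A disk of radius ε cuts out, to first order, the parameters with |s - s₀| < cε, where c is the
inverse speed of the path. Rescaling s = s₀ + εu turns the ε-dependent region of disagreement into a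
bounded set of u that shrinks to a null set, while ε times the kernel remains bounded there. -/
theorem tendsto_integral_truncationDiff (hℓ : IsContour ℓ) (s₀ : ℝ) :
    Tendsto (fun ε : ℝ => ∫ s, truncationDiff ℓ s₀ (‖pathDeriv ℓ s₀‖⁻¹) ε s) (𝓝[>] 0)
      (𝓝 0) := by
  obtain ⟨B, hB1, hB⟩ := hℓ.exists_norm_pathDeriv_le
  obtain ⟨A, hA0, hA⟩ := hℓ.exists_one_add_abs_le_add_I
  set c := ‖pathDeriv ℓ s₀‖⁻¹ with hc
  have hd0 : 0 < ‖pathDeriv ℓ s₀‖ := lt_of_lt_of_le one_pos (one_le_norm_pathDeriv ℓ s₀)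
  have hc1 : c ≤ 1 := inv_le_one_of_one_le₀ (one_le_norm_pathDeriv ℓ s₀)
  have hc0 : 0 < c := inv_pos.2 hd0
  have hcB : B⁻¹ ≤ c := by
    rw [hc]; exact inv_anti₀ hd0 (hB s₀)
  have hsubst : ∀ ε : ℝ, 0 < ε → ∫ s, truncationDiff ℓ s₀ c ε s
      = ∫ u, (ε : ℂ) * truncationDiff ℓ s₀ c ε (s₀ + ε * u) := by
    intro ε hε
    have h1 := Measure.integral_comp_mul_left (fun v => truncationDiff ℓ s₀ c ε (s₀ + v)) ε
    rw [integral_add_left_eq_self (fun v => truncationDiff ℓ s₀ c ε v) s₀] at h1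
    rw [integral_const_mul, h1, abs_of_pos (inv_pos.2 hε), Complex.real_smul, ← mul_assoc]
    have : (ε : ℂ) ≠ 0 := by exact_mod_cast hε.ne'
    push_cast
    rw [mul_inv_cancel₀ this, one_mul]
  have hlim : Tendsto (fun ε : ℝ => ∫ u, (ε : ℂ) * truncationDiff ℓ s₀ c ε (s₀ + ε * u)) (𝓝[>] 0)
      (𝓝 (∫ _ : ℝ, (0 : ℂ))) := by
    refine tendsto_integral_filter_of_dominated_convergence
      ((Icc (-1 : ℝ) 1).indicator fun _ => (B + A) * B) ?_ ?_ ?_ ?_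
    · refine Eventually.of_forall fun ε => ?_
      have hk := comparisonKernel_measurable hℓ (path ℓ s₀)
      have hm : Measurable (truncationDiff ℓ s₀ c ε) :=
        (hk.indicator (measurableSet_path_far hℓ _ _)).sub
          (hk.indicator (measurableSet_abs_far _ _))
      exact ((hm.comp (by fun_prop : Measurable fun u : ℝ => s₀ + ε * u)).const_mul
        (ε : ℂ)).aestronglyMeasurable
    · filter_upwards [Ioc_mem_nhdsGT (zero_lt_one' ℝ)] with ε hε
      refine Eventually.of_forall fun u => ?_
      have hε0 := hε.1
      have hlow : ε * |u| ≤ ‖path ℓ (s₀ + ε * u) - path ℓ s₀‖ := by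
        have := abs_sub_le_norm_path_sub ℓ (s₀ + ε * u) (path ℓ s₀)
        rwa [path_re, add_sub_cancel_left, abs_mul, abs_of_pos hε0] at this
      have hup : ‖path ℓ (s₀ + ε * u) - path ℓ s₀‖ ≤ B * (ε * |u|) := by
        have := norm_path_sub_path_le hℓ hB (s₀ + ε * u) s₀
        rwa [add_sub_cancel_left, abs_mul, abs_of_pos hε0] at this
      have habs : |s₀ + ε * u - s₀| = ε * |u| := by
        rw [add_sub_cancel_left, abs_mul, abs_of_pos hε0]
      have hnn : 0 ≤ (B + A) * B := by positivity
      -- The speed is at least 1 and at most B, so c lies between 1/B and 1. For |u| > 1 both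
      -- truncations keep the point, and for |u| < 1/B both discard it; only the range between needs
      -- the bound on the kernel.
      by_cases hu1 : 1 < |u|
      · rw [truncationDiff_eq_zero, mul_zero, norm_zero]
        · exact indicator_nonneg (fun _ _ => hnn) _
        · rw [habs]
          refine iff_of_true ?_ ?_ <;> nlinarith
      · rw [indicator_of_mem (show u ∈ Icc (-1 : ℝ) 1 from abs_le.1 (not_lt.1 hu1))]
        by_cases hu2 : |u| < B⁻¹
        · rw [truncationDiff_eq_zero, mul_zero, norm_zero]
          · exact hnn
          · rw [habs]
            have h3 : B * |u| < 1 := by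
              calc B * |u| < B * B⁻¹ := by gcongr
                _ = 1 := mul_inv_cancel₀ (by positivity)
            refine iff_of_false ?_ ?_ <;> nlinarith
        · rw [not_lt] at hu2
          have hu0 : 0 < |u| := lt_of_lt_of_le (by positivity) hu2
          rw [norm_mul, Complex.norm_real, Real.norm_of_nonneg hε0.le]
          have hn1 : ‖path ℓ (s₀ + ε * u) - path ℓ s₀‖⁻¹ ≤ ε⁻¹ * B := by
            rw [inv_le_comm₀ (lt_of_lt_of_le (by positivity) hlow) (by positivity), mul_inv,
              inv_inv]
            exact le_trans (by gcongr) hlow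
          have hn2 : ‖path ℓ (s₀ + ε * u) + Complex.I‖⁻¹ ≤ A := by
            rw [inv_le_comm₀ (norm_pos_iff.2 (hℓ.path_add_I_ne_zero _)) hA0]
            rw [inv_le_iff_one_le_mul₀ hA0, mul_comm]
            linarith [hA (s₀ + ε * u), abs_nonneg (s₀ + ε * u)]
          calc ε * ‖truncationDiff ℓ s₀ c ε (s₀ + ε * u)‖
              ≤ ε * ‖comparisonKernel ℓ (path ℓ s₀) (s₀ + ε * u)‖ := by
                gcongr; exact norm_truncationDiff_le _ _ _ _ _
            _ ≤ ε * ((ε⁻¹ * B + A) * B) := by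
                rw [comparisonKernel, norm_mul]
                gcongr
                · refine (norm_sub_le _ _).trans ?_
                  rw [norm_inv, norm_inv]
                  exact add_le_add hn1 hn2
                · exact hB _
            _ = (B + ε * A) * B := by field_simp
            _ ≤ (B + A) * B := by
                have := hε.2
                gcongr
                nlinarith
    · exact (integrable_indicator_iff measurableSet_Icc).2 (integrableOn_const (by simp))
    · have h0 : ∀ᵐ u : ℝ, u ≠ 0 := by simp [ae_iff]
      have h1 : ∀ᵐ u : ℝ, u ≠ c := by simp [ae_iff]
      have h2 : ∀ᵐ u : ℝ, u ≠ -c := by simp [ae_iff]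
      -- Except at u = ±c, the limiting distance |u| · |tangent| differs from 1, so for small ε both
      -- truncations decide alike. The value u = 0 is left out because the limit of the rescaled
      -- distance is proved for nonzero u.
      filter_upwards [h0, h1, h2] with u hu0 hu1 hu2
      refine tendsto_const_nhds.congr' ?_
      have hlim := tendsto_norm_path_slope hℓ s₀ hu0
      have hne : |u| ≠ c := fun h => by
        rcases abs_choice u with h3 | h3
        · exact hu1 (by rw [← h, h3])
        · exact hu2 (by rw [← h, h3, neg_neg])
      have hcd : c * ‖pathDeriv ℓ s₀‖ = 1 := inv_mul_cancel₀ hd0.ne'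
      rcases lt_or_gt_of_ne hne with h | h
      · have h3 : |u| * ‖pathDeriv ℓ s₀‖ < 1 := by rw [← hcd]; gcongr
        filter_upwards [self_mem_nhdsWithin, hlim.eventually_lt_const h3] with ε hε hlt
        have hε' : (0 : ℝ) < ε := hε
        rw [truncationDiff_eq_zero, mul_zero]
        rw [add_sub_cancel_left, abs_mul, abs_of_pos hε']
        rw [div_lt_one hε'] at hlt
        refine iff_of_false (by linarith) (by nlinarith)
      · have h3 : 1 < |u| * ‖pathDeriv ℓ s₀‖ := by rw [← hcd]; gcongr
        filter_upwards [self_mem_nhdsWithin, hlim.eventually_const_lt h3] with ε hε hlt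
        have hε' : (0 : ℝ) < ε := hε
        rw [truncationDiff_eq_zero, mul_zero]
        rw [add_sub_cancel_left, abs_mul, abs_of_pos hε']
        rw [one_lt_div hε'] at hlt
        refine iff_of_true hlt (by nlinarith)
  rw [integral_zero] at hlim
  refine hlim.congr' ?_
  filter_upwards [self_mem_nhdsWithin] with ε hε
  exact (hsubst ε hε).symm

theorem tendsto_integral_comparisonKernel_truncated (hℓ : IsContour ℓ) (s₀ : ℝ) :
    Tendsto (fun ε : ℝ => ∫ s in {s : ℝ | ε < ‖path ℓ s - path ℓ s₀‖},
      comparisonKernel ℓ (path ℓ s₀) s) (𝓝[>] 0) (𝓝 (Real.pi * Complex.I)) := by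
  have hd0 : 0 < ‖pathDeriv ℓ s₀‖ := lt_of_lt_of_le one_pos (one_le_norm_pathDeriv ℓ s₀)
  set c := ‖pathDeriv ℓ s₀‖⁻¹ with hc
  have hc0 : 0 < c := inv_pos.2 hd0
  have h1 : Tendsto (fun ε : ℝ => c * ε) (𝓝[>] 0) (𝓝[>] 0) := by
    refine tendsto_nhdsWithin_iff.2 ⟨?_, ?_⟩
    · have : Tendsto (fun ε : ℝ => c * ε) (𝓝 0) (𝓝 (c * 0)) :=
        Continuous.tendsto (f := fun ε : ℝ => c * ε) (by fun_prop) 0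
      rw [mul_zero] at this
      exact this.mono_left nhdsWithin_le_nhds
    · filter_upwards [self_mem_nhdsWithin] with ε hε
      exact mul_pos hc0 hε
  have h2 := (tendsto_integral_truncationDiff hℓ s₀).add
    ((tendsto_integral_comparisonKernel_symmetric hℓ s₀).comp h1)
  rw [zero_add] at h2
  refine h2.congr' ?_
  filter_upwards [self_mem_nhdsWithin] with ε hε
  have hε' : (0 : ℝ) < ε := hε
  have hm1 := measurableSet_path_far hℓ (path ℓ s₀) ε
  have hm2 := measurableSet_abs_far s₀ (c * ε)
  have hi1 : IntegrableOn (comparisonKernel ℓ (path ℓ s₀))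
      {s : ℝ | ε < ‖path ℓ s - path ℓ s₀‖} :=
    comparisonKernel_integrableOn hℓ hε' hm1 fun s hs => le_of_lt hs
  have hi2 : IntegrableOn (comparisonKernel ℓ (path ℓ s₀)) {s : ℝ | c * ε < |s - s₀|} :=
    comparisonKernel_integrableOn hℓ (mul_pos hc0 hε') hm2 fun s hs =>
      (le_of_lt hs).trans (by simpa using abs_sub_le_norm_path_sub ℓ s (path ℓ s₀))
  simp only [truncationDiff, Function.comp]
  rw [integral_sub ((integrable_indicator_iff hm1).2 hi1) ((integrable_indicator_iff hm2).2 hi2),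
    integral_indicator hm1, integral_indicator hm2, sub_add_cancel]

/-- The subtracted kernel is integrable, so its truncations converge by domination; the principal
value concerns the elementary kernel alone and contributes πi. -/
theorem pvInt_eq_subtractedInt (hℓ : IsContour ℓ) (hf : Admissible ℓ f) {U : Set ℂ}
    (hU : IsOpen U) (hd : DifferentiableOn ℂ f U) {ξ : ℂ} (hξU : ξ ∈ U) (hξ : ξ.im = ℓ ξ.re) :
    pvInt ℓ f ξ = subtractedInt ℓ f ξ + f ξ * (Real.pi * Complex.I) := by
  have hint := subtractedKernel_integrable hℓ hf hU hd hξU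
  refine Tendsto.limUnder_eq ?_
  have hK := tendsto_integral_comparisonKernel_truncated hℓ ξ.re
  rw [← eq_path_of_im_eq hξ] at hK
  have h1 : Tendsto (fun ε : ℝ => ∫ s in {s : ℝ | ε < ‖path ℓ s - ξ‖}, subtractedKernel ℓ f ξ s)
      (𝓝[>] 0) (𝓝 (subtractedInt ℓ f ξ)) := by
    have h2 : Tendsto (fun ε : ℝ =>
        ∫ s, {s : ℝ | ε < ‖path ℓ s - ξ‖}.indicator (subtractedKernel ℓ f ξ) s)
        (𝓝[>] 0) (𝓝 (∫ s, subtractedKernel ℓ f ξ s)) := by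
      refine tendsto_integral_filter_of_dominated_convergence
        (fun s => ‖subtractedKernel ℓ f ξ s‖) ?_ ?_ hint.norm ?_
      · exact Eventually.of_forall fun ε =>
          hint.aestronglyMeasurable.indicator (measurableSet_path_far hℓ ξ ε)
      · exact Eventually.of_forall fun ε => Eventually.of_forall fun s =>
          norm_indicator_le_norm_self _ _
      · filter_upwards [ae_path_sub_ne_zero ℓ ξ] with s hs
        refine tendsto_const_nhds.congr' ?_
        filter_upwards [Ioo_mem_nhdsGT (norm_pos_iff.2 hs)] with ε hε
        rw [indicator_of_mem (show s ∈ {s : ℝ | ε < ‖path ℓ s - ξ‖} from hε.2)]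
    refine h2.congr fun ε => ?_
    rw [integral_indicator (measurableSet_path_far hℓ ξ ε)]
  refine (h1.add (hK.const_mul (f ξ))).congr' ?_
  filter_upwards [self_mem_nhdsWithin] with ε hε
  have hm := measurableSet_path_far hℓ ξ ε
  rw [← integral_const_mul, ← integral_add hint.integrableOn
    ((comparisonKernel_integrableOn hℓ hε hm fun s hs => le_of_lt hs).const_mul _)]
  refine setIntegral_congr_fun hm fun s hs => ?_
  have hz : path ℓ s - ξ ≠ 0 := norm_pos_iff.1 (lt_trans hε hs)
  have hI := hℓ.path_add_I_ne_zero s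
  rw [subtractedKernel_of_ne hz, comparisonKernel_eq hℓ hz]
  field_simp
  ring

/-- The Cauchy transform `(2πi)⁻¹ ∫ f(t)/(t - ξ) dt` with the part `f(ξ)` removed above the path,
continued holomorphically. -/
def minusPart (ℓ : ℝ → ℝ) (f : ℂ → ℂ) (ξ : ℂ) : ℂ :=
  1 / (2 * (Real.pi : ℂ) * Complex.I) * subtractedInt ℓ f ξ

theorem two_pi_I_ne_zero : 2 * (Real.pi : ℂ) * Complex.I ≠ 0 := by
  simp [Real.pi_ne_zero]

/-- Together with `cauchyInt_below` and `pvInt_on`, this is the Plemelj jump relation with a single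
function on all three sides: only the multiple 1, 0 or 1/2 of the density changes. -/
theorem cauchyInt_above (hℓ : IsContour ℓ) (hf : Admissible ℓ f) {ξ : ℂ} (h : ℓ ξ.re < ξ.im) :
    1 / (2 * (Real.pi : ℂ) * Complex.I) * cauchyInt ℓ f ξ = minusPart ℓ f ξ + f ξ := by
  rw [cauchyInt_eq_subtractedInt hℓ hf h.ne', integral_comparisonKernel_above hℓ h, minusPart]
  have := two_pi_I_ne_zero
  field_simp

theorem cauchyInt_below (hℓ : IsContour ℓ) (hf : Admissible ℓ f) {ξ : ℂ} (h : ξ.im < ℓ ξ.re) :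
    1 / (2 * (Real.pi : ℂ) * Complex.I) * cauchyInt ℓ f ξ = minusPart ℓ f ξ := by
  rw [cauchyInt_eq_subtractedInt hℓ hf h.ne, integral_comparisonKernel_below hℓ h, minusPart,
    mul_zero, add_zero]

theorem pvInt_on (hℓ : IsContour ℓ) (hf : Admissible ℓ f) {U : Set ℂ}
    (hU : IsOpen U) (hd : DifferentiableOn ℂ f U) {ξ : ℂ} (hξU : ξ ∈ U) (hξ : ξ.im = ℓ ξ.re) :
    1 / (2 * (Real.pi : ℂ) * Complex.I) * pvInt ℓ f ξ = minusPart ℓ f ξ + f ξ / 2 := by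
  rw [pvInt_eq_subtractedInt hℓ hf hU hd hξU hξ, minusPart]
  have := two_pi_I_ne_zero
  have h2 : (Real.pi : ℂ) ≠ 0 := by exact_mod_cast Real.pi_ne_zero
  have h3 := Complex.I_ne_zero
  field_simp

theorem minusPart_differentiableOn (hℓ : IsContour ℓ) (hf : Admissible ℓ f) {U : Set ℂ}
    (hU : IsOpen U) (hd : DifferentiableOn ℂ f U) : DifferentiableOn ℂ (minusPart ℓ f) U :=
  (subtractedInt_differentiableOn hℓ hf hU hd).const_mul _

end

section

variable {k h : ℝ}

/-! ### The square root -/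

theorem csqrt_sq (z : ℂ) : csqrt z ^ 2 = z := by
  rw [csqrt, Complex.sqrt, ← Nat.cast_ofNat (R := ℂ), Complex.cpow_nat_inv_pow _ two_ne_zero]

theorem csqrt_eq_zero {z : ℂ} : csqrt z = 0 ↔ z = 0 := by
  rw [← pow_eq_zero_iff two_ne_zero, csqrt_sq]

theorem csqrt_eq_exp {z : ℂ} (hz : z ≠ 0) : csqrt z = Complex.exp (Complex.log z / 2) := by
  rw [csqrt, Complex.sqrt, Complex.cpow_def_of_ne_zero hz, div_eq_mul_inv]

theorem norm_csqrt (z : ℂ) : ‖csqrt z‖ = √‖z‖ := by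
  rw [eq_comm, Real.sqrt_eq_iff_mul_self_eq (norm_nonneg _) (norm_nonneg _), ← sq, ← norm_pow,
    csqrt_sq]

theorem csqrt_half_plane (z : ℂ) : 0 < (csqrt z).re ∨ ((csqrt z).re = 0 ∧ 0 ≤ (csqrt z).im) := by
  by_cases hz : z = 0
  · right; simp [hz, csqrt]
  have h1 := Complex.neg_pi_lt_arg z
  have h2 := Complex.arg_le_pi z
  have e : Complex.log z / 2 = ((Real.log ‖z‖ / 2 : ℝ) : ℂ) + ((Complex.arg z / 2 : ℝ) : ℂ)
      * Complex.I := by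
    rw [Complex.log]; push_cast; ring
  rw [csqrt_eq_exp hz, e, Complex.exp_re, Complex.exp_im]
  simp only [Complex.add_re, Complex.ofReal_re, Complex.mul_re, Complex.I_re, Complex.ofReal_im,
    Complex.I_im, Complex.add_im, Complex.mul_im]
  simp only [mul_zero, mul_one, sub_zero, add_zero, zero_add]
  rcases lt_or_eq_of_le h2 with h3 | h3
  · left
    exact mul_pos (Real.exp_pos _) (Real.cos_pos_of_mem_Ioo ⟨by linarith, by linarith⟩)
  · right
    rw [h3]
    simp [(Real.exp_pos _).le]

theorem csqrt_re_nonneg (z : ℂ) : 0 ≤ (csqrt z).re := by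
  rcases csqrt_half_plane z with h | h
  · exact h.le
  · exact h.1.ge

/-- Of two opposite square roots exactly one lies in the half plane defining the principal branch,
unless both vanish. Identities between roots thus reduce to squaring and locating the real part. -/
theorem csqrt_unique {z w : ℂ} (h : z ^ 2 = w) (hz : 0 < z.re ∨ (z.re = 0 ∧ 0 ≤ z.im)) :
    csqrt w = z := by
  have h1 : (csqrt w) ^ 2 = z ^ 2 := by rw [csqrt_sq, h]
  rcases sq_eq_sq_iff_eq_or_eq_neg.1 h1 with h2 | h2
  · exact h2
  · have h3 := csqrt_half_plane w
    rw [h2] at h3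
    simp only [Complex.neg_re, Complex.neg_im, neg_eq_zero] at h3
    rcases hz with hz | hz
    · rcases h3 with h3 | h3
      · linarith
      · linarith
    · rcases h3 with h3 | h3
      · linarith
      · have : z = 0 := Complex.ext hz.1 (by simp; linarith)
        rw [h2, this, neg_zero]

theorem csqrt_ofReal {x : ℝ} (hx : 0 ≤ x) : csqrt (x : ℂ) = (√x : ℝ) := by
  refine csqrt_unique (by exact_mod_cast Real.sq_sqrt hx) ?_
  simp only [Complex.ofReal_re, Complex.ofReal_im]
  rcases (Real.sqrt_nonneg x).lt_or_eq with h | h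
  · exact Or.inl h
  · exact Or.inr ⟨h.symm, le_rfl⟩

theorem two_mul_csqrt_re_mul_im (z : ℂ) : 2 * (csqrt z).re * (csqrt z).im = z.im := by
  have := congrArg Complex.im (csqrt_sq z)
  rw [sq, Complex.mul_im] at this
  linarith

theorem csqrt_re_sq_sub (z : ℂ) : (csqrt z).re ^ 2 - (csqrt z).im ^ 2 = z.re := by
  have := congrArg Complex.re (csqrt_sq z)
  rw [sq, Complex.mul_re] at this
  linarith

theorem csqrt_im_pos {z : ℂ} (h : 0 < z.im) : 0 < (csqrt z).im := by
  have h1 := two_mul_csqrt_re_mul_im z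
  have h2 := csqrt_re_nonneg z
  by_contra! h3
  nlinarith

theorem csqrt_im_neg {z : ℂ} (h : z.im < 0) : (csqrt z).im < 0 := by
  have h1 := two_mul_csqrt_re_mul_im z
  have h2 := csqrt_re_nonneg z
  by_contra! h3
  nlinarith

theorem csqrt_differentiableAt {z : ℂ} (hz : z ∈ Complex.slitPlane) :
    DifferentiableAt ℂ csqrt z := Complex.differentiableAt_sqrt hz

/-- On the cut the root takes its limit from the upper half plane. This is the only form of
continuity available for f̂⁺ on the ray (-∞, -k]. -/
theorem csqrt_continuousWithinAt (z : ℂ) :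
    ContinuousWithinAt csqrt {z | 0 ≤ z.im} z := by
  by_cases hc : 0 ≤ z.re ∨ z.im ≠ 0
  · exact (Complex.continuousAt_sqrt hc).continuousWithinAt
  · simp only [not_or, not_le, not_not] at hc
    have hne : z ≠ 0 := fun h0 => by rw [h0] at hc; simp at hc
    have h1 := Complex.continuousWithinAt_log_of_re_neg_of_im_zero hc.1 hc.2
    refine ((Complex.continuous_exp.continuousAt.comp_continuousWithinAt
      (h1.div_const 2))).congr_of_eventuallyEq ?_ (csqrt_eq_exp hne)
    filter_upwards [mem_nhdsWithin_of_mem_nhds (isOpen_ne.mem_nhds hne)] with w hw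
    exact csqrt_eq_exp hw

/-- For `w` in the lower half plane or on the non-negative real axis. -/
theorem csqrt_neg {w : ℂ} (h : w.im < 0 ∨ (w.im = 0 ∧ 0 ≤ w.re)) :
    csqrt (-w) = Complex.I * csqrt w := by
  refine csqrt_unique (by rw [mul_pow, csqrt_sq, Complex.I_sq]; ring) ?_
  simp only [Complex.mul_re, Complex.mul_im, Complex.I_re, Complex.I_im, zero_mul, one_mul,
    zero_sub, zero_add]
  rcases h with h | h
  · left; linarith [csqrt_im_neg h]
  · right
    have e : w = ((w.re : ℝ) : ℂ) := Complex.ext (by simp) (by simp [h.1])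
    rw [e, csqrt_ofReal h.2]
    simp

/-! ### The functions `μ` and `1 - exp(2iμh)` -/

theorem mu_neg (k : ℝ) (ξ : ℂ) : mu k (-ξ) = mu k ξ := by rw [mu, mu, neg_sq]

theorem symb_neg (k h : ℝ) (ξ : ℂ) : symb k h (-ξ) = symb k h ξ := by rw [symb, symb, mu_neg]

theorem sq_sub_sq_re (k : ℝ) (ξ : ℂ) :
    ((k : ℂ) ^ 2 - ξ ^ 2).re = k ^ 2 - ξ.re ^ 2 + ξ.im ^ 2 := by
  simp [sq]; ring

theorem sq_sub_sq_im (k : ℝ) (ξ : ℂ) : ((k : ℂ) ^ 2 - ξ ^ 2).im = -2 * (ξ.re * ξ.im) := by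
  simp [sq]; ring

/-- The plane without the two rays on which `μ` is discontinuous. -/
def cutPlane (k : ℝ) : Set ℂ := {ξ | ξ.im ≠ 0 ∨ |ξ.re| < k}

theorem isOpen_cutPlane (k : ℝ) : IsOpen (cutPlane k) :=
  (isOpen_ne_fun Complex.continuous_im continuous_const).union
    (isOpen_lt Complex.continuous_re.abs continuous_const)

theorem sq_sub_sq_mem_slitPlane (hk : 0 < k) {ξ : ℂ} (hξ : ξ ∈ cutPlane k) :
    (k : ℂ) ^ 2 - ξ ^ 2 ∈ Complex.slitPlane := by
  rw [Complex.mem_slitPlane_iff, sq_sub_sq_re, sq_sub_sq_im]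
  by_cases him : ξ.im = 0
  · left
    rcases hξ with h1 | h1
    · exact absurd him h1
    · rw [him]; nlinarith [sq_lt_sq' (by linarith [(abs_lt.1 h1).1]) (abs_lt.1 h1).2]
  · by_cases hre : ξ.re = 0
    · left; rw [hre]; nlinarith [sq_nonneg ξ.im, sq_pos_of_pos hk]
    · right; simp [him, hre]

theorem mu_differentiableAt (hk : 0 < k) {ξ : ℂ} (hξ : ξ ∈ cutPlane k) :
    DifferentiableAt ℂ (mu k) ξ := by
  have := csqrt_differentiableAt (sq_sub_sq_mem_slitPlane hk hξ)
  exact this.comp ξ (by fun_prop)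

theorem symb_differentiableAt (hk : 0 < k) (h : ℝ) {ξ : ℂ} (hξ : ξ ∈ cutPlane k) :
    DifferentiableAt ℂ (symb k h) ξ := by
  have := mu_differentiableAt hk hξ
  unfold symb
  fun_prop

/-- The open quadrants that contain the path, except for the origin. -/
def quadrants : Set ℂ := quadrantPM ∪ quadrantMP

theorem isOpen_quadrantPM : IsOpen quadrantPM :=
  (isOpen_lt continuous_const Complex.continuous_re).inter
    (isOpen_lt Complex.continuous_im continuous_const)

theorem isOpen_quadrantMP : IsOpen quadrantMP :=
  (isOpen_lt Complex.continuous_re continuous_const).inter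
    (isOpen_lt continuous_const Complex.continuous_im)

theorem isOpen_quadrants : IsOpen quadrants := isOpen_quadrantPM.union isOpen_quadrantMP

theorem re_mul_im_neg {ξ : ℂ} (hξ : ξ ∈ quadrants) : ξ.re * ξ.im < 0 := by
  rcases hξ with ⟨h1, h2⟩ | ⟨h1, h2⟩
  · exact mul_neg_of_pos_of_neg h1 h2
  · exact mul_neg_of_neg_of_pos h1 h2

theorem quadrants_subset_cutPlane (k : ℝ) : quadrants ⊆ cutPlane k := by
  rintro ξ (⟨h1, h2⟩ | ⟨h1, h2⟩)
  · exact Or.inl h2.ne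
  · exact Or.inl h2.ne'

theorem mu_im_pos (k : ℝ) {ξ : ℂ} (hξ : ξ ∈ quadrants) : 0 < (mu k ξ).im :=
  csqrt_im_pos (by rw [sq_sub_sq_im]; linarith [re_mul_im_neg hξ])

theorem norm_exp_mu (k h : ℝ) (ξ : ℂ) :
    ‖Complex.exp (2 * Complex.I * mu k ξ * (h : ℂ))‖ = Real.exp (-(2 * h * (mu k ξ).im)) := by
  rw [Complex.norm_exp]
  congr 1
  simp
  ring

theorem one_sub_mem_slitPlane {z : ℂ} (hz : ‖z‖ < 1) : 0 < (1 - z).re := by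
  have := Complex.abs_re_le_norm z
  have := (abs_le.1 this).2
  simp only [Complex.sub_re, Complex.one_re]
  linarith

/-- Here Im μ > 0, so the exponential has modulus less than 1 and the symbol lies in the unit disc
around 1, away from the cut of the logarithm. -/
theorem symb_re_pos (hh : 0 < h) {ξ : ℂ} (hξ : ξ ∈ quadrants) : 0 < (symb k h ξ).re := by
  refine one_sub_mem_slitPlane ?_
  rw [norm_exp_mu, Real.exp_lt_one_iff]
  have := mu_im_pos k hξ
  have : 0 < 2 * h * (mu k ξ).im := by positivity
  linarith

theorem symb_mem_slitPlane (hh : 0 < h) {ξ : ℂ} (hξ : ξ ∈ quadrants) :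
    symb k h ξ ∈ Complex.slitPlane := Or.inl (symb_re_pos hh hξ)

theorem log_symb_differentiableOn (hk : 0 < k) (hh : 0 < h) :
    DifferentiableOn ℂ (fun t => Complex.log (symb k h t)) quadrants := fun _ hξ =>
  ((symb_differentiableAt hk h (quadrants_subset_cutPlane k hξ)).clog
    (symb_mem_slitPlane hh hξ)).differentiableWithinAt

variable {ℓ : ℝ → ℝ}

theorem IsContour.path_mem_quadrants (hℓ : IsContour ℓ) {s : ℝ} (hs : s ≠ 0) :
    path ℓ s ∈ quadrants := by
  rcases lt_or_gt_of_ne hs with h | h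
  · exact Or.inr ⟨by simpa using h, by simpa using hℓ.pos_of_neg s h⟩
  · exact Or.inl ⟨by simpa using h, by simpa using hℓ.neg_of_pos s h⟩

theorem IsContour.path_zero (hℓ : IsContour ℓ) : path ℓ 0 = 0 := by simp [path, hℓ.zero]

theorem IsContour.mem_quadrants_of_on (hℓ : IsContour ℓ) {ξ : ℂ} (h : ξ.im = ℓ ξ.re)
    (h0 : ξ ≠ 0) : ξ ∈ quadrants := by
  rw [eq_path_of_im_eq h]
  refine hℓ.path_mem_quadrants fun hre => h0 ?_
  rw [eq_path_of_im_eq h, hre, hℓ.path_zero]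

/-- Real points on or below the path are non-positive, so the right branch ray is never met on this
side. -/
theorem IsContour.below_mem_cutPlane (hℓ : IsContour ℓ) {ξ : ℂ} (h : ξ.im ≤ ℓ ξ.re)
    (hk : 0 < k) (hc : ξ ∉ cut k) : ξ ∈ cutPlane k := by
  by_cases him : ξ.im = 0
  · right
    rw [him] at h
    have h1 : ξ.re ≤ 0 := by
      by_contra! h2
      linarith [hℓ.neg_of_pos _ h2]
    have h3 : -k < ξ.re := by
      by_contra! h2
      exact hc ⟨him, h2⟩
    rw [abs_lt]; constructor <;> linarith
  · exact Or.inl him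

/-- No sign is lost because k - ξ and k + ξ have opposite imaginary parts: so do their roots, and
the product of the roots keeps positive real part. For real ξ one of the two numbers is
non-negative, and multiplying by its root preserves the half plane. -/
theorem mu_eq_mul (k : ℝ) (hk : 0 < k) (ξ : ℂ) :
    mu k ξ = csqrt ((k : ℂ) - ξ) * csqrt ((k : ℂ) + ξ) := by
  have hP : ∀ (t : ℝ) (b : ℂ), 0 ≤ t → (0 < b.re ∨ (b.re = 0 ∧ 0 ≤ b.im)) →
      0 < ((t : ℂ) * b).re ∨ (((t : ℂ) * b).re = 0 ∧ 0 ≤ ((t : ℂ) * b).im) := by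
    intro t b ht hb
    rw [Complex.re_ofReal_mul, Complex.im_ofReal_mul]
    rcases ht.lt_or_eq with ht | ht
    · rcases hb with hb | hb
      · left; positivity
      · right; exact ⟨by rw [hb.1, mul_zero], mul_nonneg ht.le hb.2⟩
    · right; simp [← ht]
  refine csqrt_unique (by rw [mul_pow, csqrt_sq, csqrt_sq]; ring) ?_
  rcases lt_trichotomy ξ.im 0 with him | him | him
  · left
    have h1 : 0 < (csqrt ((k : ℂ) - ξ)).im := csqrt_im_pos (by simpa using him)
    have h2 : (csqrt ((k : ℂ) + ξ)).im < 0 := csqrt_im_neg (by simpa using him)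
    have h3 := csqrt_re_nonneg ((k : ℂ) - ξ)
    have h4 := csqrt_re_nonneg ((k : ℂ) + ξ)
    rw [Complex.mul_re]
    nlinarith [mul_nonneg h3 h4, mul_pos h1 (neg_pos.2 h2)]
  · have e : ξ = ((ξ.re : ℝ) : ℂ) := Complex.ext (by simp) (by simp [him])
    by_cases hle : 0 ≤ k - ξ.re
    · have e1 : (k : ℂ) - ξ = ((k - ξ.re : ℝ) : ℂ) := by
        push_cast; rw [← e]
      rw [e1, csqrt_ofReal hle]
      exact hP _ _ (Real.sqrt_nonneg _) (csqrt_half_plane _)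
    · have e1 : (k : ℂ) + ξ = ((k + ξ.re : ℝ) : ℂ) := by
        push_cast; rw [← e]
      rw [e1, csqrt_ofReal (by linarith), mul_comm]
      exact hP _ _ (Real.sqrt_nonneg _) (csqrt_half_plane _)
  · left
    have h1 : (csqrt ((k : ℂ) - ξ)).im < 0 := csqrt_im_neg (by simpa using him)
    have h2 : 0 < (csqrt ((k : ℂ) + ξ)).im := csqrt_im_pos (by simpa using him)
    have h3 := csqrt_re_nonneg ((k : ℂ) - ξ)
    have h4 := csqrt_re_nonneg ((k : ℂ) + ξ)
    rw [Complex.mul_re]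
    nlinarith [mul_nonneg h3 h4, mul_pos h2 (neg_pos.2 h1)]

/-- The entire function `(1 - exp(2ihz)) / z`. -/
def symbQuotient (h : ℝ) : ℂ → ℂ :=
  dslope (fun z => 1 - Complex.exp (2 * Complex.I * z * (h : ℂ))) 0

/-- As a function of μ the symbol is entire with a zero at 0, so μ can be divided out. The split-off
μ is what later cancels √(k+ξ) at the branch point -k. -/
theorem symb_eq_mul (k h : ℝ) (ξ : ℂ) : symb k h ξ = mu k ξ * symbQuotient h (mu k ξ) := by
  have := sub_smul_dslope (fun z => 1 - Complex.exp (2 * Complex.I * z * (h : ℂ))) 0 (mu k ξ)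
  simp only [smul_eq_mul, sub_zero, mul_zero, zero_mul, Complex.exp_zero, sub_self] at this
  rw [symbQuotient, this, symb]

theorem symbQuotient_differentiable (h : ℝ) : Differentiable ℂ (symbQuotient h) := by
  rw [← differentiableOn_univ]
  refine (Complex.differentiableOn_dslope univ_mem).2 ?_
  fun_prop

end

section

variable {k h : ℝ} {ℓ : ℝ → ℝ} {f g : ℂ → ℂ}

/-! ### Continuation of `μ` across the real axis near infinity -/

/-- The function `√(ξ² - k²)`, holomorphic near the real points at infinity. -/
def nu (k : ℝ) (ξ : ℂ) : ℂ := csqrt (ξ ^ 2 - (k : ℂ) ^ 2)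

/-- Two half strips around the real axis. -/
def strips (R b : ℝ) : Set ℂ := {ξ | R < |ξ.re| ∧ |ξ.im| < b}

theorem isOpen_strips (R b : ℝ) : IsOpen (strips R b) :=
  (isOpen_lt continuous_const Complex.continuous_re.abs).inter
    (isOpen_lt Complex.continuous_im.abs continuous_const)

theorem strips_subset {R R' b b' : ℝ} (hR : R' ≤ R) (hb : b ≤ b') : strips R b ⊆ strips R' b' :=
  fun _ hξ => ⟨hR.trans_lt hξ.1, hξ.2.trans_le hb⟩

/-- Beyond this distance from the origin, `exp(2iμh)` is small. -/
def farRadius (k h : ℝ) : ℝ := 4 + 2 * k + 2 / h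

theorem sq_sub_sq_re_ge (hk : 0 < k) (hh : 0 < h) {ξ : ℂ} (hξ : ξ ∈ strips (farRadius k h) 3) :
    (|ξ.re| / 2) ^ 2 ≤ (ξ ^ 2 - (k : ℂ) ^ 2).re := by
  have e : (ξ ^ 2 - (k : ℂ) ^ 2).re = |ξ.re| ^ 2 - |ξ.im| ^ 2 - k ^ 2 := by
    rw [sq_abs, sq_abs]; simp [sq]
  have h1 : 4 + 2 * k ≤ |ξ.re| := by
    have : 0 < 2 / h := by positivity
    have := hξ.1
    unfold farRadius at this
    linarith
  have h2 := hξ.2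
  have h3 := abs_nonneg ξ.im
  rw [e]
  nlinarith [mul_self_le_mul_self (by positivity) h1]

theorem strips_re_pos (hk : 0 < k) (hh : 0 < h) {ξ : ℂ} (hξ : ξ ∈ strips (farRadius k h) 3) :
    0 < |ξ.re| := by
  have : 0 < farRadius k h := by unfold farRadius; positivity
  exact this.trans hξ.1

theorem nu_re_ge (hk : 0 < k) (hh : 0 < h) {ξ : ℂ} (hξ : ξ ∈ strips (farRadius k h) 3) :
    |ξ.re| / 2 ≤ (nu k ξ).re := by
  have h1 := csqrt_re_sq_sub (ξ ^ 2 - (k : ℂ) ^ 2)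
  have h2 := sq_sub_sq_re_ge hk hh hξ
  have h3 : (|ξ.re| / 2) ^ 2 ≤ (csqrt (ξ ^ 2 - (k : ℂ) ^ 2)).re ^ 2 := by
    nlinarith [sq_nonneg (csqrt (ξ ^ 2 - (k : ℂ) ^ 2)).im]
  exact (abs_le_of_sq_le_sq' h3 (csqrt_re_nonneg _)).2

theorem nu_differentiableAt (hk : 0 < k) (hh : 0 < h) {ξ : ℂ}
    (hξ : ξ ∈ strips (farRadius k h) 3) : DifferentiableAt ℂ (nu k) ξ := by
  have h1 : ξ ^ 2 - (k : ℂ) ^ 2 ∈ Complex.slitPlane := by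
    left
    have := strips_re_pos hk hh hξ
    exact lt_of_lt_of_le (by positivity) (sq_sub_sq_re_ge hk hh hξ)
  exact (csqrt_differentiableAt h1).comp ξ (by fun_prop)

theorem mu_eq_I_mul_nu (k : ℝ) {ξ : ℂ} (h : ξ.re * ξ.im < 0 ∨ (ξ.re * ξ.im = 0 ∧
    0 ≤ (ξ ^ 2 - (k : ℂ) ^ 2).re)) : mu k ξ = Complex.I * nu k ξ := by
  rw [mu, nu, ← csqrt_neg, neg_sub]
  have e : (ξ ^ 2 - (k : ℂ) ^ 2).im = 2 * (ξ.re * ξ.im) := by simp [sq]; ring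
  rw [e]
  rcases h with h | h
  · left; linarith
  · right; exact ⟨by linarith [h.1], h.2⟩

theorem mu_eq_I_mul_nu_of_real (hk : 0 < k) (hh : 0 < h) {x : ℝ} (hx : farRadius k h < |x|) :
    mu k (x : ℂ) = Complex.I * nu k x := by
  refine mu_eq_I_mul_nu k (Or.inr ⟨by simp, ?_⟩)
  exact le_trans (by positivity) (sq_sub_sq_re_ge hk hh (ξ := (x : ℂ)) ⟨by simpa using hx, by simp⟩)

/-- The continuation of `1 - exp(2iμh)` across the real axis near infinity. -/
def symbFar (k h : ℝ) (ξ : ℂ) : ℂ := 1 - Complex.exp (-(2 * (h : ℂ) * nu k ξ))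

theorem symb_eq_symbFar (h : ℝ) {ξ : ℂ} (hmu : mu k ξ = Complex.I * nu k ξ) :
    symb k h ξ = symbFar k h ξ := by
  rw [symb, symbFar, hmu]
  congr 2
  linear_combination (2 * nu k ξ * h) * Complex.I_sq

theorem exp_neg_le_inv {x : ℝ} (hx : 0 < x) : Real.exp (-x) ≤ 1 / x := by
  rw [Real.exp_neg, one_div]
  exact inv_anti₀ hx (by linarith [Real.add_one_le_exp x])

theorem norm_exp_neg_nu_le (hk : 0 < k) (hh : 0 < h) {c : ℝ} (hc : 0 < c) {ξ : ℂ}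
    (hξ : ξ ∈ strips (farRadius k h) 3) :
    ‖Complex.exp (-(2 * (c : ℂ) * nu k ξ))‖ ≤ 1 / (c * |ξ.re|) := by
  have h1 := nu_re_ge hk hh hξ
  have h2 := strips_re_pos hk hh hξ
  rw [Complex.norm_exp]
  have e : (-(2 * (c : ℂ) * nu k ξ)).re = -(2 * c * (nu k ξ).re) := by simp
  rw [e]
  refine le_trans (Real.exp_le_exp.2 ?_) (exp_neg_le_inv (mul_pos hc h2))
  nlinarith

theorem norm_exp_neg_nu_le_half (hk : 0 < k) (hh : 0 < h) {ξ : ℂ}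
    (hξ : ξ ∈ strips (farRadius k h) 3) :
    ‖Complex.exp (-(2 * (h : ℂ) * nu k ξ))‖ ≤ 1 / 2 := by
  refine (norm_exp_neg_nu_le hk hh hh hξ).trans ?_
  have h1 : 2 / h ≤ |ξ.re| := by
    have := hξ.1
    unfold farRadius at this
    linarith
  rw [div_le_iff₀ hh] at h1
  exact one_div_le_one_div_of_le two_pos (by linarith)

theorem log_symbFar_differentiableOn (hk : 0 < k) (hh : 0 < h) :
    DifferentiableOn ℂ (fun t => Complex.log (symbFar k h t)) (strips (farRadius k h) 3) := by
  intro ξ hξ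
  have h1 := nu_differentiableAt hk hh hξ
  have h2 : symbFar k h ξ ∈ Complex.slitPlane :=
    Or.inl (one_sub_mem_slitPlane (lt_of_le_of_lt (norm_exp_neg_nu_le_half hk hh hξ) (by norm_num)))
  have h3 : DifferentiableAt ℂ (symbFar k h) ξ := by unfold symbFar; fun_prop
  exact (h3.clog h2).differentiableWithinAt

theorem norm_log_symbFar_le (hk : 0 < k) (hh : 0 < h) {ξ : ℂ}
    (hξ : ξ ∈ strips (farRadius k h) 3) :
    ‖Complex.log (symbFar k h ξ)‖ ≤ 3 / 2 * (1 / (h * |ξ.re|)) := by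
  rw [symbFar, sub_eq_add_neg]
  refine (Complex.norm_log_one_add_half_le_self ?_).trans ?_
  · rw [norm_neg]; exact norm_exp_neg_nu_le_half hk hh hξ
  · rw [norm_neg]
    exact mul_le_mul_of_nonneg_left (norm_exp_neg_nu_le hk hh hh hξ) (by norm_num)

theorem mu_eq_I_mul_nu_of_quadrants (k : ℝ) {ξ : ℂ} (hξ : ξ ∈ quadrants) :
    mu k ξ = Complex.I * nu k ξ := mu_eq_I_mul_nu k (Or.inl (re_mul_im_neg hξ))

theorem symbFar_eq_of_quadrants (k h : ℝ) {ξ : ℂ} (hξ : ξ ∈ quadrants) :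
    symb k h ξ = symbFar k h ξ := symb_eq_symbFar h (mu_eq_I_mul_nu_of_quadrants k hξ)

theorem IsContour.exists_path_mem_strips (hℓ : IsContour ℓ) (R : ℝ) :
    ∃ R' : ℝ, R ≤ R' ∧ 1 ≤ R' ∧ ∀ s : ℝ, R' < |s| → path ℓ s ∈ strips R 1 := by
  have h1 := hℓ.tendsto_atBot.eventually (Metric.ball_mem_nhds (0 : ℝ) one_pos)
  have h2 := hℓ.tendsto_atTop.eventually (Metric.ball_mem_nhds (0 : ℝ) one_pos)
  obtain ⟨a, ha⟩ := eventually_atBot.1 h1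
  obtain ⟨b, hb⟩ := eventually_atTop.1 h2
  refine ⟨max (max R 1) (max (-a) b), le_max_of_le_left (le_max_left _ _),
    le_max_of_le_left (le_max_right _ _), fun s hs => ⟨?_, ?_⟩⟩
  · rw [path_re]; exact lt_of_le_of_lt (le_max_of_le_left (le_max_left _ _)) hs
  · rw [path_im]
    have h3 : max (-a) b < |s| := lt_of_le_of_lt (le_max_right _ _) hs
    rcases lt_abs.1 h3 with h4 | h4
    · simpa using hb s ((le_max_right _ _).trans h4.le)
    · have : s ≤ a := by linarith [le_max_left (-a) b]
      simpa using ha s this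

/-! ### Admissibility -/

theorem integrable_one_add_abs_rpow {r : ℝ} (hr : 1 < r) :
    Integrable fun s : ℝ => (1 + |s|) ^ (-r) := by
  simpa using integrable_one_add_norm (E := ℝ) (μ := volume) (r := r) (by simpa using hr)

theorem admissible_of_decay {α M R : ℝ} (hα : 0 < α)
    (hm : AEStronglyMeasurable fun s => f (path ℓ s))
    (hloc : IntegrableOn (fun s => f (path ℓ s)) (Icc (-R) R))
    (hdec : ∀ s : ℝ, R < |s| → ‖f (path ℓ s)‖ ≤ M * (1 + |s|) ^ (-α)) : Admissible ℓ f := by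
  have hc : Continuous fun s : ℝ => (((1 + |s| : ℝ) : ℂ))⁻¹ := by
    refine Continuous.inv₀ (by fun_prop) fun s => ?_
    exact_mod_cast (by positivity : (0 : ℝ) < 1 + |s|).ne'
  have hb1 : Integrable ((Icc (-R) R).indicator fun s => ‖f (path ℓ s)‖) :=
    (integrable_indicator_iff measurableSet_Icc).2 hloc.norm
  have hb2 := (integrable_one_add_abs_rpow (r := 1 + α) (by linarith)).const_mul |M|
  refine (hb1.add hb2).mono' ?_ (Eventually.of_forall fun s => ?_)
  · simp_rw [div_eq_mul_inv]
    exact hm.mul hc.aestronglyMeasurable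
  · have hs : (0 : ℝ) < 1 + |s| := by positivity
    have hs1 : 1 ≤ 1 + |s| := by linarith [abs_nonneg s]
    rw [norm_div, Complex.norm_real, Real.norm_of_nonneg hs.le, Pi.add_apply]
    by_cases hsR : s ∈ Icc (-R) R
    · rw [indicator_of_mem hsR]
      have : ‖f (path ℓ s)‖ / (1 + |s|) ≤ ‖f (path ℓ s)‖ := div_le_self (norm_nonneg _) hs1
      have : 0 ≤ |M| * (1 + |s|) ^ (-(1 + α)) := by positivity
      linarith
    · rw [indicator_of_notMem hsR, zero_add]
      have hs' : R < |s| := by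
        by_contra! h
        exact hsR (abs_le.1 h)
      rw [div_le_iff₀ hs]
      calc ‖f (path ℓ s)‖ ≤ M * (1 + |s|) ^ (-α) := hdec s hs'
        _ ≤ |M| * (1 + |s|) ^ (-α) := by gcongr; exact le_abs_self M
        _ = |M| * (1 + |s|) ^ (-(1 + α)) * (1 + |s|) := by
          rw [mul_assoc, ← Real.rpow_add_one hs.ne']
          congr 2
          ring

theorem one_div_abs_le {s : ℝ} (hs : 1 ≤ |s|) : 1 / |s| ≤ 2 * (1 + |s|) ^ (-1 : ℝ) := by
  rw [Real.rpow_neg_one, ← div_eq_mul_inv, div_le_div_iff₀ (by linarith) (by linarith)]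
  linarith

/-- The density of `K⁺` and `K⁻` is admissible once it is locally integrable. -/
theorem log_symb_admissible_of_local (hk : 0 < k) (hh : 0 < h) (hℓ : IsContour ℓ)
    (hm : AEStronglyMeasurable fun s => Complex.log (symb k h (path ℓ s)))
    (hloc : ∀ R : ℝ, IntegrableOn (fun s => Complex.log (symb k h (path ℓ s))) (Icc (-R) R)) :
    Admissible ℓ fun t => Complex.log (symb k h t) := by
  obtain ⟨R, -, hR1, hR⟩ := hℓ.exists_path_mem_strips (farRadius k h)
  refine admissible_of_decay (α := 1) (M := 3 / h) (R := R) one_pos hm (hloc R) fun s hs => ?_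
  have hs0 : s ≠ 0 := abs_pos.1 (by linarith)
  rw [symbFar_eq_of_quadrants k h (hℓ.path_mem_quadrants hs0)]
  refine (norm_log_symbFar_le hk hh (strips_subset le_rfl (by norm_num) (hR s hs))).trans ?_
  rw [path_re]
  have := one_div_abs_le (s := s) (by linarith)
  have e : 3 / 2 * (1 / (h * |s|)) = 3 / (2 * h) * (1 / |s|) := by field_simp
  rw [e]
  calc 3 / (2 * h) * (1 / |s|) ≤ 3 / (2 * h) * (2 * (1 + |s|) ^ (-1 : ℝ)) := by gcongr
    _ = _ := by field_simp

end

section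

variable {k h : ℝ} {ℓ : ℝ → ℝ} {f g : ℂ → ℂ}

/-! ### The model factor with a zero at the origin -/

/-- A logarithm of `t / (t + i)`. -/
def theta (t : ℂ) : ℂ := Complex.log (-Complex.I * t) - Complex.log (1 - Complex.I * t)

/-- The plane without the closed lower imaginary half axis. -/
def thetaDomain : Set ℂ := {t | 0 < t.im ∨ t.re ≠ 0}

theorem thetaDomain_mem {t : ℂ} (ht : t ∈ thetaDomain) {τ : ℝ} (hτ : 0 ≤ τ) :
    -Complex.I * (t + Complex.I * τ) ∈ Complex.slitPlane := by
  refine neg_I_mul_mem_slitPlane ?_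
  rcases ht with h | h
  · left; simp; linarith
  · right; simpa using h

theorem thetaDomain_mem_zero {t : ℂ} (ht : t ∈ thetaDomain) :
    -Complex.I * t ∈ Complex.slitPlane := by simpa using thetaDomain_mem ht le_rfl

theorem neg_I_mul_add_one (t : ℂ) :
    -Complex.I * (t + Complex.I * (1 : ℝ)) = 1 - Complex.I * t := by
  push_cast; linear_combination (-1 : ℂ) * Complex.I_mul_I

theorem thetaDomain_mem_one {t : ℂ} (ht : t ∈ thetaDomain) :
    1 - Complex.I * t ∈ Complex.slitPlane := by
  rw [← neg_I_mul_add_one]; exact thetaDomain_mem ht zero_le_one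

theorem theta_differentiableAt {t : ℂ} (ht : t ∈ thetaDomain) : DifferentiableAt ℂ theta t := by
  have h1 : DifferentiableAt ℂ (fun t => Complex.log (-Complex.I * t)) t :=
    DifferentiableAt.clog (by fun_prop) (thetaDomain_mem_zero ht)
  have h2 : DifferentiableAt ℂ (fun t => Complex.log (1 - Complex.I * t)) t :=
    DifferentiableAt.clog (by fun_prop) (thetaDomain_mem_one ht)
  exact h1.sub h2

theorem exp_theta {t : ℂ} (ht : t ∈ thetaDomain) : Complex.exp (theta t) = t / (t + Complex.I) := by
  have h1 := Complex.slitPlane_ne_zero (thetaDomain_mem_zero ht)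
  have h2 := Complex.slitPlane_ne_zero (thetaDomain_mem_one ht)
  have e : 1 - Complex.I * t = -Complex.I * (t + Complex.I) := by
    linear_combination Complex.I_mul_I
  have h3 : t + Complex.I ≠ 0 := fun h => h2 (by rw [e, h, mul_zero])
  rw [theta, Complex.exp_sub, Complex.exp_log h1, Complex.exp_log h2, e,
    mul_div_mul_left _ _ (neg_ne_zero.2 Complex.I_ne_zero)]

/-- Writing this logarithm as a superposition of simple poles on the segment from 0 to -i reduces
its Cauchy transform, after Fubini, to partial fractions. -/
theorem theta_eq_integral {t : ℂ} (ht : t ∈ thetaDomain) :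
    theta t = -Complex.I * ∫ τ in Ioc (0 : ℝ) 1, (t + Complex.I * τ)⁻¹ := by
  have hne : ∀ τ : ℝ, τ ∈ uIcc (0 : ℝ) 1 → t + Complex.I * τ ≠ 0 := fun τ hτ => by
    rw [uIcc_of_le zero_le_one] at hτ
    exact right_ne_zero_of_mul (Complex.slitPlane_ne_zero (thetaDomain_mem ht hτ.1))
  have hderiv : ∀ τ ∈ uIcc (0 : ℝ) 1, HasDerivAt
      (fun τ : ℝ => -Complex.I * Complex.log (-Complex.I * (t + Complex.I * τ)))
      (t + Complex.I * τ)⁻¹ τ := by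
    intro τ hτ
    have hn := hne τ hτ
    rw [uIcc_of_le zero_le_one] at hτ
    have h1 : HasDerivAt (fun τ : ℝ => (τ : ℂ)) 1 τ := by
      simpa using (hasDerivAt_id τ).ofReal_comp
    have h2 := ((((h1.const_mul Complex.I).const_add t).const_mul (-Complex.I)).clog_real
      (thetaDomain_mem ht hτ.1)).const_mul (-Complex.I)
    refine h2.congr_deriv ?_
    have := Complex.I_ne_zero
    field_simp
    linear_combination -Complex.I_sq
  have hint : IntervalIntegrable (fun τ : ℝ => (t + Complex.I * τ)⁻¹) volume 0 1 := by
    refine ContinuousOn.intervalIntegrable (ContinuousOn.inv₀ (by fun_prop) hne)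
  rw [← intervalIntegral.integral_of_le zero_le_one,
    intervalIntegral.integral_eq_sub_of_hasDerivAt hderiv hint, neg_I_mul_add_one, theta]
  push_cast
  rw [mul_zero, add_zero]
  linear_combination (-(Complex.log (1 - Complex.I * t)) + Complex.log (-Complex.I * t))
    * Complex.I_sq

theorem integrableOn_inv_sqrt : IntegrableOn (fun τ : ℝ => (√|τ|)⁻¹) (Ioc 0 1) := by
  have h := intervalIntegral.intervalIntegrable_rpow' (a := 0) (b := 1) (r := -(1 / 2))
    (by norm_num)
  rw [intervalIntegrable_iff, uIoc_of_le zero_le_one] at h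
  refine h.congr_fun (fun τ hτ => ?_) measurableSet_Ioc
  simp only
  rw [abs_of_pos hτ.1, Real.rpow_neg hτ.1.le, Real.sqrt_eq_rpow]

theorem integrable_inv_sqrt_mul :
    Integrable fun s : ℝ => (√|s|)⁻¹ * (1 + |s|)⁻¹ := by
  have h1 : IntegrableOn (fun s : ℝ => (√|s|)⁻¹) (Icc (-1) 1) := by
    have e : Icc (-1 : ℝ) 1 = Icc (-1) 0 ∪ Icc 0 1 := by
      rw [Icc_union_Icc_eq_Icc] <;> norm_num
    have h2 : IntegrableOn (fun s : ℝ => (√|s|)⁻¹) (Icc 0 1) := by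
      rw [integrableOn_Icc_iff_integrableOn_Ioc]
      exact integrableOn_inv_sqrt
    rw [e]
    refine IntegrableOn.union ?_ h2
    have h3 := h2.comp_neg
    simpa using h3
  have h2 := (integrable_one_add_abs_rpow (r := 3 / 2) (by norm_num)).const_mul 2
  refine (((integrable_indicator_iff measurableSet_Icc).2 h1).add h2).mono'
    (by fun_prop) (Eventually.of_forall fun s => ?_)
  have hs : 0 < 1 + |s| := by positivity
  rw [Pi.add_apply, Real.norm_of_nonneg (by positivity)]
  by_cases hs1 : s ∈ Icc (-1 : ℝ) 1
  · rw [indicator_of_mem hs1]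
    have h3 : (√|s|)⁻¹ * (1 + |s|)⁻¹ ≤ (√|s|)⁻¹ * 1 := by
      gcongr
      exact inv_le_one_of_one_le₀ (by linarith [abs_nonneg s])
    have : 0 ≤ 2 * (1 + |s|) ^ (-(3 / 2) : ℝ) := by positivity
    linarith
  · rw [indicator_of_notMem hs1, zero_add]
    have hs2 : 1 < |s| := by
      by_contra! h
      exact hs1 (abs_le.1 h)
    have e : (1 + |s|) ^ (-(3 / 2) : ℝ) = (√(1 + |s|))⁻¹ * (1 + |s|)⁻¹ := by
      rw [Real.sqrt_eq_rpow, ← Real.rpow_neg hs.le, ← Real.rpow_neg_one, ← Real.rpow_add hs]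
      norm_num
    rw [e, ← mul_assoc]
    gcongr
    have h4 : √(1 + |s|) ≤ 2 * √|s| := by
      rw [Real.sqrt_le_left (by positivity), mul_pow, Real.sq_sqrt (abs_nonneg s)]
      linarith
    have h5 : 0 < √|s| := Real.sqrt_pos.2 (by linarith)
    rw [inv_le_iff_one_le_mul₀ h5]
    have h6 : 0 < √(1 + |s|) := Real.sqrt_pos.2 hs
    rw [mul_assoc, inv_mul_eq_div, ← mul_div_assoc, le_div_iff₀ h6]
    linarith

theorem sign_mul_self {σ : ℝ} (hσ : σ = 1 ∨ σ = -1) : σ * σ = 1 := by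
  rcases hσ with rfl | rfl <;> norm_num

theorem sign_abs {σ : ℝ} (hσ : σ = 1 ∨ σ = -1) : |σ| = 1 := by
  rcases hσ with rfl | rfl <;> norm_num

/-- The modulus of the sum dominates |s| through its real part, and |τ| up to the factor 1 + B,
since the path passes through 0 with speed at most B. The geometric mean of these bounds separates
the variables, and each factor is integrable at 0. -/
theorem norm_inv_path_add_le (hℓ : IsContour ℓ) {B : ℝ} (hB0 : 1 ≤ B)
    (hB : ∀ s, ‖pathDeriv ℓ s‖ ≤ B) {σ : ℝ} (hσ : σ = 1 ∨ σ = -1) {s τ : ℝ} (hs : s ≠ 0)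
    (hτ : τ ≠ 0) :
    ‖(σ * path ℓ s + Complex.I * τ)⁻¹‖ ≤ (1 + B) * ((√|s|)⁻¹ * (√|τ|)⁻¹) := by
  set z : ℂ := σ * path ℓ s + Complex.I * τ with hz
  have h1 : |s| ≤ ‖z‖ := by
    have := Complex.abs_re_le_norm z
    have e : z.re = σ * s := by simp [hz]
    rwa [e, abs_mul, sign_abs hσ, one_mul] at this
  have h2 : ‖(σ : ℂ) * path ℓ s‖ ≤ B * |s| := by
    rw [norm_mul, Complex.norm_real, Real.norm_eq_abs, sign_abs hσ, one_mul]
    simpa [hℓ.path_zero] using norm_path_sub_path_le hℓ hB s 0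
  have h3 : |τ| ≤ ‖z‖ + ‖(σ : ℂ) * path ℓ s‖ := by
    have e : Complex.I * τ = z - σ * path ℓ s := by rw [hz]; ring
    have e2 : ‖Complex.I * (τ : ℂ)‖ = |τ| := by simp
    rw [← e2, e]
    exact norm_sub_le _ _
  have hs0 := abs_pos.2 hs
  have hτ0 := abs_pos.2 hτ
  have h4 : |s| * |τ| ≤ ((1 + B) * ‖z‖) ^ 2 := by
    have h3' : |τ| ≤ (1 + B) * ‖z‖ := by nlinarith
    calc |s| * |τ| ≤ ((1 + B) * ‖z‖) * ((1 + B) * ‖z‖) := by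
          gcongr
          nlinarith [norm_nonneg z]
      _ = _ := by ring
  have h5 : √|s| * √|τ| ≤ (1 + B) * ‖z‖ := by
    rw [← Real.sqrt_mul hs0.le, Real.sqrt_le_left (by positivity)]
    exact h4
  have h6 : 0 < √|s| * √|τ| := mul_pos (Real.sqrt_pos.2 hs0) (Real.sqrt_pos.2 hτ0)
  have h7 : 0 < ‖z‖ := lt_of_lt_of_le hs0 h1
  rw [norm_inv, ← mul_inv, ← div_eq_mul_inv, inv_le_comm₀ h7 (by positivity), inv_div,
    div_le_iff₀ (by positivity)]
  linarith

theorem sign_mul_path_mem_thetaDomain {σ : ℝ} (hσ : σ = 1 ∨ σ = -1) {s : ℝ} (hs : s ≠ 0) :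
    (σ : ℂ) * path ℓ s ∈ thetaDomain := by
  right
  rcases hσ with rfl | rfl <;> simpa using hs

theorem theta_admissible (hℓ : IsContour ℓ) {σ : ℝ} (hσ : σ = 1 ∨ σ = -1) :
    Admissible ℓ fun t => theta (σ * t) := by
  obtain ⟨B, hB1, hB⟩ := hℓ.exists_norm_pathDeriv_le
  set D := ∫ τ in Ioc (0 : ℝ) 1, (√|τ|)⁻¹
  refine (integrable_inv_sqrt_mul.const_mul ((1 + B) * D)).mono' ?_ ?_
  · have hp := hℓ.continuous_path.measurable
    have h1 : Measurable fun s : ℝ => theta (σ * path ℓ s) := by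
      unfold theta
      exact (Complex.measurable_log.comp ((hp.const_mul (σ : ℂ)).const_mul _)).sub
        (Complex.measurable_log.comp (((hp.const_mul (σ : ℂ)).const_mul _).const_sub _))
    exact (h1.div (by fun_prop)).aestronglyMeasurable
  · have h0 : ∀ᵐ s : ℝ, s ≠ 0 := by simp [ae_iff]
    filter_upwards [h0] with s hs
    have hs1 : (0 : ℝ) < 1 + |s| := by positivity
    rw [norm_div, Complex.norm_real, Real.norm_of_nonneg hs1.le, div_eq_mul_inv, ← mul_assoc]
    gcongr
    rw [theta_eq_integral (sign_mul_path_mem_thetaDomain hσ hs), norm_mul, norm_neg,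
      Complex.norm_I, one_mul]
    calc ‖∫ τ in Ioc (0 : ℝ) 1, (σ * path ℓ s + Complex.I * τ)⁻¹‖
        ≤ ∫ τ in Ioc (0 : ℝ) 1, (1 + B) * (√|s|)⁻¹ * (√|τ|)⁻¹ := by
          refine norm_integral_le_of_norm_le (integrableOn_inv_sqrt.const_mul _) ?_
          refine (ae_restrict_iff' measurableSet_Ioc).2 (Eventually.of_forall fun τ hτ => ?_)
          rw [mul_assoc]
          exact norm_inv_path_add_le hℓ hB1 hB hσ hs hτ.1.ne'
      _ = (1 + B) * D * (√|s|)⁻¹ := by rw [integral_const_mul]; ring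

theorem integrable_theta_kernel (hℓ : IsContour ℓ) {σ : ℝ} (hσ : σ = 1 ∨ σ = -1) {ξ : ℂ}
    (hξ : ξ.im ≠ ℓ ξ.re) :
    Integrable (Function.uncurry fun s τ : ℝ =>
      (σ * path ℓ s + Complex.I * τ)⁻¹ * ((path ℓ s - ξ)⁻¹ * pathDeriv ℓ s))
      (volume.prod (volume.restrict (Ioc 0 1))) := by
  obtain ⟨B, hB1, hB⟩ := hℓ.exists_norm_pathDeriv_le
  obtain ⟨A, hA0, hA⟩ := hℓ.exists_one_add_abs_le hξ
  have hprod := Integrable.mul_prod (integrable_inv_sqrt_mul.const_mul ((1 + B) * A * B))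
    integrableOn_inv_sqrt
  refine hprod.mono' ?_ ?_
  · have hp := hℓ.continuous_path.measurable
    have hp1 : Measurable fun z : ℝ × ℝ => path ℓ z.1 := hp.comp measurable_fst
    have hp2 : Measurable fun z : ℝ × ℝ => pathDeriv ℓ z.1 :=
      hℓ.continuous_pathDeriv.measurable.comp measurable_fst
    have hp3 : Measurable fun z : ℝ × ℝ => (z.2 : ℂ) :=
      Complex.measurable_ofReal.comp measurable_snd
    exact (((hp1.const_mul _).add (hp3.const_mul _)).inv.mul
      ((hp1.sub_const _).inv.mul hp2)).aestronglyMeasurable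
  · have h0 : ∀ᵐ s : ℝ, s ≠ 0 := by simp [ae_iff]
    have h1 := (Measure.quasiMeasurePreserving_fst (μ := (volume : Measure ℝ))
      (ν := (volume : Measure ℝ).restrict (Ioc 0 1))).ae h0
    have h2 := (Measure.quasiMeasurePreserving_snd (μ := (volume : Measure ℝ))
      (ν := (volume : Measure ℝ).restrict (Ioc 0 1))).ae (ae_restrict_of_ae h0)
    filter_upwards [h1, h2] with z hz1 hz2
    have hs : (0 : ℝ) < 1 + |z.1| := by positivity
    have h3 := norm_inv_path_add_le hℓ hB1 hB hσ hz1 hz2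
    have h4 : ‖(path ℓ z.1 - ξ)⁻¹‖ ≤ A * (1 + |z.1|)⁻¹ := by
      rw [norm_inv, ← div_eq_mul_inv, inv_le_comm₀ (norm_pos_iff.2 (path_sub_ne_zero hξ _))
        (by positivity), inv_div, div_le_iff₀ hA0]
      linarith [hA z.1]
    rw [Function.uncurry, norm_mul, norm_mul]
    calc _ ≤ ((1 + B) * ((√|z.1|)⁻¹ * (√|z.2|)⁻¹)) * ((A * (1 + |z.1|)⁻¹) * B) := by
          gcongr
          exact hB _
      _ = _ := by ring

/-- After Fubini the inner integrand is a product of two simple poles, at ξ and at b = -σiτ. Partial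
fractions make it a difference of two comparison kernels in which the reference pole -i cancels, so
only J - c, the relative position of ξ and b, enters. -/
theorem cauchyInt_theta (hℓ : IsContour ℓ) {σ : ℝ} (hσ : σ = 1 ∨ σ = -1) {ξ : ℂ}
    (hξ : ξ.im ≠ ℓ ξ.re) {J c : ℂ} (hJ : ∫ s, comparisonKernel ℓ ξ s = J)
    (hc : ∀ τ : ℝ, 0 < τ → ∫ s, comparisonKernel ℓ (-(σ * (Complex.I * τ))) s = c) :
    cauchyInt ℓ (fun t => theta (σ * t)) ξ =
      (J - c) * (-Complex.I * ∫ τ in Ioc (0 : ℝ) 1, (σ * ξ + Complex.I * τ)⁻¹) := by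
  have hσσ : (σ : ℂ) * σ = 1 := by exact_mod_cast sign_mul_self hσ
  have hσ0 : (σ : ℂ) ≠ 0 := left_ne_zero_of_mul (hσσ.symm ▸ one_ne_zero)
  have h0 : ∀ᵐ s : ℝ, s ≠ 0 := by simp [ae_iff]
  have e1 : cauchyInt ℓ (fun t => theta (σ * t)) ξ = ∫ s : ℝ, -Complex.I *
      ∫ τ in Ioc (0 : ℝ) 1,
        (σ * path ℓ s + Complex.I * τ)⁻¹ * ((path ℓ s - ξ)⁻¹ * pathDeriv ℓ s) := by
    refine integral_congr_ae ?_
    filter_upwards [h0] with s hs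
    rw [theta_eq_integral (sign_mul_path_mem_thetaDomain hσ hs), integral_mul_const]
    ring
  rw [e1, integral_const_mul, integral_integral_swap (integrable_theta_kernel hℓ hσ hξ),
    mul_left_comm (J - c), ← integral_const_mul (J - c)]
  congr 1
  refine integral_congr_ae ?_
  -- For at most one τ the two poles can coincide; this null set is discarded so that partial
  -- fractions apply.
  have h1 : ∀ᵐ τ : ℝ, τ ≠ -(σ * ξ.im) := by simp [ae_iff]
  filter_upwards [ae_restrict_of_ae h1, ae_restrict_mem measurableSet_Ioc] with τ hτ hτ1
  have hne : σ * ξ + Complex.I * τ ≠ 0 := by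
    intro h
    have := congrArg Complex.im h
    simp at this
    exact hτ (by linarith)
  have hb : (-(σ * (Complex.I * τ)) : ℂ).im ≠ ℓ (-(σ * (Complex.I * τ)) : ℂ).re := by
    have : σ * τ ≠ 0 := mul_ne_zero (by exact_mod_cast hσ0) hτ1.1.ne'
    have e2 : (-(σ * (Complex.I * τ)) : ℂ).re = 0 := by simp
    rw [e2, hℓ.zero]
    simpa using this
  rw [← hJ, ← hc τ hτ1.1, ← integral_sub (comparisonKernel_integrable hℓ hξ)
    (comparisonKernel_integrable hℓ hb), ← integral_mul_const]
  refine integral_congr_ae (Eventually.of_forall fun s => ?_)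
  have hz := path_sub_ne_zero hξ s
  have hz2 := path_sub_ne_zero hb s
  have e3 : σ * path ℓ s + Complex.I * τ = σ * (path ℓ s - -(σ * (Complex.I * τ))) := by
    linear_combination (-(Complex.I * τ)) * hσσ
  have e4 : σ * ξ + Complex.I * τ = σ * (ξ - -(σ * (Complex.I * τ))) := by
    linear_combination (-(Complex.I * τ)) * hσσ
  have hz3 : ξ - -(σ * (Complex.I * τ)) ≠ 0 := fun h => hne (by rw [e4, h, mul_zero])
  simp only [comparisonKernel]
  rw [e3, e4]
  generalize -((σ : ℂ) * (Complex.I * τ)) = b at hz2 hz3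
  field_simp
  ring

theorem above_mem_thetaDomain (hℓ : IsContour ℓ) {ξ : ℂ} (h : ℓ ξ.re < ξ.im) :
    ξ ∈ thetaDomain := by
  by_cases hre : ξ.re = 0
  · rw [hre, hℓ.zero] at h; exact Or.inl h
  · exact Or.inr hre

theorem neg_below_mem_thetaDomain (hℓ : IsContour ℓ) {ξ : ℂ} (h : ξ.im < ℓ ξ.re) :
    -ξ ∈ thetaDomain := by
  by_cases hre : ξ.re = 0
  · rw [hre, hℓ.zero] at h; exact Or.inl (by simpa using h)
  · exact Or.inr (by simpa using hre)

theorem integral_comparisonKernel_neg_I_mul (hℓ : IsContour ℓ) {τ : ℝ} (hτ : 0 < τ) :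
    ∫ s, comparisonKernel ℓ (-(((1 : ℝ) : ℂ) * (Complex.I * τ))) s = 0 :=
  integral_comparisonKernel_below hℓ (by simp [hℓ.zero, hτ])

theorem integral_comparisonKernel_I_mul (hℓ : IsContour ℓ) {τ : ℝ} (hτ : 0 < τ) :
    ∫ s, comparisonKernel ℓ (-(((-1 : ℝ) : ℂ) * (Complex.I * τ))) s
      = 2 * Real.pi * Complex.I :=
  integral_comparisonKernel_above hℓ (by simp [hℓ.zero, hτ])

/-- A logarithm of `t² / (t² + 1)`. -/
def thetaSum (t : ℂ) : ℂ := theta t + theta (-t)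

theorem theta_neg_admissible (hℓ : IsContour ℓ) : Admissible ℓ fun t => theta (-t) := by
  simpa using theta_admissible hℓ (σ := -1) (Or.inr rfl)

theorem theta_one_admissible (hℓ : IsContour ℓ) : Admissible ℓ theta := by
  simpa using theta_admissible hℓ (σ := 1) (Or.inl rfl)

theorem Admissible.add (hf : Admissible ℓ f) (hg : Admissible ℓ g) :
    Admissible ℓ fun t => f t + g t := by
  refine (Integrable.add hf hg).congr (Eventually.of_forall fun s => ?_)
  simp only [Pi.add_apply, add_div]

theorem Admissible.sub (hf : Admissible ℓ f) (hg : Admissible ℓ g) :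
    Admissible ℓ fun t => f t - g t := by
  refine (Integrable.sub hf hg).congr (Eventually.of_forall fun s => ?_)
  simp only [Pi.sub_apply, sub_div]

theorem thetaSum_admissible (hℓ : IsContour ℓ) : Admissible ℓ thetaSum :=
  (theta_one_admissible hℓ).add (theta_neg_admissible hℓ)

theorem Admissible.cauchy_integrable (hℓ : IsContour ℓ) (hf : Admissible ℓ f) {ξ : ℂ}
    (hξ : ξ.im ≠ ℓ ξ.re) :
    Integrable fun s : ℝ => f (path ℓ s) / (path ℓ s - ξ) * pathDeriv ℓ s := by
  refine ((subtractedKernel_integrable_of_off hℓ hf hξ).add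
    ((comparisonKernel_integrable hℓ hξ).const_mul (f ξ))).congr (Eventually.of_forall fun s => ?_)
  have hz := path_sub_ne_zero hξ s
  have hI := hℓ.path_add_I_ne_zero s
  simp only [Pi.add_apply]
  rw [subtractedKernel_of_ne hz, comparisonKernel_eq hℓ hz]
  field_simp
  ring

theorem cauchyInt_add (hℓ : IsContour ℓ) (hf : Admissible ℓ f) (hg : Admissible ℓ g) {ξ : ℂ}
    (hξ : ξ.im ≠ ℓ ξ.re) :
    cauchyInt ℓ (fun t => f t + g t) ξ = cauchyInt ℓ f ξ + cauchyInt ℓ g ξ := by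
  rw [cauchyInt, cauchyInt, cauchyInt, ← integral_add (hf.cauchy_integrable hℓ hξ)
    (hg.cauchy_integrable hℓ hξ)]
  refine integral_congr_ae (Eventually.of_forall fun s => ?_)
  simp only
  ring

/-- The poles composing `theta t` lie on the segment from 0 to -i, below the path, so this summand
is reproduced from above. Those of `theta (-t)` lie above, on the same side as ξ, and contribute
nothing. -/
theorem cauchyInt_thetaSum_above (hℓ : IsContour ℓ) {ξ : ℂ} (h : ℓ ξ.re < ξ.im) :
    1 / (2 * (Real.pi : ℂ) * Complex.I) * cauchyInt ℓ thetaSum ξ = theta ξ := by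
  have h1 := cauchyInt_theta hℓ (σ := 1) (Or.inl rfl) h.ne'
    (integral_comparisonKernel_above hℓ h) fun τ hτ => integral_comparisonKernel_neg_I_mul hℓ hτ
  have h2 := cauchyInt_theta hℓ (σ := -1) (Or.inr rfl) h.ne'
    (integral_comparisonKernel_above hℓ h) fun τ hτ => integral_comparisonKernel_I_mul hℓ hτ
  simp only [Complex.ofReal_one, one_mul, sub_zero, sub_self, zero_mul, Complex.ofReal_neg,
    neg_mul] at h1 h2
  have e : cauchyInt ℓ thetaSum ξ = cauchyInt ℓ theta ξ + cauchyInt ℓ (fun t => theta (-t)) ξ :=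
    cauchyInt_add hℓ (theta_one_admissible hℓ) (theta_neg_admissible hℓ) h.ne'
  rw [e, h2, add_zero, theta_eq_integral (above_mem_thetaDomain hℓ h)]
  refine Eq.trans (congrArg _ h1) ?_
  have := two_pi_I_ne_zero
  field_simp

/-- The roles of the summands are exchanged, and the sign comes from J - c = -2πi. -/
theorem cauchyInt_thetaSum_below (hℓ : IsContour ℓ) {ξ : ℂ} (h : ξ.im < ℓ ξ.re) :
    1 / (2 * (Real.pi : ℂ) * Complex.I) * cauchyInt ℓ thetaSum ξ = -theta (-ξ) := by
  have h1 := cauchyInt_theta hℓ (σ := 1) (Or.inl rfl) h.ne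
    (integral_comparisonKernel_below hℓ h) fun τ hτ => integral_comparisonKernel_neg_I_mul hℓ hτ
  have h2 := cauchyInt_theta hℓ (σ := -1) (Or.inr rfl) h.ne
    (integral_comparisonKernel_below hℓ h) fun τ hτ => integral_comparisonKernel_I_mul hℓ hτ
  simp only [Complex.ofReal_one, one_mul, sub_self, zero_mul, Complex.ofReal_neg,
    neg_mul] at h1 h2
  have e : cauchyInt ℓ thetaSum ξ = cauchyInt ℓ theta ξ + cauchyInt ℓ (fun t => theta (-t)) ξ :=
    cauchyInt_add hℓ (theta_one_admissible hℓ) (theta_neg_admissible hℓ) h.ne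
  have h1' : cauchyInt ℓ theta ξ = 0 := h1
  rw [e, h2, h1', zero_add, theta_eq_integral (neg_below_mem_thetaDomain hℓ h)]
  have := two_pi_I_ne_zero
  field_simp
  ring

end

section

variable {k h : ℝ} {ℓ : ℝ → ℝ} {f g : ℂ → ℂ}

/-! ### The logarithm of the symbol near the origin -/

theorem IsContour.path_mem_cutPlane (hℓ : IsContour ℓ) (hk : 0 < k) (s : ℝ) :
    path ℓ s ∈ cutPlane k := by
  by_cases hs : s = 0
  · right; simpa [hs] using hk
  · exact quadrants_subset_cutPlane k (hℓ.path_mem_quadrants hs)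

theorem continuous_symb_path (hk : 0 < k) (h : ℝ) (hℓ : IsContour ℓ) :
    Continuous fun s => symb k h (path ℓ s) :=
  continuous_iff_continuousAt.2 fun s =>
    (symb_differentiableAt hk h (hℓ.path_mem_cutPlane hk s)).continuousAt.comp
      hℓ.continuous_path.continuousAt

theorem log_symb_aestronglyMeasurable (hk : 0 < k) (h : ℝ) (hℓ : IsContour ℓ) :
    AEStronglyMeasurable fun s => Complex.log (symb k h (path ℓ s)) :=
  (Complex.measurable_log.comp (continuous_symb_path hk h hℓ).measurable).aestronglyMeasurable

theorem mu_zero (hk : 0 < k) : mu k 0 = k := by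
  rw [mu]
  exact csqrt_unique (by ring) (Or.inl (by simpa using hk))

theorem symb_zero (hk : 0 < k) (h : ℝ) :
    symb k h 0 = 1 - Complex.exp (2 * Complex.I * k * h) := by rw [symb, mu_zero hk]

/-- The open set on which `log (1 - exp(2iμh))` is plainly holomorphic. -/
def regularSet (k h : ℝ) : Set ℂ := {ξ | ξ ∈ cutPlane k ∧ symb k h ξ ∈ Complex.slitPlane}

theorem isOpen_regularSet (hk : 0 < k) (h : ℝ) : IsOpen (regularSet k h) := by
  have hc : ContinuousOn (symb k h) (cutPlane k) := fun ξ hξ =>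
    (symb_differentiableAt hk h hξ).continuousAt.continuousWithinAt
  exact hc.isOpen_inter_preimage (isOpen_cutPlane k) Complex.isOpen_slitPlane

theorem log_symb_differentiableOn_regularSet (hk : 0 < k) (h : ℝ) :
    DifferentiableOn ℂ (fun t => Complex.log (symb k h t)) (regularSet k h) := fun _ hξ =>
  ((symb_differentiableAt hk h hξ.1).clog hξ.2).differentiableWithinAt

theorem quadrants_subset_regularSet (hh : 0 < h) : quadrants ⊆ regularSet k h := fun _ hξ =>
  ⟨quadrants_subset_cutPlane k hξ, symb_mem_slitPlane hh hξ⟩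

/-- At the origin the exponential has modulus 1; the only point of the unit circle with real part 1
is 1 itself, so a nonzero symbol there has positive real part. -/
theorem zero_mem_regularSet (hk : 0 < k) (h0 : symb k h 0 ≠ 0) : (0 : ℂ) ∈ regularSet k h := by
  refine ⟨Or.inr (by simpa using hk), Or.inl ?_⟩
  rw [symb_zero hk] at h0 ⊢
  set z := Complex.exp (2 * Complex.I * k * h) with hz
  have hn : ‖z‖ = 1 := by
    rw [hz, show 2 * Complex.I * (k : ℂ) * h = ((2 * k * h : ℝ) : ℂ) * Complex.I by push_cast; ring]
    exact Complex.norm_exp_ofReal_mul_I _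
  have h1 : z.re ≤ 1 := hn ▸ Complex.re_le_norm z
  rw [Complex.sub_re, Complex.one_re, sub_pos]
  refine lt_of_le_of_ne h1 fun h2 => h0 ?_
  have h3 : z.re ^ 2 + z.im ^ 2 = 1 := by
    have := Complex.sq_norm z
    rw [hn, Complex.normSq_apply] at this
    nlinarith
  have h4 : z.im = 0 := by
    rw [h2] at h3
    nlinarith [sq_nonneg z.im]
  rw [show z = 1 from Complex.ext (by simpa using h2) (by simpa using h4), sub_self]

theorem log_symb_admissible_of_ne (hk : 0 < k) (hh : 0 < h) (hℓ : IsContour ℓ)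
    (h0 : symb k h 0 ≠ 0) : Admissible ℓ fun t => Complex.log (symb k h t) := by
  refine log_symb_admissible_of_local hk hh hℓ (log_symb_aestronglyMeasurable hk h hℓ) fun R => ?_
  refine Continuous.integrableOn_Icc (Continuous.clog (continuous_symb_path hk h hℓ) fun s => ?_)
  by_cases hs : s = 0
  · rw [hs, hℓ.path_zero]; exact (zero_mem_regularSet hk h0).2
  · exact symb_mem_slitPlane hh (hℓ.path_mem_quadrants hs)

/-- The function `(1 - exp(2iμh)) (ξ² + 1) / ξ²`, continued to the origin, if the symbol vanishes
there. -/
def reducedSymb (k h : ℝ) (ξ : ℂ) : ℂ :=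
  -((ξ ^ 2 + 1) * dslope (fun z => 1 - Complex.exp (2 * Complex.I * z * (h : ℂ))) k (mu k ξ))
    / (mu k ξ + k)

theorem mu_add_ne_zero (hk : 0 < k) (ξ : ℂ) : mu k ξ + k ≠ 0 := by
  intro h
  have h1 := congrArg Complex.re h
  have h2 := csqrt_re_nonneg ((k : ℂ) ^ 2 - ξ ^ 2)
  rw [mu] at h1
  simp at h1
  linarith

theorem reducedSymb_neg (k h : ℝ) (ξ : ℂ) : reducedSymb k h (-ξ) = reducedSymb k h ξ := by
  rw [reducedSymb, reducedSymb, mu_neg, neg_sq]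

/-- If the symbol vanishes at μ = k, it is divisible by μ - k, and μ - k = -ξ²/(μ + k) shows that
the zero in ξ is double. -/
theorem symb_mul_eq_reducedSymb_mul (hk : 0 < k) (h0 : symb k h 0 = 0) (ξ : ℂ) :
    symb k h ξ * (ξ ^ 2 + 1) = reducedSymb k h ξ * ξ ^ 2 := by
  have h1 := sub_smul_dslope (fun z => 1 - Complex.exp (2 * Complex.I * z * (h : ℂ))) k (mu k ξ)
  have h2 := symb_zero hk h
  rw [h0] at h2
  simp only [smul_eq_mul] at h1
  rw [← h2, sub_zero] at h1
  have h3 : mu k ξ ^ 2 = (k : ℂ) ^ 2 - ξ ^ 2 := by rw [mu, csqrt_sq]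
  have h4 := mu_add_ne_zero hk ξ
  rw [symb, ← h1, reducedSymb]
  generalize dslope (fun z => 1 - Complex.exp (2 * Complex.I * z * (h : ℂ))) (k : ℂ) (mu k ξ) = q
  field_simp
  linear_combination (q * (ξ ^ 2 + 1)) * h3

theorem reducedSymb_differentiableAt (hk : 0 < k) (h : ℝ) {ξ : ℂ} (hξ : ξ ∈ cutPlane k) :
    DifferentiableAt ℂ (reducedSymb k h) ξ := by
  have h1 := mu_differentiableAt hk hξ
  have h2 : Differentiable ℂ
      (dslope (fun z => 1 - Complex.exp (2 * Complex.I * z * (h : ℂ))) (k : ℂ)) := by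
    rw [← differentiableOn_univ]
    exact (Complex.differentiableOn_dslope univ_mem).2 (by fun_prop)
  have h3 : DifferentiableAt ℂ (fun ξ => dslope
      (fun z => 1 - Complex.exp (2 * Complex.I * z * (h : ℂ))) (k : ℂ) (mu k ξ)) ξ :=
    (h2 _).comp ξ h1
  exact ((DifferentiableAt.mul (by fun_prop) h3).neg).div (h1.add_const _) (mu_add_ne_zero hk ξ)

/-- The vanishing of the symbol means exp(2ikh) = 1, so the relevant derivative is -2ih. The value
is a positive multiple of i: its argument π/2 is well inside the range of the principal branch. -/
theorem reducedSymb_zero (hk : 0 < k) (h0 : symb k h 0 = 0) :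
    reducedSymb k h 0 = ((h / k : ℝ) : ℂ) * Complex.I := by
  have h2 := symb_zero hk h
  rw [h0] at h2
  have h3 : deriv (fun z => 1 - Complex.exp (2 * Complex.I * z * (h : ℂ))) (k : ℂ)
      = -(2 * Complex.I * h) := by
    have hd : HasDerivAt (fun z => 1 - Complex.exp (2 * Complex.I * z * (h : ℂ)))
        (-(Complex.exp (2 * Complex.I * k * h) * (2 * Complex.I * 1 * h))) (k : ℂ) :=
      ((((hasDerivAt_id (k : ℂ)).const_mul (2 * Complex.I)).mul_const (h : ℂ)).cexp).const_sub 1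
    rw [hd.deriv]
    linear_combination (-(2 * Complex.I * h)) * h2
  rw [reducedSymb, mu_zero hk, dslope_same, h3]
  have : (k : ℂ) ≠ 0 := by exact_mod_cast hk.ne'
  push_cast
  field_simp
  ring

theorem exp_thetaSum {t : ℂ} (ht : t ∈ thetaDomain) (ht' : -t ∈ thetaDomain) :
    Complex.exp (thetaSum t) * (t ^ 2 + 1) = t ^ 2 := by
  have h1 : t + Complex.I ≠ 0 := by
    intro h
    have := exp_theta ht
    rw [h, div_zero] at this
    exact Complex.exp_ne_zero _ this
  have h2 : -t + Complex.I ≠ 0 := by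
    intro h
    have := exp_theta ht'
    rw [h, div_zero] at this
    exact Complex.exp_ne_zero _ this
  rw [thetaSum, Complex.exp_add, exp_theta ht, exp_theta ht']
  field_simp
  linear_combination (-t ^ 2) * Complex.I_sq

theorem quadrants_re_ne {t : ℂ} (ht : t ∈ quadrants) : t.re ≠ 0 :=
  left_ne_zero_of_mul (re_mul_im_neg ht).ne

theorem quadrants_mem_thetaDomain {t : ℂ} (ht : t ∈ quadrants) : t ∈ thetaDomain :=
  Or.inr (quadrants_re_ne ht)

theorem neg_quadrants_mem_thetaDomain {t : ℂ} (ht : t ∈ quadrants) : -t ∈ thetaDomain :=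
  Or.inr (by simpa using quadrants_re_ne ht)

theorem thetaSum_neg (t : ℂ) : thetaSum (-t) = thetaSum t := by
  rw [thetaSum, thetaSum, neg_neg, add_comm]

theorem thetaSum_differentiableOn : DifferentiableOn ℂ thetaSum quadrants := fun t ht =>
  ((theta_differentiableAt (quadrants_mem_thetaDomain ht)).add
    ((theta_differentiableAt (neg_quadrants_mem_thetaDomain ht)).comp t
      differentiableAt_id.neg)).differentiableWithinAt

/-- Conditions on a point near the origin that determine the branches of the logarithms. -/
def NearOrigin (k h : ℝ) (t : ℂ) : Prop :=
  |Complex.arg (1 - Complex.I * t)| < Real.pi / 4 ∧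
  |Complex.arg (1 - Complex.I * -t)| < Real.pi / 4 ∧
  Real.pi / 4 < Complex.arg (reducedSymb k h t) ∧
  Complex.arg (reducedSymb k h t) < 3 * Real.pi / 4 ∧
  reducedSymb k h t ∈ Complex.slitPlane ∧ t ∈ cutPlane k

theorem eventually_nearOrigin (hk : 0 < k) (hh : 0 < h) (h0 : symb k h 0 = 0) :
    ∀ᶠ t in 𝓝 (0 : ℂ), NearOrigin k h t := by
  have hpi := Real.pi_pos
  have hmem : (0 : ℂ) ∈ cutPlane k := Or.inr (by simpa using hk)
  have hS := reducedSymb_zero hk h0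
  have hhk : 0 < h / k := by positivity
  have hslit : reducedSymb k h 0 ∈ Complex.slitPlane := by
    rw [hS, Complex.mem_slitPlane_iff]; right; simpa using hhk.ne'
  have harg : Complex.arg (reducedSymb k h 0) = Real.pi / 2 := by
    rw [hS, Complex.arg_real_mul _ hhk, Complex.arg_I]
  have hc := (reducedSymb_differentiableAt hk h hmem).continuousAt
  have hca : ContinuousAt (fun t => Complex.arg (reducedSymb k h t)) 0 :=
    (Complex.continuousAt_arg hslit).comp hc
  have h1 : ContinuousAt (fun t : ℂ => |Complex.arg (1 - Complex.I * t)|) 0 :=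
    (ContinuousAt.comp (f := fun t : ℂ => 1 - Complex.I * t)
      (Complex.continuousAt_arg (by simp)) (by fun_prop)).abs
  have h2 : ContinuousAt (fun t : ℂ => |Complex.arg (1 - Complex.I * -t)|) 0 :=
    (ContinuousAt.comp (f := fun t : ℂ => 1 - Complex.I * -t)
      (Complex.continuousAt_arg (by simp)) (by fun_prop)).abs
  filter_upwards [h1.eventually_lt_const (by simp [hpi] : _ < Real.pi / 4),
    h2.eventually_lt_const (by simp [hpi] : _ < Real.pi / 4),
    hca.eventually_const_lt (by simp only [harg]; linarith : Real.pi / 4 < _),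
    hca.eventually_lt_const (by simp only [harg]; linarith : _ < 3 * Real.pi / 4),
    hc.eventually (Complex.isOpen_slitPlane.mem_nhds hslit),
    (isOpen_cutPlane k).mem_nhds hmem] with t a b c d e f'
  exact ⟨a, b, c, d, e, f'⟩

/-- Both sides have the same exponential, so they differ by 2πin. Near the origin the arguments are
so restricted that the imaginary part of the difference is below 2π in modulus, which forces n = 0.
-/
theorem log_symb_sub_thetaSum (hk : 0 < k) (hh : 0 < h) (h0 : symb k h 0 = 0) {t : ℂ}
    (ht : t ∈ quadrantPM) (hn : NearOrigin k h t) :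
    Complex.log (symb k h t) - thetaSum t = Complex.log (reducedSymb k h t) := by
  have hq : t ∈ quadrants := Or.inl ht
  have hpi := Real.pi_pos
  obtain ⟨h1, h2, h3, h4, h5, -⟩ := hn
  have hre : 0 < (Complex.I * t).re := by simpa using ht.2
  have him : 0 < (Complex.I * t).im := by simpa using ht.1
  have a1 : Complex.arg (-Complex.I * t) = Complex.arg (Complex.I * t) - Real.pi := by
    rw [neg_mul]; exact Complex.arg_neg_eq_arg_sub_pi_of_im_pos him
  have a2 : -Complex.I * -t = Complex.I * t := by ring
  have a3 := (abs_lt.1 (Complex.abs_arg_lt_pi_div_two_iff.2 (Or.inl hre))).2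
  have a4 : 0 ≤ Complex.arg (Complex.I * t) := Complex.arg_nonneg_iff.2 him.le
  have a5 := abs_lt.1 (Complex.abs_arg_lt_pi_div_two_iff.2 (Or.inl (symb_re_pos (k := k) hh hq)))
  have hsym := Complex.slitPlane_ne_zero (symb_mem_slitPlane (k := k) hh hq)
  have hred := Complex.slitPlane_ne_zero h5
  have h6 := exp_thetaSum (quadrants_mem_thetaDomain hq) (neg_quadrants_mem_thetaDomain hq)
  have ht0 : t ≠ 0 := fun h => quadrants_re_ne hq (by simp [h])
  have hone : Complex.exp (Complex.log (symb k h t) - thetaSum t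
      - Complex.log (reducedSymb k h t)) = 1 := by
    rw [Complex.exp_sub, Complex.exp_sub, Complex.exp_log hsym, Complex.exp_log hred]
    have h7 := symb_mul_eq_reducedSymb_mul hk h0 t
    have h8 := Complex.exp_ne_zero (thetaSum t)
    have h9 : t ^ 2 + 1 ≠ 0 := fun h => by
      rw [h, mul_zero] at h6; exact pow_ne_zero 2 ht0 h6.symm
    rw [div_div, div_eq_one_iff_eq (mul_ne_zero h8 hred)]
    refine mul_right_cancel₀ h9 ?_
    linear_combination h7 - reducedSymb k h t * h6
  obtain ⟨n, hn⟩ := Complex.exp_eq_one_iff.1 hone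
  have him2 := congrArg Complex.im hn
  simp only [thetaSum, theta, Complex.sub_im, Complex.add_im, Complex.log_im, a2, a1] at him2
  have e : ((n : ℂ) * (2 * Real.pi * Complex.I)).im = n * (2 * Real.pi) := by simp
  rw [e] at him2
  have h1' := abs_lt.1 h1
  have h2' := abs_lt.1 h2
  -- With a = arg(it) in [0, π/2), the model contributes π - 2a in (0, π]; the symbol contributes at
  -- most π/2, the two arguments near 0 at most π/2 in all, and the reduced symbol lies between π/4
  -- and 3π/4. The total stays strictly between -7π/4 and 7π/4.
  have hlt : (n : ℝ) < 1 := by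
    by_contra! hge
    nlinarith
  have hgt : (-1 : ℝ) < n := by
    by_contra! hge
    nlinarith
  have hn0 : n = 0 := by
    have hlt' : n < 1 := by exact_mod_cast hlt
    have hgt' : -1 < n := by exact_mod_cast hgt
    omega
  rw [hn0] at hn
  simp only [Int.cast_zero, zero_mul] at hn
  exact sub_eq_zero.1 hn

/-- If the symbol vanishes at the origin, its logarithm differs from the model `thetaSum` by a
function that is holomorphic near the whole path. -/
theorem exists_regular_part (hk : 0 < k) (hh : 0 < h) (h0 : symb k h 0 = 0) :
    ∃ r : ℝ, 0 < r ∧ r ≤ 1 ∧ ball (0 : ℂ) r ⊆ cutPlane k ∧ ∃ f : ℂ → ℂ,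
      DifferentiableOn ℂ f (quadrants ∪ ball 0 r) ∧
      (∀ ξ ∈ quadrants, f ξ = Complex.log (symb k h ξ) - thetaSum ξ) ∧
      ∀ ξ ∈ ball (0 : ℂ) r, Complex.exp (f ξ) * ξ ^ 2 = symb k h ξ * (ξ ^ 2 + 1) := by
  classical
  obtain ⟨r₀, hr₀, hball⟩ := Metric.eventually_nhds_iff_ball.1 (eventually_nearOrigin hk hh h0)
  set r := min r₀ 1
  have hr : 0 < r := lt_min hr₀ one_pos
  have hnear : ∀ ξ ∈ ball (0 : ℂ) r, NearOrigin k h ξ := fun ξ hξ =>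
    hball ξ (ball_subset_ball (min_le_left _ _) hξ)
  have hneg : ∀ ξ ∈ ball (0 : ℂ) r, -ξ ∈ ball (0 : ℂ) r := fun ξ hξ => by simpa using hξ
  have key : ∀ ξ ∈ quadrants, ξ ∈ ball (0 : ℂ) r →
      Complex.log (reducedSymb k h ξ) = Complex.log (symb k h ξ) - thetaSum ξ := by
    intro ξ hξ hb
    rcases hξ with hξ | hξ
    · exact (log_symb_sub_thetaSum hk hh h0 hξ (hnear ξ hb)).symm
    -- All three functions are even, so the second quadrant follows from the first by reflection.
    · have hmem : -ξ ∈ quadrantPM := ⟨by simpa using hξ.1, by simpa using hξ.2⟩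
      have := log_symb_sub_thetaSum hk hh h0 hmem (hnear _ (hneg ξ hb))
      rw [symb_neg, thetaSum_neg, reducedSymb_neg] at this
      exact this.symm
  have hlogd : DifferentiableOn ℂ (fun ξ => Complex.log (reducedSymb k h ξ)) (ball 0 r) :=
    fun ξ hξ => by
      obtain ⟨-, -, -, -, h5, h6⟩ := hnear ξ hξ
      exact ((reducedSymb_differentiableAt hk h h6).clog h5).differentiableWithinAt
  set f : ℂ → ℂ := fun ξ => if ξ ∈ ball (0 : ℂ) r then Complex.log (reducedSymb k h ξ)
    else Complex.log (symb k h ξ) - thetaSum ξ with hf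
  have hfq : ∀ ξ ∈ quadrants, f ξ = Complex.log (symb k h ξ) - thetaSum ξ := by
    intro ξ hξ
    by_cases hb : ξ ∈ ball (0 : ℂ) r
    · rw [hf]; simp only; rw [if_pos hb, key ξ hξ hb]
    · rw [hf]; simp only; rw [if_neg hb]
  have hfb : ∀ ξ ∈ ball (0 : ℂ) r, f ξ = Complex.log (reducedSymb k h ξ) := fun ξ hb => if_pos hb
  refine ⟨r, hr, min_le_right _ _, fun ξ hξ => (hnear ξ hξ).2.2.2.2.2, f, ?_, hfq, ?_⟩
  · refine DifferentiableOn.union_of_isOpen ?_ ?_ isOpen_quadrants isOpen_ball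
    · exact ((log_symb_differentiableOn hk hh).sub thetaSum_differentiableOn).congr hfq
    · exact hlogd.congr hfb
  · intro ξ hξ
    rw [hfb ξ hξ, Complex.exp_log (Complex.slitPlane_ne_zero (hnear ξ hξ).2.2.2.2.1),
      symb_mul_eq_reducedSymb_mul hk h0]

theorem admissible_local_integrable (hf : Admissible ℓ f) (R : ℝ) :
    IntegrableOn (fun s => f (path ℓ s)) (Icc (-R) R) := by
  have hc : Continuous fun s : ℝ => ((1 + |s| : ℝ) : ℂ) := by fun_prop
  refine ((Integrable.integrableOn hf).mul_continuousOn (hc.continuousOn)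
    isCompact_Icc).congr_fun (fun s _ => ?_) measurableSet_Icc
  have : ((1 + |s| : ℝ) : ℂ) ≠ 0 := by
    exact_mod_cast (by positivity : (0 : ℝ) < 1 + |s|).ne'
  simp only
  exact div_mul_cancel₀ _ this

theorem IsContour.path_mem_quadrants_union (hℓ : IsContour ℓ) {r : ℝ} (hr : 0 < r) (s : ℝ) :
    path ℓ s ∈ quadrants ∪ ball 0 r := by
  by_cases hs : s = 0
  · right; rw [hs, hℓ.path_zero]; exact mem_ball_self hr
  · exact Or.inl (hℓ.path_mem_quadrants hs)

theorem continuous_comp_path (hℓ : IsContour ℓ) {U : Set ℂ} (hU : IsOpen U)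
    (hd : DifferentiableOn ℂ f U) (hp : ∀ s, path ℓ s ∈ U) : Continuous fun s => f (path ℓ s) :=
  continuous_iff_continuousAt.2 fun s =>
    (hd.continuousOn.continuousAt (hU.mem_nhds (hp s))).comp hℓ.continuous_path.continuousAt

theorem ae_path_mem_quadrants (hℓ : IsContour ℓ) : ∀ᵐ s : ℝ, path ℓ s ∈ quadrants := by
  have h0 : ∀ᵐ s : ℝ, s ≠ 0 := by simp [ae_iff]
  filter_upwards [h0] with s hs using hℓ.path_mem_quadrants hs

/-- A zero of the symbol at the origin does no harm: the logarithm is then a locally bounded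
function on the path plus the admissible model `thetaSum`. -/
theorem log_symb_admissible (hk : 0 < k) (hh : 0 < h) (hℓ : IsContour ℓ) :
    Admissible ℓ fun t => Complex.log (symb k h t) := by
  by_cases h0 : symb k h 0 = 0
  · obtain ⟨r, hr, -, -, f, hd, hf, -⟩ := exists_regular_part hk hh h0
    refine log_symb_admissible_of_local hk hh hℓ (log_symb_aestronglyMeasurable hk h hℓ) fun R => ?_
    have h1 : IntegrableOn (fun s => f (path ℓ s)) (Icc (-R) R) :=
      (continuous_comp_path hℓ (isOpen_quadrants.union isOpen_ball) hd
        (hℓ.path_mem_quadrants_union hr)).integrableOn_Icc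
    refine (h1.add (admissible_local_integrable (thetaSum_admissible hℓ) R)).congr
      (ae_restrict_of_ae ?_)
    filter_upwards [ae_path_mem_quadrants hℓ] with s hs
    rw [Pi.add_apply, hf _ hs, sub_add_cancel]
  · exact log_symb_admissible_of_ne hk hh hℓ h0

end

section

variable {k h : ℝ} {ℓ : ℝ → ℝ} {f g : ℂ → ℂ}

/-! ### The Wiener–Hopf factors and their continuation across the path -/

open Classical in
/-- `K⁺`, continued below the path as `(1 - exp(2iμh)) / K⁻`. -/
def plusFactor (k h : ℝ) (ℓ : ℝ → ℝ) (ξ : ℂ) : ℂ :=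
  if ℓ ξ.re ≤ ξ.im then Kplus k h ℓ ξ else symb k h ξ / Kminus k h ℓ ξ

open Classical in
/-- `K⁻`, continued above the path as `(1 - exp(2iμh)) / K⁺`. -/
def minusFactor (k h : ℝ) (ℓ : ℝ → ℝ) (ξ : ℂ) : ℂ :=
  if ξ.im ≤ ℓ ξ.re then Kminus k h ℓ ξ else symb k h ξ / Kplus k h ℓ ξ

theorem Kplus_above {ξ : ℂ} (hξ : ℓ ξ.re < ξ.im) : Kplus k h ℓ ξ = Complex.exp
    (1 / (2 * (Real.pi : ℂ) * Complex.I) * cauchyInt ℓ (fun t => Complex.log (symb k h t)) ξ) :=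
  if_neg hξ.ne'

theorem Kminus_below {ξ : ℂ} (hξ : ξ.im < ℓ ξ.re) : Kminus k h ℓ ξ = Complex.exp
    (-(1 / (2 * (Real.pi : ℂ) * Complex.I)
      * cauchyInt ℓ (fun t => Complex.log (symb k h t)) ξ)) :=
  if_neg hξ.ne

theorem Kplus_ne_zero {ξ : ℂ} (hξ : ℓ ξ.re < ξ.im) : Kplus k h ℓ ξ ≠ 0 := by
  rw [Kplus_above hξ]; exact Complex.exp_ne_zero _

theorem Kminus_ne_zero {ξ : ℂ} (hξ : ξ.im < ℓ ξ.re) : Kminus k h ℓ ξ ≠ 0 := by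
  rw [Kminus_below hξ]; exact Complex.exp_ne_zero _

theorem Kplus_differentiableAt (hk : 0 < k) (hh : 0 < h) (hℓ : IsContour ℓ) {ξ : ℂ}
    (hξ : ℓ ξ.re < ξ.im) : DifferentiableAt ℂ (Kplus k h ℓ) ξ := by
  have h1 := (cauchyInt_differentiableOn hℓ (log_symb_admissible hk hh hℓ)).differentiableAt
    (hℓ.isOpen_off.mem_nhds hξ.ne')
  refine (h1.const_mul (1 / (2 * (Real.pi : ℂ) * Complex.I))).cexp.congr_of_eventuallyEq ?_
  filter_upwards [hℓ.isOpen_above.mem_nhds hξ] with z hz using Kplus_above hz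

theorem Kminus_differentiableAt (hk : 0 < k) (hh : 0 < h) (hℓ : IsContour ℓ) {ξ : ℂ}
    (hξ : ξ.im < ℓ ξ.re) : DifferentiableAt ℂ (Kminus k h ℓ) ξ := by
  have h1 := (cauchyInt_differentiableOn hℓ (log_symb_admissible hk hh hℓ)).differentiableAt
    (hℓ.isOpen_off.mem_nhds hξ.ne)
  refine (h1.const_mul (1 / (2 * (Real.pi : ℂ) * Complex.I))).neg.cexp.congr_of_eventuallyEq ?_
  filter_upwards [hℓ.isOpen_below.mem_nhds hξ] with z hz using Kminus_below hz

theorem plusFactor_differentiableAt_above (hk : 0 < k) (hh : 0 < h) (hℓ : IsContour ℓ) {ξ : ℂ}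
    (hξ : ℓ ξ.re < ξ.im) : DifferentiableAt ℂ (plusFactor k h ℓ) ξ := by
  refine (Kplus_differentiableAt hk hh hℓ hξ).congr_of_eventuallyEq ?_
  filter_upwards [hℓ.isOpen_above.mem_nhds hξ] with z hz using if_pos (le_of_lt hz)

theorem plusFactor_differentiableAt_below (hk : 0 < k) (hh : 0 < h) (hℓ : IsContour ℓ) {ξ : ℂ}
    (hξ : ξ.im < ℓ ξ.re) (hc : ξ ∈ cutPlane k) : DifferentiableAt ℂ (plusFactor k h ℓ) ξ := by
  refine ((symb_differentiableAt hk h hc).div (Kminus_differentiableAt hk hh hℓ hξ)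
    (Kminus_ne_zero hξ)).congr_of_eventuallyEq ?_
  filter_upwards [hℓ.isOpen_below.mem_nhds hξ] with z hz using if_neg (not_le.2 hz)

theorem minusFactor_differentiableAt_below (hk : 0 < k) (hh : 0 < h) (hℓ : IsContour ℓ) {ξ : ℂ}
    (hξ : ξ.im < ℓ ξ.re) : DifferentiableAt ℂ (minusFactor k h ℓ) ξ := by
  refine (Kminus_differentiableAt hk hh hℓ hξ).congr_of_eventuallyEq ?_
  filter_upwards [hℓ.isOpen_below.mem_nhds hξ] with z hz using if_pos (le_of_lt hz)

theorem minusFactor_differentiableAt_above (hk : 0 < k) (hh : 0 < h) (hℓ : IsContour ℓ) {ξ : ℂ}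
    (hξ : ℓ ξ.re < ξ.im) (hc : ξ ∈ cutPlane k) : DifferentiableAt ℂ (minusFactor k h ℓ) ξ := by
  refine ((symb_differentiableAt hk h hc).div (Kplus_differentiableAt hk hh hℓ hξ)
    (Kplus_ne_zero hξ)).congr_of_eventuallyEq ?_
  filter_upwards [hℓ.isOpen_above.mem_nhds hξ] with z hz using if_neg (not_le.2 hz)

/-- The definitions above, on and below the path collapse to one formula. On the path the principal
value supplies half of the logarithm and the prefactor, the square root of the symbol, supplies the
other half. -/
theorem plusFactor_eq_on_regularSet (hk : 0 < k) (hh : 0 < h) (hℓ : IsContour ℓ) {ξ : ℂ}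
    (hξ : ξ ∈ regularSet k h) : plusFactor k h ℓ ξ =
      Complex.exp (minusPart ℓ (fun t => Complex.log (symb k h t)) ξ
        + Complex.log (symb k h ξ)) := by
  have hadm := log_symb_admissible hk hh hℓ
  have hne : symb k h ξ ≠ 0 := Complex.slitPlane_ne_zero hξ.2
  rcases lt_trichotomy ξ.im (ℓ ξ.re) with hlt | heq | hgt
  · rw [plusFactor, if_neg (not_le.2 hlt), Kminus_below hlt, cauchyInt_below hℓ hadm hlt,
      Complex.exp_add, Complex.exp_log hne, Complex.exp_neg, div_inv_eq_mul, mul_comm]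
  · rw [plusFactor, if_pos heq.ge, Kplus, if_pos heq, pvInt_on hℓ hadm (isOpen_regularSet hk h)
      (log_symb_differentiableOn_regularSet hk h) hξ heq, csqrt_eq_exp hne, ← Complex.exp_add]
    congr 1; ring
  · rw [plusFactor, if_pos hgt.le, Kplus_above hgt, cauchyInt_above hℓ hadm hgt]

theorem minusFactor_eq_on_regularSet (hk : 0 < k) (hh : 0 < h) (hℓ : IsContour ℓ) {ξ : ℂ}
    (hξ : ξ ∈ regularSet k h) : minusFactor k h ℓ ξ =
      Complex.exp (-minusPart ℓ (fun t => Complex.log (symb k h t)) ξ) := by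
  have hadm := log_symb_admissible hk hh hℓ
  have hne : symb k h ξ ≠ 0 := Complex.slitPlane_ne_zero hξ.2
  rcases lt_trichotomy ξ.im (ℓ ξ.re) with hlt | heq | hgt
  · rw [minusFactor, if_pos hlt.le, Kminus_below hlt, cauchyInt_below hℓ hadm hlt]
  · rw [minusFactor, if_pos heq.le, Kminus, if_pos heq, pvInt_on hℓ hadm (isOpen_regularSet hk h)
      (log_symb_differentiableOn_regularSet hk h) hξ heq, csqrt_eq_exp hne, ← Complex.exp_add]
    congr 1; ring
  · rw [minusFactor, if_neg (not_le.2 hgt), Kplus_above hgt, cauchyInt_above hℓ hadm hgt,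
      Complex.exp_add, Complex.exp_log hne, Complex.exp_neg]
    have := Complex.exp_ne_zero (minusPart ℓ (fun t => Complex.log (symb k h t)) ξ)
    field_simp

theorem log_symb_minusPart_differentiableAt (hk : 0 < k) (hh : 0 < h) (hℓ : IsContour ℓ) {ξ : ℂ}
    (hξ : ξ ∈ regularSet k h) :
    DifferentiableAt ℂ (minusPart ℓ fun t => Complex.log (symb k h t)) ξ :=
  (minusPart_differentiableOn hℓ (log_symb_admissible hk hh hℓ) (isOpen_regularSet hk h)
    (log_symb_differentiableOn_regularSet hk h)).differentiableAt
    ((isOpen_regularSet hk h).mem_nhds hξ)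

theorem plusFactor_differentiableAt_regularSet (hk : 0 < k) (hh : 0 < h) (hℓ : IsContour ℓ) {ξ : ℂ}
    (hξ : ξ ∈ regularSet k h) : DifferentiableAt ℂ (plusFactor k h ℓ) ξ := by
  refine ((log_symb_minusPart_differentiableAt hk hh hℓ hξ).add
    ((symb_differentiableAt hk h hξ.1).clog hξ.2)).cexp.congr_of_eventuallyEq ?_
  filter_upwards [(isOpen_regularSet hk h).mem_nhds hξ] with z hz
  exact plusFactor_eq_on_regularSet hk hh hℓ hz

theorem minusFactor_differentiableAt_regularSet (hk : 0 < k) (hh : 0 < h) (hℓ : IsContour ℓ)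
    {ξ : ℂ} (hξ : ξ ∈ regularSet k h) : DifferentiableAt ℂ (minusFactor k h ℓ) ξ := by
  refine (log_symb_minusPart_differentiableAt hk hh hℓ hξ).neg.cexp.congr_of_eventuallyEq ?_
  filter_upwards [(isOpen_regularSet hk h).mem_nhds hξ] with z hz
  exact minusFactor_eq_on_regularSet hk hh hℓ hz

/-- A point of the path is the limit of the points vertically above it, which are off the path, so
continuity transfers the identity. -/
theorem eq_on_path_of_eq_off {F G : ℂ → ℂ} {ξ : ℂ} (hF : ContinuousAt F ξ)
    (hG : ContinuousAt G ξ) (hξ : ξ.im = ℓ ξ.re)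
    (h : ∀ᶠ z in 𝓝 ξ, z.im ≠ ℓ z.re → F z = G z) : F ξ = G ξ := by
  have h1 : Tendsto (fun δ : ℝ => ξ + (δ : ℂ) * Complex.I) (𝓝[>] 0) (𝓝 ξ) := by
    have : Tendsto (fun δ : ℝ => ξ + (δ : ℂ) * Complex.I) (𝓝 0)
        (𝓝 (ξ + ((0 : ℝ) : ℂ) * Complex.I)) :=
      Continuous.tendsto (f := fun δ : ℝ => ξ + (δ : ℂ) * Complex.I) (by fun_prop) 0
    simp only [Complex.ofReal_zero, zero_mul, add_zero] at this
    exact this.mono_left nhdsWithin_le_nhds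
  refine tendsto_nhds_unique (hF.tendsto.comp h1) ((hG.tendsto.comp h1).congr' ?_)
  filter_upwards [h1.eventually h, self_mem_nhdsWithin] with δ hδ hδ0
  refine (hδ ?_).symm
  have : (0 : ℝ) < δ := hδ0
  simp [hξ, this.ne']

/-- The behaviour of both factors near a zero of the symbol at the origin. -/
theorem factors_near_zero (hk : 0 < k) (hh : 0 < h) (hℓ : IsContour ℓ) (h0 : symb k h 0 = 0) :
    DifferentiableAt ℂ (plusFactor k h ℓ) 0 ∧ DifferentiableAt ℂ (minusFactor k h ℓ) 0 := by
  obtain ⟨r, hr, hr1, hrc, f, hd, hfq, hfb⟩ := exists_regular_part hk hh h0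
  have hU : IsOpen (quadrants ∪ ball (0 : ℂ) r) := isOpen_quadrants.union isOpen_ball
  have hΘ := thetaSum_admissible hℓ
  have hf : Admissible ℓ f := by
    refine ((log_symb_admissible hk hh hℓ).sub hΘ).congr ?_
    filter_upwards [ae_path_mem_quadrants hℓ] with s hs using (hfq _ hs).symm
  have hadd : ∀ ξ : ℂ, ξ.im ≠ ℓ ξ.re → cauchyInt ℓ (fun t => Complex.log (symb k h t)) ξ
      = cauchyInt ℓ f ξ + cauchyInt ℓ thetaSum ξ := by
    intro ξ hξ
    rw [← cauchyInt_add hℓ hf hΘ hξ]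
    refine cauchyInt_congr ?_
    filter_upwards [ae_path_mem_quadrants hℓ] with s hs
    rw [hfq _ hs, sub_add_cancel]
  have hm : ∀ ξ ∈ ball (0 : ℂ) r, DifferentiableAt ℂ (minusPart ℓ f) ξ := fun ξ hξ =>
    (minusPart_differentiableOn hℓ hf hU hd).differentiableAt (hU.mem_nhds (Or.inr hξ))
  have hfd : ∀ ξ ∈ ball (0 : ℂ) r, DifferentiableAt ℂ f ξ := fun ξ hξ =>
    hd.differentiableAt (hU.mem_nhds (Or.inr hξ))
  have hI : ∀ ξ ∈ ball (0 : ℂ) r, ξ + Complex.I ≠ 0 ∧ ξ - Complex.I ≠ 0 := by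
    intro ξ hξ
    have h1 : ‖ξ‖ < 1 := by rw [mem_ball_zero_iff] at hξ; linarith
    constructor
    · intro h2
      rw [eq_neg_of_add_eq_zero_left h2, norm_neg, Complex.norm_I] at h1
      exact lt_irrefl _ h1
    · intro h2
      rw [sub_eq_zero.1 h2, Complex.norm_I] at h1
      exact lt_irrefl _ h1
  -- These are the candidate continuations: the regular part is exponentiated as before, and the
  -- model part contributes t/(t + i) to K⁺ and t/(t - i) to K⁻. Each factor thus takes one of the
  -- two zeros of the symbol.
  set P : ℂ → ℂ := fun ξ => Complex.exp (minusPart ℓ f ξ + f ξ) * (ξ / (ξ + Complex.I)) with hP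
  set M : ℂ → ℂ := fun ξ => Complex.exp (-minusPart ℓ f ξ) * (ξ / (ξ - Complex.I)) with hM
  have hPd : ∀ ξ ∈ ball (0 : ℂ) r, DifferentiableAt ℂ P ξ := fun ξ hξ =>
    ((hm ξ hξ).add (hfd ξ hξ)).cexp.mul
      (differentiableAt_id.div (differentiableAt_id.add_const _) (hI ξ hξ).1)
  have hMd : ∀ ξ ∈ ball (0 : ℂ) r, DifferentiableAt ℂ M ξ := fun ξ hξ =>
    (hm ξ hξ).neg.cexp.mul
      (differentiableAt_id.div (differentiableAt_id.sub_const _) (hI ξ hξ).2)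
  have hKp : ∀ ξ : ℂ, ℓ ξ.re < ξ.im → Kplus k h ℓ ξ = P ξ := by
    intro ξ hξ
    rw [Kplus_above hξ, hadd ξ hξ.ne', mul_add, cauchyInt_above hℓ hf hξ,
      cauchyInt_thetaSum_above hℓ hξ, Complex.exp_add, exp_theta (above_mem_thetaDomain hℓ hξ)]
  have hKm : ∀ ξ : ℂ, ξ.im < ℓ ξ.re → Kminus k h ℓ ξ = M ξ := by
    intro ξ hξ
    rw [Kminus_below hξ, hadd ξ hξ.ne, mul_add, cauchyInt_below hℓ hf hξ,
      cauchyInt_thetaSum_below hℓ hξ, neg_add, neg_neg, Complex.exp_add,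
      exp_theta (neg_below_mem_thetaDomain hℓ hξ), hM]
    simp only
    rw [show -ξ + Complex.I = -(ξ - Complex.I) by ring, neg_div_neg_eq]
  have hprod : ∀ ξ ∈ ball (0 : ℂ) r, symb k h ξ = P ξ * M ξ := by
    intro ξ hξ
    have h1 := hfb ξ hξ
    obtain ⟨hI1, hI2⟩ := hI ξ hξ
    have h2 := Complex.exp_ne_zero (minusPart ℓ f ξ)
    simp only [hP, hM]
    rw [Complex.exp_add, Complex.exp_neg]
    field_simp
    linear_combination -h1 - symb k h ξ * Complex.I_sq
  have hMne : ∀ ξ : ℂ, ξ.im < ℓ ξ.re → M ξ ≠ 0 := fun ξ hξ => hKm ξ hξ ▸ Kminus_ne_zero hξ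
  have hPne : ∀ ξ : ℂ, ℓ ξ.re < ξ.im → P ξ ≠ 0 := fun ξ hξ => hKp ξ hξ ▸ Kplus_ne_zero hξ
  have hoffP : ∀ ξ ∈ ball (0 : ℂ) r, ξ.im ≠ ℓ ξ.re → plusFactor k h ℓ ξ = P ξ := by
    intro ξ hξ hne
    rcases lt_or_gt_of_ne hne with hlt | hgt
    · rw [plusFactor, if_neg (not_le.2 hlt), hKm ξ hlt, hprod ξ hξ,
        mul_div_cancel_right₀ _ (hMne ξ hlt)]
    · rw [plusFactor, if_pos (le_of_lt hgt), hKp ξ hgt]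
  have hoffM : ∀ ξ ∈ ball (0 : ℂ) r, ξ.im ≠ ℓ ξ.re → minusFactor k h ℓ ξ = M ξ := by
    intro ξ hξ hne
    rcases lt_or_gt_of_ne hne with hlt | hgt
    · rw [minusFactor, if_pos (le_of_lt hlt), hKm ξ hlt]
    · rw [minusFactor, if_neg (not_le.2 hgt), hKp ξ hgt, hprod ξ hξ,
        mul_div_cancel_left₀ _ (hPne ξ hgt)]
  have hreg : ∀ ξ : ℂ, ξ.im = ℓ ξ.re → ξ ≠ 0 → ξ ∈ regularSet k h := fun ξ hξ hne =>
    quadrants_subset_regularSet hh (hℓ.mem_quadrants_of_on hξ hne)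
  have hz : (0 : ℂ).im = ℓ (0 : ℂ).re := by simp [hℓ.zero]
  -- At the origin itself the prefactor vanishes, so both factors are 0 there whatever value the
  -- principal value integral has, in agreement with `P` and `M`.
  have hc0 : csqrt (symb k h 0) = 0 := csqrt_eq_zero.2 h0
  constructor
  · refine (hPd 0 (mem_ball_self hr)).congr_of_eventuallyEq ?_
    filter_upwards [ball_mem_nhds (0 : ℂ) hr] with ξ hξ
    by_cases hon : ξ.im = ℓ ξ.re
    · by_cases hne : ξ = 0
      · rw [hne, plusFactor, if_pos hz.ge, Kplus, if_pos hz, hc0, hP]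
        simp
      · refine eq_on_path_of_eq_off
          (plusFactor_differentiableAt_regularSet hk hh hℓ (hreg ξ hon hne)).continuousAt
          (hPd ξ hξ).continuousAt hon ?_
        filter_upwards [isOpen_ball.mem_nhds hξ] with z hz using hoffP z hz
    · exact hoffP ξ hξ hon
  · refine (hMd 0 (mem_ball_self hr)).congr_of_eventuallyEq ?_
    filter_upwards [ball_mem_nhds (0 : ℂ) hr] with ξ hξ
    by_cases hon : ξ.im = ℓ ξ.re
    · by_cases hne : ξ = 0
      · rw [hne, minusFactor, if_pos hz.le, Kminus, if_pos hz, hc0, hM]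
        simp
      · refine eq_on_path_of_eq_off
          (minusFactor_differentiableAt_regularSet hk hh hℓ (hreg ξ hon hne)).continuousAt
          (hMd ξ hξ).continuousAt hon ?_
        filter_upwards [isOpen_ball.mem_nhds hξ] with z hz using hoffM z hz
    · exact hoffM ξ hξ hon

theorem factors_differentiableAt_on (hk : 0 < k) (hh : 0 < h) (hℓ : IsContour ℓ) {ξ : ℂ}
    (hξ : ξ.im = ℓ ξ.re) :
    DifferentiableAt ℂ (plusFactor k h ℓ) ξ ∧ DifferentiableAt ℂ (minusFactor k h ℓ) ξ := by
  by_cases hne : ξ = 0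
  · by_cases h0 : symb k h 0 = 0
    · rw [hne]; exact factors_near_zero hk hh hℓ h0
    · have := zero_mem_regularSet hk h0
      rw [hne]
      exact ⟨plusFactor_differentiableAt_regularSet hk hh hℓ this,
        minusFactor_differentiableAt_regularSet hk hh hℓ this⟩
  · have := quadrants_subset_regularSet (k := k) hh (hℓ.mem_quadrants_of_on hξ hne)
    exact ⟨plusFactor_differentiableAt_regularSet hk hh hℓ this,
      minusFactor_differentiableAt_regularSet hk hh hℓ this⟩

/-- The ray [k, ∞) lies above the path, where K⁺ is a Cauchy integral and the symbol does not
appear. Only the left ray remains as a singular set. -/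
theorem plusFactor_differentiableAt (hk : 0 < k) (hh : 0 < h) (hℓ : IsContour ℓ) {ξ : ℂ}
    (hξ : ξ ∉ cut k) : DifferentiableAt ℂ (plusFactor k h ℓ) ξ := by
  rcases lt_trichotomy ξ.im (ℓ ξ.re) with hlt | heq | hgt
  · exact plusFactor_differentiableAt_below hk hh hℓ hlt (hℓ.below_mem_cutPlane hlt.le hk hξ)
  · exact (factors_differentiableAt_on hk hh hℓ heq).1
  · exact plusFactor_differentiableAt_above hk hh hℓ hgt

theorem minusFactor_differentiableAt (hk : 0 < k) (hh : 0 < h) (hℓ : IsContour ℓ) {ξ : ℂ}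
    (hξ : ξ ∈ cutPlane k) : DifferentiableAt ℂ (minusFactor k h ℓ) ξ := by
  rcases lt_trichotomy ξ.im (ℓ ξ.re) with hlt | heq | hgt
  · exact minusFactor_differentiableAt_below hk hh hℓ hlt
  · exact (factors_differentiableAt_on hk hh hℓ heq).2
  · exact minusFactor_differentiableAt_above hk hh hℓ hgt hξ

end

section

variable {k h : ℝ} {ℓ : ℝ → ℝ} {f g : ℂ → ℂ}

/-! ### Decay of Cauchy transforms along the real axis -/

theorem rpow_neg_mul_rpow_neg_le {u v a b : ℝ} (hu : 1 ≤ u) (hv : 1 ≤ v) (ha : 0 ≤ a)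
    (hb : 0 ≤ b) : u ^ (-a) * v ^ (-b) ≤ u ^ (-(a + b)) + v ^ (-(a + b)) := by
  have hu0 : 0 < u := by linarith
  have hv0 : 0 < v := by linarith
  rcases le_total u v with h | h
  · calc u ^ (-a) * v ^ (-b) ≤ u ^ (-a) * u ^ (-b) := by
          gcongr ?_ * ?_
          exact Real.rpow_le_rpow_of_nonpos hu0 h (by linarith)
      _ = u ^ (-(a + b)) := by rw [← Real.rpow_add hu0]; congr 1; ring
      _ ≤ _ := le_add_of_nonneg_right (by positivity)
  · calc u ^ (-a) * v ^ (-b) ≤ v ^ (-a) * v ^ (-b) := by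
          gcongr ?_ * ?_
          exact Real.rpow_le_rpow_of_nonpos hv0 h (by linarith)
      _ = v ^ (-(a + b)) := by rw [← Real.rpow_add hv0]; congr 1; ring
      _ ≤ _ := le_add_of_nonneg_left (by positivity)

/-- The growing factor x ^ η is split by subadditivity and absorbed into u or v. Each resulting
product has total exponent 1 + α - η and is dominated by that power of the smaller of u and v. -/
theorem rpow_mul_inv_mul_rpow_le {u v x α η : ℝ} (hu : 1 ≤ u) (hv : 1 ≤ v) (hx : 0 ≤ x)
    (hxuv : x ≤ u + v) (hη : 0 ≤ η) (hηα : η ≤ α) (hα : α ≤ 1) :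
    x ^ η * (u⁻¹ * v ^ (-α)) ≤ 2 * (u ^ (-(1 + α - η)) + v ^ (-(1 + α - η))) := by
  have hu0 : 0 < u := by linarith
  have hv0 : 0 < v := by linarith
  have h1 : x ^ η ≤ u ^ η + v ^ η :=
    (Real.rpow_le_rpow hx hxuv hη).trans (Real.rpow_add_le_add_rpow hu0.le hv0.le hη
      (hηα.trans hα))
  have h2 := rpow_neg_mul_rpow_neg_le hu hv (a := 1 - η) (b := α) (by linarith) (by linarith)
  have h3 := rpow_neg_mul_rpow_neg_le hu hv (a := 1) (b := α - η) (by linarith) (by linarith)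
  have e2 : u ^ η * (u⁻¹ * v ^ (-α)) = u ^ (-(1 - η)) * v ^ (-α) := by
    rw [← mul_assoc, ← Real.rpow_neg_one u, ← Real.rpow_add hu0]; congr 2; ring
  have e3 : v ^ η * (u⁻¹ * v ^ (-α)) = u ^ (-1 : ℝ) * v ^ (-(α - η)) := by
    rw [mul_left_comm, ← Real.rpow_add hv0, Real.rpow_neg_one]; congr 2; ring
  rw [show -(1 - η + α) = -(1 + α - η) by ring] at h2
  rw [show -(1 + (α - η)) = -(1 + α - η) by ring] at h3
  calc x ^ η * (u⁻¹ * v ^ (-α)) ≤ (u ^ η + v ^ η) * (u⁻¹ * v ^ (-α)) := by gcongr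
    _ = u ^ (-(1 - η)) * v ^ (-α) + u ^ (-1 : ℝ) * v ^ (-(α - η)) := by rw [add_mul, e2, e3]
    _ ≤ _ := by linarith

theorem norm_add_I_le (t : ℂ) : ‖t + Complex.I‖ ≤ |t.re| + |t.im| + 1 := by
  refine (norm_add_le _ _).trans ?_
  rw [Complex.norm_I]
  linarith [Complex.norm_le_abs_re_add_abs_im t]

theorem ball_subset_strips {R b : ℝ} {ξ : ℂ} (hξ : ξ ∈ strips (R + 1) (b - 1)) :
    ball ξ 1 ⊆ strips R b := by
  intro z hz
  rw [mem_ball, dist_eq_norm] at hz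
  have h1 := Complex.abs_re_le_norm (z - ξ)
  have h2 := Complex.abs_im_le_norm (z - ξ)
  rw [Complex.sub_re] at h1
  rw [Complex.sub_im] at h2
  have h3 := abs_sub_abs_le_abs_sub ξ.re z.re
  have h4 := abs_sub_abs_le_abs_sub z.im ξ.im
  rw [abs_sub_comm] at h3
  have h5 := hξ.1
  have h6 := hξ.2
  constructor <;> linarith

/-- Bound near the singularity. -/
theorem norm_subtractedKernel_near (hℓ : IsContour ℓ) {B A R b M α : ℝ}
    (hB : ∀ s, ‖pathDeriv ℓ s‖ ≤ B) (hA0 : 0 < A)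
    (hA : ∀ s, 1 + |s| ≤ A * ‖path ℓ s + Complex.I‖)
    (hR : 1 ≤ R) (hb : 0 ≤ b) (hα0 : 0 < α) (hα1 : α ≤ 1)
    (hd : DifferentiableOn ℂ f (strips R b))
    (hM0 : 0 ≤ M) (hM : ∀ ξ ∈ strips R b, ‖f ξ‖ ≤ M * |ξ.re| ^ (-α)) {ξ : ℂ}
    (hξ : ξ ∈ strips (R + 1) (b - 1)) {s : ℝ} (hs : path ℓ s ∈ ball ξ (2 * (1 / 3))) :
    ‖subtractedKernel ℓ f ξ s‖ ≤ 24 * M * (b + 3) * A * B * |ξ.re| ^ (-α) := by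
  set x := |ξ.re| with hx
  have hx2 : 2 ≤ x := by have := hξ.1; linarith
  have hx0 : 0 < x := by linarith
  have hB0 : 0 ≤ B := (norm_nonneg _).trans (hB 0)
  have hsub := ball_subset_strips hξ
  -- Radius 1/3 in the difference quotient estimate makes the largest disc the unit disc; this
  -- accounts for the loss of 1 in both parameters of the strip.
  have h3 : (3 * (1 / 3) : ℝ) = 1 := by norm_num
  have hsup : ∀ z ∈ ball ξ (3 * (1 / 3)), ‖f z * (z + Complex.I)‖ ≤
      (2 * M * x ^ (-α)) * ((b + 3) * x) := by
    rw [h3]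
    intro z hz
    have hz' := hsub hz
    rw [mem_ball, dist_eq_norm] at hz
    have h1 := Complex.abs_re_le_norm (z - ξ)
    rw [Complex.sub_re] at h1
    have h4 := abs_sub_abs_le_abs_sub ξ.re z.re
    rw [abs_sub_comm] at h4
    have h5 := abs_sub_abs_le_abs_sub z.re ξ.re
    have hlow : x / 2 ≤ |z.re| := by linarith
    rw [norm_mul]
    gcongr
    · refine (hM z hz').trans ?_
      have h6 : |z.re| ^ (-α) ≤ (x / 2) ^ (-α) :=
        Real.rpow_le_rpow_of_nonpos (by linarith) hlow (by linarith)
      have h7 : (x / 2) ^ (-α) = x ^ (-α) * 2 ^ α := by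
        rw [Real.div_rpow hx0.le (by norm_num), Real.rpow_neg (by norm_num : (0 : ℝ) ≤ 2) α,
          div_inv_eq_mul]
      have h8 : (2 : ℝ) ^ α ≤ 2 := by
        calc (2 : ℝ) ^ α ≤ 2 ^ (1 : ℝ) := Real.rpow_le_rpow_of_exponent_le (by norm_num) hα1
          _ = 2 := Real.rpow_one 2
      have h9 : 0 ≤ x ^ (-α) := by positivity
      calc M * |z.re| ^ (-α) ≤ M * (x ^ (-α) * 2) := by
            gcongr
            rw [h7] at h6
            exact h6.trans (by gcongr)
        _ = _ := by ring
    · refine (norm_add_I_le z).trans ?_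
      have := hz'.2
      nlinarith
  have hdd : DifferentiableOn ℂ (fun t => f t * (t + Complex.I)) (ball ξ (3 * (1 / 3))) := by
    rw [h3]
    exact (hd.mono hsub).mul (by fun_prop)
  have h1 := norm_dslope_le_of_ball (by norm_num) hdd hsup hs
    (mem_ball_self (by norm_num : (0 : ℝ) < 2 * (1 / 3)))
  have hs' : |s - ξ.re| < 1 := by
    rw [mem_ball, dist_eq_norm] at hs
    exact (abs_sub_le_norm_path_sub ℓ s ξ).trans_lt (hs.trans (by norm_num))
  have hslow : x / 2 ≤ 1 + |s| := by
    have := abs_sub_abs_le_abs_sub ξ.re s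
    rw [abs_sub_comm] at this
    linarith
  have h2 : ‖path ℓ s + Complex.I‖⁻¹ ≤ A * (2 / x) := by
    rw [inv_le_comm₀ (norm_pos_iff.2 (hℓ.path_add_I_ne_zero s)) (by positivity), mul_inv, inv_div,
      inv_mul_le_iff₀ hA0]
    linarith [hA s]
  calc ‖subtractedKernel ℓ f ξ s‖
      = ‖dslope (fun t => f t * (t + Complex.I)) (path ℓ s) ξ‖ * ‖path ℓ s + Complex.I‖⁻¹
        * ‖pathDeriv ℓ s‖ := by rw [subtractedKernel, norm_mul, norm_div, div_eq_mul_inv]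
    _ ≤ ((2 * M * x ^ (-α)) * ((b + 3) * x) / (1 / 3 / 2)) * (A * (2 / x)) * B := by
        gcongr
        exact hB s
    _ = 24 * M * (b + 3) * A * B * x ^ (-α) := by field_simp; ring

/-- Bound away from the singularity. -/
theorem norm_subtractedKernel_far (hℓ : IsContour ℓ) {B A : ℝ}
    (hB : ∀ s, ‖pathDeriv ℓ s‖ ≤ B) (hA0 : 0 < A)
    (hA : ∀ s, 1 + |s| ≤ A * ‖path ℓ s + Complex.I‖) {ξ : ℂ} {s : ℝ}
    (hs : path ℓ s ∉ ball ξ (2 * (1 / 3))) :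
    ‖subtractedKernel ℓ f ξ s‖ ≤ B * (5 / 2 * (‖f (path ℓ s)‖ * (1 + |s - ξ.re|)⁻¹)
      + 5 / 2 * A * ‖f ξ * (ξ + Complex.I)‖ * ((1 + |s - ξ.re|)⁻¹ * (1 + |s|)⁻¹)) := by
  have hB0 : 0 ≤ B := (norm_nonneg _).trans (hB s)
  rw [mem_ball, dist_eq_norm, not_lt] at hs
  have hu : 0 < 1 + |s - ξ.re| := by positivity
  have hv : 0 < 1 + |s| := by positivity
  have hlow : 1 + |s - ξ.re| ≤ 5 / 2 * ‖path ℓ s - ξ‖ := by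
    have := abs_sub_le_norm_path_sub ℓ s ξ
    linarith
  have hz : path ℓ s - ξ ≠ 0 := by
    intro h0; rw [h0, norm_zero] at hs; linarith
  have hI := hℓ.path_add_I_ne_zero s
  have e : subtractedKernel ℓ f ξ s = (f (path ℓ s) / (path ℓ s - ξ)
      - f ξ * (ξ + Complex.I) / ((path ℓ s - ξ) * (path ℓ s + Complex.I))) * pathDeriv ℓ s := by
    rw [subtractedKernel_of_ne hz]; field_simp
  have h1 : ‖path ℓ s - ξ‖⁻¹ ≤ 5 / 2 * (1 + |s - ξ.re|)⁻¹ := by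
    rw [inv_le_comm₀ (norm_pos_iff.2 hz) (by positivity), mul_inv, inv_inv,
      inv_mul_le_iff₀ (by norm_num)]
    exact hlow
  have h2 : ‖path ℓ s + Complex.I‖⁻¹ ≤ A * (1 + |s|)⁻¹ := by
    rw [inv_le_comm₀ (norm_pos_iff.2 hI) (by positivity), mul_inv, inv_inv,
      inv_mul_le_iff₀ hA0]
    exact hA s
  rw [e, norm_mul, mul_comm]
  refine mul_le_mul (hB s) ?_ (norm_nonneg _) hB0
  refine (norm_sub_le _ _).trans (add_le_add ?_ ?_)
  · rw [norm_div, div_eq_mul_inv]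
    calc _ ≤ ‖f (path ℓ s)‖ * (5 / 2 * (1 + |s - ξ.re|)⁻¹) := by gcongr
      _ = _ := by ring
  · rw [norm_div (f ξ * (ξ + Complex.I)), norm_mul (path ℓ s - ξ), div_eq_mul_inv, mul_inv]
    calc _ ≤ ‖f ξ * (ξ + Complex.I)‖ * ((5 / 2 * (1 + |s - ξ.re|)⁻¹) * (A * (1 + |s|)⁻¹)) := by
          gcongr
      _ = _ := by ring

theorem rpow_neg_abs_le {s α : ℝ} (hs : 1 ≤ |s|) (hα0 : 0 ≤ α) (hα1 : α ≤ 1) :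
    |s| ^ (-α) ≤ 2 * (1 + |s|) ^ (-α) := by
  have h0 : 0 < |s| := by linarith
  have h1 : (2 * |s|) ^ (-α) ≤ (1 + |s|) ^ (-α) :=
    Real.rpow_le_rpow_of_nonpos (by linarith) (by linarith) (by linarith)
  rw [Real.mul_rpow (by norm_num) h0.le] at h1
  have h2 : (1 : ℝ) ≤ 2 * 2 ^ (-α) := by
    calc (1 : ℝ) = 2 ^ (0 : ℝ) := (Real.rpow_zero 2).symm
      _ ≤ 2 ^ (1 + -α) := Real.rpow_le_rpow_of_exponent_le (by norm_num) (by linarith)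
      _ = 2 * 2 ^ (-α) := by rw [Real.rpow_add (by norm_num), Real.rpow_one]
  have h3 : 0 ≤ |s| ^ (-α) := by positivity
  nlinarith

/-- The density at the points of the path, against the weight of the Cauchy kernel. -/
theorem density_weight_le {R b M α η : ℝ} (hR : 1 ≤ R)
    (hpath : ∀ s, R < |s| → path ℓ s ∈ strips R b) (hM0 : 0 ≤ M)
    (hM : ∀ ξ ∈ strips R b, ‖f ξ‖ ≤ M * |ξ.re| ^ (-α))
    (hη : 0 ≤ η) (hηα : η < α) (hα : α ≤ 1) {y s : ℝ} (hy : 1 ≤ |y|) :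
    ‖f (path ℓ s)‖ * (1 + |s - y|)⁻¹ ≤
      |y| ^ (-η) * (4 * M * ((1 + |s - y|) ^ (-(1 + α - η)) + (1 + |s|) ^ (-(1 + α - η)))
        + (1 + R) * (Icc (-R) R).indicator (fun s => ‖f (path ℓ s)‖) s) := by
  set x := |y|
  have hx0 : 0 < x := by linarith
  have hxus : x ≤ 1 + |s - y| + |s| := by
    have := abs_sub_abs_le_abs_sub y s
    rw [abs_sub_comm] at this
    linarith
  set u := 1 + |s - y| with hu
  have hu1 : 1 ≤ u := by linarith [abs_nonneg (s - y)]
  have hu0 : 0 < u := by linarith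
  by_cases hsR : s ∈ Icc (-R) R
  · rw [indicator_of_mem hsR]
    have h1 : u⁻¹ ≤ (1 + R) * x ^ (-η) := by
      have h2 : x ≤ (1 + R) * u := by
        have h3 : |s| ≤ R := abs_le.2 hsR
        nlinarith
      have h4 : x⁻¹ ≤ x ^ (-η) := by
        rw [← Real.rpow_neg_one]
        exact Real.rpow_le_rpow_of_exponent_le (by linarith) (by linarith)
      calc u⁻¹ ≤ (1 + R) * x⁻¹ := by
            rw [inv_le_comm₀ hu0 (by positivity), mul_inv, inv_inv, inv_mul_le_iff₀ (by linarith)]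
            exact h2
        _ ≤ _ := by gcongr
    calc ‖f (path ℓ s)‖ * u⁻¹ ≤ ‖f (path ℓ s)‖ * ((1 + R) * x ^ (-η)) := by gcongr
      _ = x ^ (-η) * (0 + (1 + R) * ‖f (path ℓ s)‖) := by ring
      _ ≤ _ := by gcongr; positivity
  · rw [indicator_of_notMem hsR, mul_zero, add_zero]
    have hs' : R < |s| := by
      by_contra! h
      exact hsR (abs_le.1 h)
    have h1 : ‖f (path ℓ s)‖ ≤ M * (2 * (1 + |s|) ^ (-α)) := by
      have := hM _ (hpath s hs')
      rw [path_re] at this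
      exact this.trans (mul_le_mul_of_nonneg_left
        (rpow_neg_abs_le (by linarith) (by linarith) hα) hM0)
    set v := 1 + |s| with hv
    have hv1 : 1 ≤ v := by linarith [abs_nonneg s]
    have h2 := rpow_mul_inv_mul_rpow_le hu1 hv1 hx0.le (by linarith) hη hηα.le hα
    have hxη : x ^ (-η) * x ^ η = 1 := by rw [← Real.rpow_add hx0]; simp
    calc ‖f (path ℓ s)‖ * u⁻¹ ≤ M * (2 * v ^ (-α)) * u⁻¹ := by gcongr
      _ = 2 * M * (x ^ (-η) * x ^ η) * (u⁻¹ * v ^ (-α)) := by rw [hxη]; ring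
      _ = 2 * M * x ^ (-η) * (x ^ η * (u⁻¹ * v ^ (-α))) := by ring
      _ ≤ 2 * M * x ^ (-η) * (2 * (u ^ (-(1 + α - η)) + v ^ (-(1 + α - η)))) := by gcongr
      _ = _ := by ring

/-- The density at the singular point, against the weights of both Cauchy kernels. -/
theorem singular_weight_le {b M α η : ℝ} (hb : 0 ≤ b) (hM0 : 0 ≤ M) (hη : 0 ≤ η) (hηα : η < α)
    (hα : α ≤ 1) {ξ : ℂ} (hM : ‖f ξ‖ ≤ M * |ξ.re| ^ (-α)) (him : |ξ.im| ≤ b) (hξ : 1 ≤ |ξ.re|)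
    (s : ℝ) :
    ‖f ξ * (ξ + Complex.I)‖ * ((1 + |s - ξ.re|)⁻¹ * (1 + |s|)⁻¹) ≤
      |ξ.re| ^ (-η) * (2 * (M * (b + 2))
        * ((1 + |s - ξ.re|) ^ (-(1 + α - η)) + (1 + |s|) ^ (-(1 + α - η)))) := by
  have hxus : |ξ.re| ≤ 1 + |s - ξ.re| + |s| := by
    have := abs_sub_abs_le_abs_sub ξ.re s
    rw [abs_sub_comm] at this
    linarith
  have hI := norm_add_I_le ξ
  set x := |ξ.re|
  have hx0 : 0 < x := by linarith
  set u := 1 + |s - ξ.re| with hu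
  have hu1 : 1 ≤ u := by linarith [abs_nonneg (s - ξ.re)]
  set v := 1 + |s| with hv
  have hv1 : 1 ≤ v := by linarith [abs_nonneg s]
  have hu0 : 0 < u := by linarith
  have hv0 : 0 < v := by linarith
  have h1 : ‖f ξ * (ξ + Complex.I)‖ ≤ (M * x ^ (-α)) * ((b + 2) * x) := by
    rw [norm_mul]
    refine mul_le_mul hM (hI.trans ?_) (norm_nonneg _) (by positivity)
    nlinarith
  -- The product of f(ξ) and ξ + i may grow like x ^ (1 - α). Using the inequality with 1 - α + η
  -- for η and 1 for α absorbs this growth and leads to the same exponent 1 + α - η.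
  have h2 := rpow_mul_inv_mul_rpow_le hu1 hv1 hx0.le (by linarith : x ≤ u + v)
    (η := 1 - α + η) (α := 1) (by linarith) (by linarith) le_rfl
  rw [show (1 : ℝ) + 1 - (1 - α + η) = 1 + α - η by ring, Real.rpow_neg_one] at h2
  have h3 : x ^ (-α) * x = x ^ (-η) * x ^ (1 - α + η) := by
    rw [← Real.rpow_add_one hx0.ne', ← Real.rpow_add hx0]; congr 1; ring
  calc ‖f ξ * (ξ + Complex.I)‖ * (u⁻¹ * v⁻¹)
      ≤ (M * x ^ (-α)) * ((b + 2) * x) * (u⁻¹ * v⁻¹) := by gcongr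
    _ = M * (b + 2) * (x ^ (-α) * x) * (u⁻¹ * v⁻¹) := by ring
    _ = x ^ (-η) * (M * (b + 2)) * (x ^ (1 - α + η) * (u⁻¹ * v⁻¹)) := by rw [h3]; ring
    _ ≤ x ^ (-η) * (M * (b + 2)) * (2 * (u ^ (-(1 + α - η)) + v ^ (-(1 + α - η)))) :=
        mul_le_mul_of_nonneg_left h2 (by positivity)
    _ = _ := by ring

/-- Near the singularity u is bounded, so an integrable weight can be inserted for the cost of a
constant, here 4 = 2². -/
theorem near_weight_le {x u p α η : ℝ} (hx : 1 ≤ x) (hηα : η ≤ α) (hu0 : 0 < u) (hu2 : u ≤ 2)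
    (hp0 : 0 ≤ p) (hp2 : p ≤ 2) : x ^ (-α) ≤ x ^ (-η) * (4 * u ^ (-p)) := by
  have h1 : x ^ (-α) ≤ x ^ (-η) := Real.rpow_le_rpow_of_exponent_le hx (by linarith)
  have h2 : 1 ≤ 4 * u ^ (-p) := by
    have h3 : (2 : ℝ) ^ (-(2 : ℝ)) ≤ u ^ (-p) :=
      calc (2 : ℝ) ^ (-(2 : ℝ)) ≤ 2 ^ (-p) :=
            Real.rpow_le_rpow_of_exponent_le (by norm_num) (by linarith)
        _ ≤ u ^ (-p) := Real.rpow_le_rpow_of_nonpos hu0 hu2 (by linarith)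
    have h4 : (2 : ℝ) ^ (-(2 : ℝ)) = 1 / 4 := by
      rw [Real.rpow_neg (by norm_num)]; norm_num
    rw [h4] at h3
    linarith
  exact h1.trans (le_mul_of_one_le_right (by positivity) h2)

/-- Near the singularity Cauchy estimates give |ξ.re| ^ (-α), because the growth of t + i in the
numerator cancels against the denominator. Farther away the two terms are weighted separately. The
indicator carries the bounded piece of the path, on which no decay or boundedness of the density is
assumed. -/
theorem exists_norm_subtractedKernel_le_weights (hℓ : IsContour ℓ) {R b M α η : ℝ}
    (hR : 1 ≤ R) (hb : 0 ≤ b) (hpath : ∀ s, R < |s| → path ℓ s ∈ strips R b)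
    (hd : DifferentiableOn ℂ f (strips R b)) (hM0 : 0 ≤ M)
    (hM : ∀ ξ ∈ strips R b, ‖f ξ‖ ≤ M * |ξ.re| ^ (-α))
    (hη : 0 ≤ η) (hηα : η < α) (hα : α ≤ 1) :
    ∃ c₁ c₂ : ℝ, 0 ≤ c₁ ∧ 0 ≤ c₂ ∧ ∀ ξ ∈ strips (R + 1) (b - 1), ∀ s,
      ‖subtractedKernel ℓ f ξ s‖ ≤ |ξ.re| ^ (-η)
        * (c₁ * ((1 + |s - ξ.re|) ^ (-(1 + α - η)) + (1 + |s|) ^ (-(1 + α - η)))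
        + c₂ * (Icc (-R) R).indicator (fun s => ‖f (path ℓ s)‖) s) := by
  obtain ⟨B, hB1, hB⟩ := hℓ.exists_norm_pathDeriv_le
  obtain ⟨A, hA0, hA⟩ := hℓ.exists_one_add_abs_le_add_I
  have hα0 : 0 < α := by linarith
  -- `T` is the constant of the near bound, multiplied by 4 when the weight is inserted; `T'`
  -- collects the two far terms.
  set T := 24 * M * (b + 3) * A * B with hT
  have hT0 : 0 ≤ T := by positivity
  set T' := B * (10 * M) + B * (5 * A * (M * (b + 2))) with hT'
  have hT'0 : 0 ≤ T' := by positivity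
  refine ⟨4 * T + T', B * (5 / 2 * (1 + R)), by positivity, by positivity, fun ξ hξ s => ?_⟩
  have hx2 : 1 ≤ |ξ.re| := by have := hξ.1; linarith
  have hξ' : ξ ∈ strips R b := strips_subset (by linarith) (by linarith) hξ
  have hind : 0 ≤ (Icc (-R) R).indicator (fun s => ‖f (path ℓ s)‖) s :=
    indicator_nonneg (fun _ _ => norm_nonneg _) _
  have hu1 : 0 < 1 + |s - ξ.re| := by positivity
  have hxη : 0 ≤ |ξ.re| ^ (-η) := by positivity
  have hU : 0 ≤ (1 + |s - ξ.re|) ^ (-(1 + α - η)) := by positivity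
  have hV : 0 ≤ (1 + |s|) ^ (-(1 + α - η)) := by positivity
  by_cases hs : path ℓ s ∈ ball ξ (2 * (1 / 3))
  · have h1 := norm_subtractedKernel_near hℓ hB hA0 hA hR hb hα0 hα hd hM0 hM hξ hs
    have hu2 : 1 + |s - ξ.re| ≤ 2 := by
      rw [mem_ball, dist_eq_norm] at hs
      have := (abs_sub_le_norm_path_sub ℓ s ξ).trans_lt hs
      linarith
    have h2 := near_weight_le (p := 1 + α - η) hx2 hηα.le hu1 hu2 (by linarith) (by linarith)
    refine h1.trans ((mul_le_mul_of_nonneg_left h2 hT0).trans ?_)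
    rw [mul_left_comm]
    refine mul_le_mul_of_nonneg_left ?_ hxη
    have h3 : 0 ≤ B * (5 / 2 * (1 + R))
        * (Icc (-R) R).indicator (fun s => ‖f (path ℓ s)‖) s := by positivity
    nlinarith [mul_nonneg hT0 hV, mul_nonneg hT'0 hU, mul_nonneg hT'0 hV]
  · have h1 := norm_subtractedKernel_far (f := f) hℓ hB hA0 hA hs
    have h2 := density_weight_le hR hpath hM0 hM hη hηα hα (s := s) hx2
    have h3 := singular_weight_le hb hM0 hη hηα hα (hM ξ hξ') hξ'.2.le hx2 s
    revert h1 h2 h3 hU hV hind hxη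
    generalize ‖subtractedKernel ℓ f ξ s‖ = a₁
    generalize (Icc (-R) R).indicator (fun s => ‖f (path ℓ s)‖) s = a₂
    generalize ‖f (path ℓ s)‖ * (1 + |s - ξ.re|)⁻¹ = a₃
    generalize (1 + |s - ξ.re|) ^ (-(1 + α - η)) = U
    generalize (1 + |s|) ^ (-(1 + α - η)) = V
    generalize (1 + |s - ξ.re|)⁻¹ * (1 + |s|)⁻¹ = a₄
    generalize |ξ.re| ^ (-η) = X
    generalize ‖f ξ * (ξ + Complex.I)‖ = a₅
    intro hind hX hU hV h1 h2 h3
    have hB0 : 0 ≤ B := by linarith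
    calc a₁ ≤ B * (5 / 2 * a₃ + 5 / 2 * A * (a₅ * a₄)) := h1.trans (le_of_eq (by ring))
      _ ≤ B * (5 / 2 * (X * (4 * M * (U + V) + (1 + R) * a₂))
          + 5 / 2 * A * (X * (2 * (M * (b + 2)) * (U + V)))) :=
        mul_le_mul_of_nonneg_left (add_le_add (mul_le_mul_of_nonneg_left h2 (by norm_num))
          (mul_le_mul_of_nonneg_left h3 (by positivity))) hB0
      _ = X * (T' * (U + V) + B * (5 / 2 * (1 + R)) * a₂) := by rw [hT']; ring
      _ ≤ X * ((4 * T + T') * (U + V) + B * (5 / 2 * (1 + R)) * a₂) := by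
        refine mul_le_mul_of_nonneg_left ?_ hX
        nlinarith [mul_nonneg hT0 hU, mul_nonneg hT0 hV]

/-- The weights are integrable because η < α makes the exponent p exceed 1, and the integral of the
shifted weight is independent of ξ by translation invariance. The density itself supplies the only
other integral, over a bounded interval. -/
theorem minusPart_decay (hℓ : IsContour ℓ) (hf : Admissible ℓ f) {R b M α η : ℝ}
    (hR : 1 ≤ R) (hb : 0 ≤ b) (hpath : ∀ s, R < |s| → path ℓ s ∈ strips R b)
    (hd : DifferentiableOn ℂ f (strips R b)) (hM0 : 0 ≤ M)
    (hM : ∀ ξ ∈ strips R b, ‖f ξ‖ ≤ M * |ξ.re| ^ (-α))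
    (hη : 0 ≤ η) (hηα : η < α) (hα : α ≤ 1) :
    ∃ C : ℝ, 0 ≤ C ∧ ∀ ξ ∈ strips (R + 1) (b - 1), ‖minusPart ℓ f ξ‖ ≤ C * |ξ.re| ^ (-η) := by
  obtain ⟨c₁, c₂, hc₁0, hc₂0, key⟩ :=
    exists_norm_subtractedKernel_le_weights hℓ hR hb hpath hd hM0 hM hη hηα hα
  set p := 1 + α - η with hp
  have hv := integrable_one_add_abs_rpow (r := p) (by linarith)
  set D := ∫ s : ℝ, (1 + |s|) ^ (-p) with hD
  have hD0 : 0 ≤ D := integral_nonneg fun s => by positivity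
  have hloc' : Integrable ((Icc (-R) R).indicator fun s => ‖f (path ℓ s)‖) :=
    (integrable_indicator_iff measurableSet_Icc).2 (admissible_local_integrable hf R).norm
  set E := ∫ s, (Icc (-R) R).indicator (fun s => ‖f (path ℓ s)‖) s with hE
  have hE0 : 0 ≤ E := integral_nonneg fun s => indicator_nonneg (fun _ _ => norm_nonneg _) _
  refine ⟨‖1 / (2 * (Real.pi : ℂ) * Complex.I)‖ * (c₁ * (D + D) + c₂ * E), by positivity,
    fun ξ hξ => ?_⟩
  have hui : Integrable fun s : ℝ => (1 + |s - ξ.re|) ^ (-p) := hv.comp_sub_right ξ.re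
  have huD : ∫ s : ℝ, (1 + |s - ξ.re|) ^ (-p) = D :=
    integral_sub_right_eq_self (fun s : ℝ => (1 + |s|) ^ (-p)) ξ.re
  have huv : Integrable fun s : ℝ => (1 + |s - ξ.re|) ^ (-p) + (1 + |s|) ^ (-p) := hui.add hv
  have hbound := norm_integral_le_of_norm_le
    (((huv.const_mul c₁).add (hloc'.const_mul c₂)).const_mul (|ξ.re| ^ (-η)))
    (Eventually.of_forall (key ξ hξ))
  have hval : ∫ s : ℝ, |ξ.re| ^ (-η) * (c₁ * ((1 + |s - ξ.re|) ^ (-p) + (1 + |s|) ^ (-p))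
        + c₂ * (Icc (-R) R).indicator (fun s => ‖f (path ℓ s)‖) s)
      = |ξ.re| ^ (-η) * (c₁ * (D + D) + c₂ * E) := by
    rw [integral_const_mul, integral_add (huv.const_mul c₁) (hloc'.const_mul c₂),
      integral_const_mul, integral_const_mul, integral_add hui hv, huD]
  rw [minusPart, norm_mul]
  calc _ ≤ ‖1 / (2 * (Real.pi : ℂ) * Complex.I)‖ * (|ξ.re| ^ (-η) * (c₁ * (D + D) + c₂ * E)) :=
        mul_le_mul_of_nonneg_left (hbound.trans (le_of_eq hval)) (norm_nonneg _)
    _ = _ := by ring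

end

section

variable {k h : ℝ} {ℓ : ℝ → ℝ} {f g : ℂ → ℂ} {x₁ x₂ : ℝ}

/-! ### The factors and the density near infinity -/

theorem log_symbFar_path (k h : ℝ) (hℓ : IsContour ℓ) : ∀ᵐ s : ℝ,
    Complex.log (symb k h (path ℓ s)) = Complex.log (symbFar k h (path ℓ s)) := by
  filter_upwards [ae_path_mem_quadrants hℓ] with s hs
  rw [symbFar_eq_of_quadrants k h hs]

theorem log_symbFar_admissible (hk : 0 < k) (hh : 0 < h) (hℓ : IsContour ℓ) :
    Admissible ℓ fun t => Complex.log (symbFar k h t) :=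
  (log_symb_admissible hk hh hℓ).congr (log_symbFar_path k h hℓ)

/-- The exponent of `K⁺` and `K⁻` near the real points at infinity. -/
def farExponent (k h : ℝ) (ℓ : ℝ → ℝ) (ξ : ℂ) : ℂ :=
  minusPart ℓ (fun t => Complex.log (symbFar k h t)) ξ

theorem farExponent_differentiableOn (hk : 0 < k) (hh : 0 < h) (hℓ : IsContour ℓ) :
    DifferentiableOn ℂ (farExponent k h ℓ) (strips (farRadius k h) 3) :=
  minusPart_differentiableOn hℓ (log_symbFar_admissible hk hh hℓ) (isOpen_strips _ _)
    (log_symbFar_differentiableOn hk hh)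

/-- A radius beyond which the path is close to the real axis and the exponent is bounded. -/
structure IsFar (k h : ℝ) (ℓ : ℝ → ℝ) (R C : ℝ) : Prop where
  radius_le : farRadius k h ≤ R
  one_le : 1 ≤ R
  path_mem : ∀ s, R < |s| → path ℓ s ∈ strips R 1
  bound : ∀ ξ ∈ strips R 2, ‖farExponent k h ℓ ξ‖ ≤ C

theorem exists_isFar (hk : 0 < k) (hh : 0 < h) (hℓ : IsContour ℓ) : ∃ R C, IsFar k h ℓ R C := by
  obtain ⟨R, hfR, hR1, hR⟩ := hℓ.exists_path_mem_strips (farRadius k h)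
  have hR' : ∀ s, R < |s| → path ℓ s ∈ strips R 3 := fun s hs =>
    ⟨by simpa using hs, (hR s hs).2.trans (by norm_num)⟩
  have hsub : strips R 3 ⊆ strips (farRadius k h) 3 := strips_subset hfR le_rfl
  -- The choice η = 0 asks only for boundedness of the exponent. Half-width 3 for the density leaves
  -- half-width 2 for the exponent, and then 1 for the transform of the density of H⁺.
  obtain ⟨C, -, hC⟩ := minusPart_decay hℓ (log_symbFar_admissible hk hh hℓ) (R := R) (b := 3)
    (M := 3 / (2 * h)) (α := 1) (η := 0) hR1 (by norm_num) hR'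
    ((log_symbFar_differentiableOn hk hh).mono hsub) (by positivity)
    (fun ξ hξ => by
      refine (norm_log_symbFar_le hk hh (hsub hξ)).trans (le_of_eq ?_)
      have := strips_re_pos hk hh (hsub hξ)
      rw [Real.rpow_neg_one]
      field_simp) le_rfl one_pos le_rfl
  refine ⟨R + 1, C, by linarith, by linarith, fun s hs => ⟨by simpa using hs, ?_⟩, fun ξ hξ => ?_⟩
  · exact (hR s (by linarith)).2
  · have := hC ξ (by norm_num; exact hξ)
    simpa [farExponent] using this

theorem IsFar.strips_subset {R C : ℝ} (hR : IsFar k h ℓ R C) :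
    strips R 2 ⊆ strips (farRadius k h) 3 :=
  WienerHopf.strips_subset hR.radius_le (by norm_num)

/-- In the quadrants μ = iν, so the symbol and its far continuation agree both on almost all of the
path and at ξ, which is all that the regularized integral sees. -/
theorem Kminus_eq_of_quadrants (hk : 0 < k) (hh : 0 < h) (hℓ : IsContour ℓ) {ξ : ℂ}
    (hξ : ξ ∈ quadrants) (h' : ξ.im ≤ ℓ ξ.re) :
    Kminus k h ℓ ξ = Complex.exp (-farExponent k h ℓ ξ) := by
  have h1 := minusFactor_eq_on_regularSet hk hh hℓ (quadrants_subset_regularSet (k := k) hh hξ)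
  rw [minusFactor, if_pos h'] at h1
  rw [h1, farExponent, minusPart, minusPart, subtractedInt_congr
    (g := fun t => Complex.log (symbFar k h t)) (log_symbFar_path k h hℓ)
    (by rw [symbFar_eq_of_quadrants k h hξ])]

theorem Kminus_below_eq_far (hk : 0 < k) (hh : 0 < h) (hℓ : IsContour ℓ) {ξ : ℂ}
    (h' : ξ.im < ℓ ξ.re) : Kminus k h ℓ ξ = Complex.exp (-farExponent k h ℓ ξ) := by
  rw [Kminus_below h', cauchyInt_congr (g := fun t => Complex.log (symbFar k h t))
    (log_symbFar_path k h hℓ), cauchyInt_below hℓ (log_symbFar_admissible hk hh hℓ) h', farExponent]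

theorem symbFar_ne_zero (hk : 0 < k) (hh : 0 < h) {ξ : ℂ} (hξ : ξ ∈ strips (farRadius k h) 3) :
    symbFar k h ξ ≠ 0 := by
  have := one_sub_mem_slitPlane (lt_of_le_of_lt (norm_exp_neg_nu_le_half hk hh hξ)
    (by norm_num : (1 : ℝ) / 2 < 1))
  intro h0
  rw [symbFar] at h0
  rw [h0] at this
  simp at this

theorem norm_symbFar_le (hk : 0 < k) (hh : 0 < h) {ξ : ℂ} (hξ : ξ ∈ strips (farRadius k h) 3) :
    ‖symbFar k h ξ‖ ≤ 2 := by
  have := norm_exp_neg_nu_le_half hk hh hξ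
  refine (norm_sub_le _ _).trans ?_
  rw [norm_one]
  linarith

theorem Kplus_above_eq_far (hk : 0 < k) (hh : 0 < h) (hℓ : IsContour ℓ) {ξ : ℂ}
    (h' : ℓ ξ.re < ξ.im) (hξ : ξ ∈ strips (farRadius k h) 3) :
    Kplus k h ℓ ξ = Complex.exp (farExponent k h ℓ ξ) * symbFar k h ξ := by
  rw [Kplus_above h', cauchyInt_congr (g := fun t => Complex.log (symbFar k h t))
    (log_symbFar_path k h hℓ), cauchyInt_above hℓ (log_symbFar_admissible hk hh hℓ) h',
    Complex.exp_add, Complex.exp_log (symbFar_ne_zero hk hh hξ), farExponent]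

open Classical in
/-- The continuation of `√(k - t)` across the real axis near infinity. -/
def farRoot (k : ℝ) (t : ℂ) : ℂ :=
  if 0 < t.re then Complex.I * csqrt (t - k) else csqrt ((k : ℂ) - t)

/-- The continuation of the density across the real axis near infinity. -/
def farDensity (k h : ℝ) (ℓ : ℝ → ℝ) (x₁ x₂ : ℝ) (t : ℂ) : ℂ :=
  Complex.exp (Complex.I * t * (x₁ : ℂ) - nu k t * (x₂ : ℂ)) * Complex.exp (-farExponent k h ℓ t)
    / farRoot k t

theorem farRoot_eq_of_re_neg (k : ℝ) {t : ℂ} (ht : t.re < 0) : farRoot k t = csqrt ((k : ℂ) - t) :=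
  if_neg ht.not_gt

theorem farRoot_eq_of_quadrants (k : ℝ) {t : ℂ} (ht : t ∈ quadrants) :
    farRoot k t = csqrt ((k : ℂ) - t) := by
  rcases ht with ht | ht
  · rw [farRoot, if_pos ht.1, ← csqrt_neg (Or.inl (by simpa using ht.2)), neg_sub]
  · exact farRoot_eq_of_re_neg k ht.1

theorem norm_farRoot (k : ℝ) (t : ℂ) : ‖farRoot k t‖ = √‖(k : ℂ) - t‖ := by
  rw [farRoot]
  split_ifs
  · rw [norm_mul, Complex.norm_I, one_mul, norm_csqrt, norm_sub_rev]
  · rw [norm_csqrt]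

theorem strips_half_re (hk : 0 < k) (hh : 0 < h) {ξ : ℂ} (hξ : ξ ∈ strips (farRadius k h) 3) :
    2 * k < |ξ.re| ∧ 4 < |ξ.re| := by
  have h1 := hξ.1
  have : 0 < 2 / h := by positivity
  unfold farRadius at h1
  constructor <;> linarith

theorem half_abs_re_le_norm_sub (hk : 0 < k) (hh : 0 < h) {ξ : ℂ}
    (hξ : ξ ∈ strips (farRadius k h) 3) : |ξ.re| / 2 ≤ ‖(k : ℂ) - ξ‖ := by
  have h1 := (strips_half_re hk hh hξ).1
  have h2 := Complex.abs_re_le_norm ((k : ℂ) - ξ)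
  rw [Complex.sub_re, Complex.ofReal_re, abs_sub_comm] at h2
  have h3 := abs_sub_abs_le_abs_sub ξ.re k
  rw [abs_of_pos hk] at h3
  linarith

theorem inv_sqrt_le {x y : ℝ} (hx : 0 < x) (h : x / 2 ≤ y) : (√y)⁻¹ ≤ 2 * x ^ (-(1 / 2) : ℝ) := by
  have h1 : √x ≤ 2 * √y := by
    rw [Real.sqrt_le_left (by positivity), mul_pow, Real.sq_sqrt (by linarith)]
    linarith
  have h2 : 0 < √x := Real.sqrt_pos.2 hx
  rw [Real.rpow_neg hx.le, ← Real.sqrt_eq_rpow, ← div_eq_mul_inv, inv_le_comm₀ (by linarith)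
    (by positivity), inv_div]
  linarith

theorem farRoot_ne_zero (hk : 0 < k) (hh : 0 < h) {ξ : ℂ} (hξ : ξ ∈ strips (farRadius k h) 3) :
    farRoot k ξ ≠ 0 := by
  rw [← norm_pos_iff, norm_farRoot]
  have := half_abs_re_le_norm_sub hk hh hξ
  have := strips_re_pos hk hh hξ
  exact Real.sqrt_pos.2 (by linarith)

theorem farRoot_differentiableAt (hk : 0 < k) (hh : 0 < h) {ξ : ℂ}
    (hξ : ξ ∈ strips (farRadius k h) 3) : DifferentiableAt ℂ (farRoot k) ξ := by
  have h1 := (strips_half_re hk hh hξ).1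
  have h2 := strips_re_pos hk hh hξ
  rcases lt_or_gt_of_ne (abs_pos.1 h2) with h3 | h3
  · have h4 : (k : ℂ) - ξ ∈ Complex.slitPlane := Or.inl (by simp; linarith)
    refine ((csqrt_differentiableAt h4).comp ξ
      (differentiableAt_id.const_sub (k : ℂ))).congr_of_eventuallyEq ?_
    filter_upwards [(isOpen_lt Complex.continuous_re continuous_const).mem_nhds h3] with z hz
    exact farRoot_eq_of_re_neg k hz
  · rw [abs_of_pos h3] at h1
    have h4 : ξ - (k : ℂ) ∈ Complex.slitPlane := Or.inl (by simp; linarith)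
    refine (((csqrt_differentiableAt h4).comp ξ
      (differentiableAt_id.sub_const (k : ℂ))).const_mul Complex.I).congr_of_eventuallyEq ?_
    filter_upwards [(isOpen_lt continuous_const Complex.continuous_re).mem_nhds h3] with z hz
    exact if_pos hz

theorem farDensity_differentiableOn (hk : 0 < k) (hh : 0 < h) (hℓ : IsContour ℓ) (x₁ x₂ : ℝ) :
    DifferentiableOn ℂ (farDensity k h ℓ x₁ x₂) (strips (farRadius k h) 3) := by
  intro ξ hξ
  have h1 := nu_differentiableAt hk hh hξ
  have h2 := (farExponent_differentiableOn hk hh hℓ).differentiableAt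
    ((isOpen_strips _ _).mem_nhds hξ)
  have h3 : DifferentiableAt ℂ
      (fun t => Complex.exp (Complex.I * t * (x₁ : ℂ) - nu k t * (x₂ : ℂ))) ξ := by fun_prop
  exact ((h3.mul h2.neg.cexp).div (farRoot_differentiableAt hk hh hξ)
    (farRoot_ne_zero hk hh hξ)).differentiableWithinAt

theorem density_eq_farDensity (x₁ x₂ : ℝ) {ξ : ℂ}
    (hK : Kminus k h ℓ ξ = Complex.exp (-farExponent k h ℓ ξ))
    (hmu : mu k ξ = Complex.I * nu k ξ) (hr : farRoot k ξ = csqrt ((k : ℂ) - ξ)) :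
    density k h ℓ x₁ x₂ ξ = farDensity k h ℓ x₁ x₂ ξ := by
  rw [density, farDensity, hK, hmu, hr]
  congr 3
  linear_combination (nu k ξ * x₂) * Complex.I_sq

theorem density_path_eq_farDensity (hk : 0 < k) (hh : 0 < h) (hℓ : IsContour ℓ) (x₁ x₂ : ℝ)
    {s : ℝ} (hs : s ≠ 0) :
    density k h ℓ x₁ x₂ (path ℓ s) = farDensity k h ℓ x₁ x₂ (path ℓ s) :=
  have hq := hℓ.path_mem_quadrants hs
  density_eq_farDensity x₁ x₂ (Kminus_eq_of_quadrants hk hh hℓ hq (by simp))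
    (mu_eq_I_mul_nu_of_quadrants k hq) (farRoot_eq_of_quadrants k hq)

theorem norm_exp_phase_le (hk : 0 < k) (hh : 0 < h) {α : ℝ}
    (hx : (x₂ = 0 ∧ α = 1 / 2) ∨ (0 < x₂ ∧ α = 1)) : ∃ M : ℝ, 0 ≤ M ∧
    ∀ ξ ∈ strips (farRadius k h) 3, ‖Complex.exp (-(nu k ξ * (x₂ : ℂ)))‖
      * (2 * |ξ.re| ^ (-(1 / 2) : ℝ)) ≤ M * |ξ.re| ^ (-α) := by
  rcases hx with ⟨rfl, rfl⟩ | ⟨hx, rfl⟩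
  · exact ⟨2, by norm_num, fun ξ _ => by simp⟩
  · refine ⟨4 / x₂, by positivity, fun ξ hξ => ?_⟩
    have h1 := norm_exp_neg_nu_le hk hh (c := x₂ / 2) (by positivity) hξ
    have h0 := strips_re_pos hk hh hξ
    have h4 := (strips_half_re hk hh hξ).2
    have e : -(2 * ((x₂ / 2 : ℝ) : ℂ) * nu k ξ) = -(nu k ξ * (x₂ : ℂ)) := by push_cast; ring
    rw [e] at h1
    have h2 : |ξ.re| ^ (-(1 / 2) : ℝ) ≤ 1 :=
      Real.rpow_le_one_of_one_le_of_nonpos (by linarith) (by norm_num)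
    calc _ ≤ 1 / (x₂ / 2 * |ξ.re|) * (2 * 1) := by gcongr
      _ = _ := by rw [Real.rpow_neg_one]; field_simp; norm_num

theorem IsFar.exists_norm_farDensity_le {R C : ℝ} (hR : IsFar k h ℓ R C) (hk : 0 < k) (hh : 0 < h)
    {α : ℝ} (hx : (x₂ = 0 ∧ α = 1 / 2) ∨ (0 < x₂ ∧ α = 1)) (x₁ : ℝ) : ∃ M : ℝ, 0 ≤ M ∧
    ∀ ξ ∈ strips R 2, ‖farDensity k h ℓ x₁ x₂ ξ‖ ≤ M * |ξ.re| ^ (-α) := by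
  obtain ⟨M, hM0, hM⟩ := norm_exp_phase_le (x₂ := x₂) hk hh hx
  refine ⟨Real.exp (2 * |x₁|) * Real.exp C * M, by positivity, fun ξ hξ => ?_⟩
  have hξ' := hR.strips_subset hξ
  have h1 : ‖Complex.exp (Complex.I * ξ * x₁)‖ ≤ Real.exp (2 * |x₁|) := by
    rw [Complex.norm_exp]
    refine Real.exp_le_exp.2 ?_
    have e : (Complex.I * ξ * x₁).re = -(ξ.im * x₁) := by simp
    rw [e]
    calc -(ξ.im * x₁) ≤ |ξ.im * x₁| := neg_le_abs _
      _ = |ξ.im| * |x₁| := abs_mul _ _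
      _ ≤ 2 * |x₁| := by gcongr; exact hξ.2.le
  have h2 : ‖Complex.exp (-farExponent k h ℓ ξ)‖ ≤ Real.exp C := by
    refine (Complex.norm_exp_le_exp_norm _).trans ?_
    rw [norm_neg]
    exact Real.exp_le_exp.2 (hR.bound ξ hξ)
  have h3 : ‖farRoot k ξ‖⁻¹ ≤ 2 * |ξ.re| ^ (-(1 / 2) : ℝ) := by
    rw [norm_farRoot]
    exact inv_sqrt_le (strips_re_pos hk hh hξ') (half_abs_re_le_norm_sub hk hh hξ')
  rw [farDensity, norm_div, norm_mul, sub_eq_add_neg, Complex.exp_add, norm_mul, div_eq_mul_inv]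
  calc _ ≤ Real.exp (2 * |x₁|) * ‖Complex.exp (-(nu k ξ * (x₂ : ℂ)))‖ * Real.exp C
        * (2 * |ξ.re| ^ (-(1 / 2) : ℝ)) := by gcongr
    _ = Real.exp (2 * |x₁|) * Real.exp C * (‖Complex.exp (-(nu k ξ * (x₂ : ℂ)))‖
        * (2 * |ξ.re| ^ (-(1 / 2) : ℝ))) := by ring
    _ ≤ Real.exp (2 * |x₁|) * Real.exp C * (M * |ξ.re| ^ (-α)) :=
        mul_le_mul_of_nonneg_left (hM ξ hξ') (by positivity)
    _ = _ := by ring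

end

section

variable {k h : ℝ} {ℓ : ℝ → ℝ} {f g : ℂ → ℂ} {x₁ x₂ : ℝ}

/-! ### The function `f̂⁺` and its continuation below the path -/

/-- The density of `H⁺`, continued holomorphically to both sides of the path. -/
def densityExt (k h : ℝ) (ℓ : ℝ → ℝ) (x₁ x₂ : ℝ) (t : ℂ) : ℂ :=
  Complex.exp (Complex.I * t * (x₁ : ℂ) + Complex.I * mu k t * (x₂ : ℂ)) * minusFactor k h ℓ t
    / csqrt ((k : ℂ) - t)

theorem densityExt_eq_density {ξ : ℂ} (hξ : ξ.im ≤ ℓ ξ.re) :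
    densityExt k h ℓ x₁ x₂ ξ = density k h ℓ x₁ x₂ ξ := by
  rw [densityExt, density, minusFactor, if_pos hξ]

theorem density_path (s : ℝ) :
    density k h ℓ x₁ x₂ (path ℓ s) = densityExt k h ℓ x₁ x₂ (path ℓ s) :=
  (densityExt_eq_density (by simp)).symm

theorem sub_mem_slitPlane_of_cutPlane {ξ : ℂ} (hξ : ξ ∈ cutPlane k) :
    (k : ℂ) - ξ ∈ Complex.slitPlane := by
  rw [Complex.mem_slitPlane_iff]
  rcases hξ with h1 | h1
  · right; simpa using h1
  · left; simpa using (abs_lt.1 h1).2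

theorem add_mem_slitPlane {ξ : ℂ} (hξ : ξ ∉ cut k) : (k : ℂ) + ξ ∈ Complex.slitPlane := by
  rw [Complex.mem_slitPlane_iff]
  by_contra! hc
  simp only [Complex.add_re, Complex.ofReal_re, Complex.add_im, Complex.ofReal_im, zero_add] at hc
  exact hξ ⟨hc.2, by linarith [hc.1]⟩

theorem cutPlane_notMem_cut {ξ : ℂ} (hξ : ξ ∈ cutPlane k) : ξ ∉ cut k := by
  rintro ⟨h1, h2⟩
  rcases hξ with h3 | h3
  · exact h3 h1
  · linarith [(abs_lt.1 h3).1]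

theorem csqrt_ne_zero_of_slitPlane {z : ℂ} (hz : z ∈ Complex.slitPlane) : csqrt z ≠ 0 := fun h =>
  Complex.slitPlane_ne_zero hz (csqrt_eq_zero.1 h)

theorem densityExt_differentiableOn (hk : 0 < k) (hh : 0 < h) (hℓ : IsContour ℓ) (x₁ x₂ : ℝ) :
    DifferentiableOn ℂ (densityExt k h ℓ x₁ x₂) (cutPlane k) := by
  intro ξ hξ
  have h1 := mu_differentiableAt hk hξ
  have h2 := sub_mem_slitPlane_of_cutPlane hξ
  have h3 : DifferentiableAt ℂ (fun t => csqrt ((k : ℂ) - t)) ξ :=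
    (csqrt_differentiableAt h2).comp ξ (differentiableAt_id.const_sub (k : ℂ))
  have h4 : DifferentiableAt ℂ (fun t => Complex.exp
      (Complex.I * t * (x₁ : ℂ) + Complex.I * mu k t * (x₂ : ℂ))) ξ := by fun_prop
  exact ((h4.mul (minusFactor_differentiableAt hk hh hℓ hξ)).div h3
    (csqrt_ne_zero_of_slitPlane h2)).differentiableWithinAt

theorem continuous_density_path (hk : 0 < k) (hh : 0 < h) (hℓ : IsContour ℓ) (x₁ x₂ : ℝ) :
    Continuous fun s => density k h ℓ x₁ x₂ (path ℓ s) := by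
  simp_rw [density_path]
  exact continuous_comp_path hℓ (isOpen_cutPlane k) (densityExt_differentiableOn hk hh hℓ x₁ x₂)
    (hℓ.path_mem_cutPlane hk)

theorem density_admissible (hk : 0 < k) (hh : 0 < h) (hℓ : IsContour ℓ) {x₁ x₂ : ℝ}
    (hx : 0 ≤ x₂) : Admissible ℓ (density k h ℓ x₁ x₂) := by
  obtain ⟨R, C, hR⟩ := exists_isFar hk hh hℓ
  obtain ⟨α, hα0, hα1, hα⟩ : ∃ α : ℝ, 0 < α ∧ α ≤ 1 ∧
      ((x₂ = 0 ∧ α = 1 / 2) ∨ (0 < x₂ ∧ α = 1)) := by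
    rcases hx.eq_or_lt with h0 | h0
    · exact ⟨1 / 2, by norm_num, by norm_num, Or.inl ⟨h0.symm, rfl⟩⟩
    · exact ⟨1, by norm_num, le_rfl, Or.inr ⟨h0, rfl⟩⟩
  obtain ⟨M, hM0, hM⟩ := hR.exists_norm_farDensity_le hk hh hα x₁
  have hc := continuous_density_path hk hh hℓ x₁ x₂
  refine admissible_of_decay (α := α) (M := M * 2) (R := R) hα0 hc.aestronglyMeasurable
    hc.integrableOn_Icc fun s hs => ?_
  have hR1 := hR.one_le
  rw [density_path_eq_farDensity hk hh hℓ x₁ x₂ (abs_pos.1 (by linarith))]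
  have h1 := hM _ (strips_subset le_rfl one_le_two (hR.path_mem s hs))
  rw [path_re] at h1
  refine h1.trans ?_
  rw [mul_assoc]
  exact mul_le_mul_of_nonneg_left (rpow_neg_abs_le (by linarith) hα0.le hα1) hM0

theorem pvInt_congr (h : ∀ s : ℝ, f (path ℓ s) = g (path ℓ s)) (ξ : ℂ) :
    pvInt ℓ f ξ = pvInt ℓ g ξ := by
  simp_rw [pvInt, h]

theorem Hplus_above {ξ : ℂ} (hξ : ℓ ξ.re < ξ.im) : Hplus k h ℓ x₁ x₂ ξ =
    1 / (2 * (Real.pi : ℂ) * Complex.I) * cauchyInt ℓ (density k h ℓ x₁ x₂) ξ :=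
  if_neg hξ.ne'

open Classical in
/-- The function `f̂⁺`, continued below the path. -/
def fhatExt (k h : ℝ) (ℓ : ℝ → ℝ) (x₁ x₂ : ℝ) (ξ : ℂ) : ℂ :=
  if ℓ ξ.re ≤ ξ.im then fhatPlus k h ℓ x₁ x₂ ξ
  else (1 / (2 * (Real.pi : ℂ) * Complex.I) * cauchyInt ℓ (density k h ℓ x₁ x₂) ξ
      * csqrt ((k : ℂ) - ξ)
      + Complex.exp (Complex.I * ξ * (x₁ : ℂ) + Complex.I * mu k ξ * (x₂ : ℂ)) * Kminus k h ℓ ξ)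
      * symbQuotient h (mu k ξ) / (2 * Complex.I * Kminus k h ℓ ξ)

/-- Below the path, away from the branch points, the continuation has the same structure as
`f̂⁺` itself. -/
theorem fhatExt_below (hk : 0 < k) {ξ : ℂ} (hξ : ξ.im < ℓ ξ.re) (h₁ : (k : ℂ) - ξ ≠ 0)
    (h₂ : (k : ℂ) + ξ ≠ 0) : fhatExt k h ℓ x₁ x₂ ξ =
      (1 / (2 * (Real.pi : ℂ) * Complex.I) * cauchyInt ℓ (density k h ℓ x₁ x₂) ξ
        + density k h ℓ x₁ x₂ ξ) * (symb k h ξ / Kminus k h ℓ ξ)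
        / (2 * Complex.I * csqrt ((k : ℂ) + ξ)) := by
  have h3 : csqrt ((k : ℂ) - ξ) ≠ 0 := fun h => h₁ (csqrt_eq_zero.1 h)
  have h4 : csqrt ((k : ℂ) + ξ) ≠ 0 := fun h => h₂ (csqrt_eq_zero.1 h)
  have h5 := Kminus_ne_zero (k := k) (h := h) hξ
  have h6 : symb k h ξ
      = csqrt ((k : ℂ) - ξ) * csqrt ((k : ℂ) + ξ) * symbQuotient h (mu k ξ) := by
    rw [symb_eq_mul]
    congr 1
    exact mu_eq_mul k hk ξ
  rw [fhatExt, if_neg (not_le.2 hξ), density, h6]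
  generalize 1 / (2 * (Real.pi : ℂ) * Complex.I) * cauchyInt ℓ (density k h ℓ x₁ x₂) ξ = c
  have := Complex.I_ne_zero
  field_simp

/-- By the Plemelj relation for the density and the continuation of K⁺, the three definitions become
one product of functions holomorphic on the cut plane. In particular the principal value definition
on the path is the common boundary value. -/
theorem fhatExt_eq_on_cutPlane (hk : 0 < k) (hh : 0 < h) (hℓ : IsContour ℓ) (hx : 0 ≤ x₂) {ξ : ℂ}
    (hξ : ξ ∈ cutPlane k) : fhatExt k h ℓ x₁ x₂ ξ =
      (minusPart ℓ (densityExt k h ℓ x₁ x₂) ξ + densityExt k h ℓ x₁ x₂ ξ) * plusFactor k h ℓ ξ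
        / (2 * Complex.I * csqrt ((k : ℂ) + ξ)) := by
  have hadm : Admissible ℓ (densityExt k h ℓ x₁ x₂) :=
    (density_admissible hk hh hℓ hx).congr (Eventually.of_forall density_path)
  have hc : cauchyInt ℓ (density k h ℓ x₁ x₂) ξ = cauchyInt ℓ (densityExt k h ℓ x₁ x₂) ξ :=
    cauchyInt_congr (Eventually.of_forall density_path)
  rcases lt_trichotomy ξ.im (ℓ ξ.re) with hlt | heq | hgt
  · rw [fhatExt_below hk hlt (Complex.slitPlane_ne_zero (sub_mem_slitPlane_of_cutPlane hξ))
      (Complex.slitPlane_ne_zero (add_mem_slitPlane (cutPlane_notMem_cut hξ))), hc,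
      cauchyInt_below hℓ hadm hlt, densityExt_eq_density hlt.le, plusFactor, if_neg (not_le.2 hlt)]
  · rw [fhatExt, if_pos heq.ge, fhatPlus, Hplus, if_pos heq, plusFactor, if_pos heq.ge,
      pvInt_congr density_path, pvInt_on hℓ hadm (isOpen_cutPlane k)
      (densityExt_differentiableOn hk hh hℓ x₁ x₂) hξ heq, densityExt_eq_density heq.le]
    congr 2
    ring
  · rw [fhatExt, if_pos hgt.le, fhatPlus, Hplus_above hgt, plusFactor, if_pos hgt.le, hc,
      cauchyInt_above hℓ hadm hgt]

theorem csqrt_add_differentiableAt {ξ : ℂ} (hξ : ξ ∉ cut k) :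
    DifferentiableAt ℂ (fun z => csqrt ((k : ℂ) + z)) ξ :=
  (csqrt_differentiableAt (add_mem_slitPlane hξ)).comp ξ (differentiableAt_id.const_add (k : ℂ))

theorem two_I_csqrt_add_ne_zero {ξ : ℂ} (hξ : ξ ∉ cut k) :
    2 * Complex.I * csqrt ((k : ℂ) + ξ) ≠ 0 :=
  mul_ne_zero (mul_ne_zero two_ne_zero Complex.I_ne_zero)
    (csqrt_ne_zero_of_slitPlane (add_mem_slitPlane hξ))

theorem cauchyInt_density_differentiableAt (hk : 0 < k) (hh : 0 < h) (hℓ : IsContour ℓ)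
    (hx : 0 ≤ x₂) {ξ : ℂ} (hξ : ξ.im ≠ ℓ ξ.re) :
    DifferentiableAt ℂ (cauchyInt ℓ (density k h ℓ x₁ x₂)) ξ :=
  (cauchyInt_differentiableOn hℓ (density_admissible hk hh hℓ hx)).differentiableAt
    (hℓ.isOpen_off.mem_nhds hξ)

theorem fhatExt_differentiableAt (hk : 0 < k) (hh : 0 < h) (hℓ : IsContour ℓ) (hx : 0 ≤ x₂)
    {ξ : ℂ} (hξ : ξ ∉ cut k) : DifferentiableAt ℂ (fhatExt k h ℓ x₁ x₂) ξ := by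
  have h1 := (csqrt_add_differentiableAt hξ).const_mul (2 * Complex.I)
  have h2 := two_I_csqrt_add_ne_zero hξ
  by_cases hc : ξ ∈ cutPlane k
  · have hadm : Admissible ℓ (densityExt k h ℓ x₁ x₂) :=
      (density_admissible hk hh hℓ hx).congr (Eventually.of_forall density_path)
    have hd := densityExt_differentiableOn hk hh hℓ x₁ x₂
    have hU := isOpen_cutPlane k
    have h3 := (minusPart_differentiableOn hℓ hadm hU hd).differentiableAt (hU.mem_nhds hc)
    have h4 := hd.differentiableAt (hU.mem_nhds hc)
    refine (((h3.add h4).mul (plusFactor_differentiableAt hk hh hℓ hξ)).div h1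
      h2).congr_of_eventuallyEq ?_
    filter_upwards [hU.mem_nhds hc] with z hz using fhatExt_eq_on_cutPlane hk hh hℓ hx hz
  -- The remaining points form the ray [k, ∞). It lies above the path, so f̂⁺ is holomorphic there
  -- by its original definition, although μ is not.
  · have hab : ℓ ξ.re < ξ.im := by
      by_contra! h3
      exact hc (hℓ.below_mem_cutPlane h3 hk hξ)
    have h3 := (cauchyInt_density_differentiableAt (x₁ := x₁) hk hh hℓ hx hab.ne').const_mul
      (1 / (2 * (Real.pi : ℂ) * Complex.I))
    refine ((h3.mul (Kplus_differentiableAt hk hh hℓ hab)).div h1 h2).congr_of_eventuallyEq ?_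
    filter_upwards [hℓ.isOpen_above.mem_nhds hab] with z hz
    have hz' : ℓ z.re < z.im := hz
    rw [fhatExt, if_pos hz'.le, fhatPlus, Hplus_above hz']
    rfl

theorem mu_continuousWithinAt (k : ℝ) (ξ : ℂ) :
    ContinuousWithinAt (mu k) {z | z.re ≤ 0 ∧ 0 ≤ z.im} ξ := by
  have h1 : ContinuousWithinAt (fun z : ℂ => (k : ℂ) ^ 2 - z ^ 2) {z | z.re ≤ 0 ∧ 0 ≤ z.im} ξ :=
    Continuous.continuousWithinAt (by fun_prop)
  refine (csqrt_continuousWithinAt _).comp h1 fun z hz => ?_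
  change 0 ≤ ((k : ℂ) ^ 2 - z ^ 2).im
  rw [sq_sub_sq_im]
  nlinarith [mul_nonneg (neg_nonneg.2 hz.1) hz.2]

/-- The cut lies below the path, where the continuation is written without √(k+ξ). All its
ingredients are holomorphic near the cut except μ, and for Re z ≤ 0 ≤ Im z the radicand k² - z²
stays in the closed upper half plane, up to which the root is continuous. -/
theorem fhatExt_continuousWithinAt_cut (hk : 0 < k) (hh : 0 < h) (hℓ : IsContour ℓ) (hx : 0 ≤ x₂)
    {ξ : ℂ} (hξ : ξ ∈ cut k) :
    ContinuousWithinAt (fhatExt k h ℓ x₁ x₂) {z | z.re ≤ 0 ∧ 0 ≤ z.im} ξ := by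
  have hre : ξ.re < 0 := by linarith [hξ.2]
  have hbel : ξ.im < ℓ ξ.re := by rw [hξ.1]; exact hℓ.pos_of_neg _ hre
  have h1 := mu_continuousWithinAt k ξ
  have h2 := (cauchyInt_density_differentiableAt (x₁ := x₁) hk hh hℓ hx
    hbel.ne).continuousAt.continuousWithinAt (s := {z | z.re ≤ 0 ∧ 0 ≤ z.im})
  have h3 := (Kminus_differentiableAt hk hh hℓ hbel).continuousAt.continuousWithinAt
    (s := {z | z.re ≤ 0 ∧ 0 ≤ z.im})
  have h4 : ContinuousWithinAt (fun z : ℂ => csqrt ((k : ℂ) - z)) {z | z.re ≤ 0 ∧ 0 ≤ z.im} ξ := by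
    have : (k : ℂ) - ξ ∈ Complex.slitPlane := Or.inl (by simp; linarith)
    exact ((csqrt_differentiableAt this).comp ξ
      (differentiableAt_id.const_sub (k : ℂ))).continuousAt.continuousWithinAt
  have h5 : ContinuousWithinAt (fun z => symbQuotient h (mu k z)) {z | z.re ≤ 0 ∧ 0 ≤ z.im} ξ :=
    (symbQuotient_differentiable h).continuous.continuousAt.comp_continuousWithinAt h1
  have h6 : ContinuousWithinAt (fun z => Complex.exp
      (Complex.I * z * (x₁ : ℂ) + Complex.I * mu k z * (x₂ : ℂ))) {z | z.re ≤ 0 ∧ 0 ≤ z.im} ξ :=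
    (((continuousWithinAt_const.mul continuousWithinAt_id).mul continuousWithinAt_const).add
      ((continuousWithinAt_const.mul h1).mul continuousWithinAt_const)).cexp
  have h7 : ∀ z : ℂ, z.im < ℓ z.re → fhatExt k h ℓ x₁ x₂ z =
      (1 / (2 * (Real.pi : ℂ) * Complex.I) * cauchyInt ℓ (density k h ℓ x₁ x₂) z
      * csqrt ((k : ℂ) - z)
      + Complex.exp (Complex.I * z * (x₁ : ℂ) + Complex.I * mu k z * (x₂ : ℂ)) * Kminus k h ℓ z)
      * symbQuotient h (mu k z) / (2 * Complex.I * Kminus k h ℓ z) := fun z hz => by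
    rw [fhatExt, if_neg (not_le.2 hz)]
  refine ((((((continuousWithinAt_const.mul h2).mul h4).add (h6.mul h3)).mul h5).div
    (continuousWithinAt_const.mul h3) ?_)).congr_of_eventuallyEq ?_ (h7 ξ hbel)
  · exact mul_ne_zero (mul_ne_zero two_ne_zero Complex.I_ne_zero) (Kminus_ne_zero hbel)
  · filter_upwards [mem_nhdsWithin_of_mem_nhds (hℓ.isOpen_below.mem_nhds hbel)] with z hz
      using h7 z hz

theorem closure_quadrantPM_subset : closure quadrantPM ⊆ {z : ℂ | 0 ≤ z.re} :=
  closure_minimal (fun _ hz => le_of_lt hz.1) (isClosed_le continuous_const Complex.continuous_re)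

theorem closure_quadrantMP_subset : closure quadrantMP ⊆ {z : ℂ | z.re ≤ 0 ∧ 0 ≤ z.im} :=
  closure_minimal (fun _ hz => ⟨le_of_lt hz.1, le_of_lt hz.2⟩)
    ((isClosed_le Complex.continuous_re continuous_const).inter
      (isClosed_le continuous_const Complex.continuous_im))

theorem fhatExt_continuousOn (hk : 0 < k) (hh : 0 < h) (hℓ : IsContour ℓ) (hx : 0 ≤ x₂) :
    ContinuousOn (fhatExt k h ℓ x₁ x₂) (closure quadrantPM ∪ closure quadrantMP) := by
  intro ξ _
  by_cases hc : ξ ∈ cut k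
  · refine (fhatExt_continuousWithinAt_cut hk hh hℓ hx hc).mono_of_mem_nhdsWithin ?_
    have hre : ξ.re < 0 := by linarith [hc.2]
    filter_upwards [self_mem_nhdsWithin, mem_nhdsWithin_of_mem_nhds
      ((isOpen_lt Complex.continuous_re continuous_const).mem_nhds hre)] with z hz hz'
    rcases hz with hz | hz
    · exact absurd (closure_quadrantPM_subset hz) (not_le.2 hz')
    · exact closure_quadrantMP_subset hz
  · exact (fhatExt_differentiableAt hk hh hℓ hx hc).continuousAt.continuousWithinAt

end

section

variable {k h : ℝ} {ℓ : ℝ → ℝ} {f g : ℂ → ℂ} {x₁ x₂ : ℝ}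

/-! ### Decay along the real axis -/

theorem ofReal_mem_strips {R b x : ℝ} (hb : 0 < b) (hx : R < |x|) : (x : ℂ) ∈ strips R b :=
  ⟨by simpa using hx, by simpa using hb⟩

/-- Positive real points lie above the path and negative ones below it. On both sides the far
continuation yields the same product, because K⁺ there is exp(`farExponent`) times the continued
symbol; only values on the path and at x are needed of f. -/
theorem fhatExt_ofReal (hk : 0 < k) (hh : 0 < h) (hℓ : IsContour ℓ) (hx : 0 ≤ x₂)
    (hf : ∀ᵐ s : ℝ, density k h ℓ x₁ x₂ (path ℓ s) = f (path ℓ s)) {x : ℝ}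
    (hfx : f x = farDensity k h ℓ x₁ x₂ x) (hxR : farRadius k h < |x|) :
    fhatExt k h ℓ x₁ x₂ x = (minusPart ℓ f x + f x)
      * (Complex.exp (farExponent k h ℓ x) * symbFar k h x)
      / (2 * Complex.I * csqrt ((k : ℂ) + x)) := by
  have hadm := density_admissible (x₁ := x₁) hk hh hℓ hx
  have hfadm : Admissible ℓ f := hadm.congr hf
  have hmem : (x : ℂ) ∈ strips (farRadius k h) 3 := ofReal_mem_strips (by norm_num) hxR
  have h0 := strips_half_re hk hh hmem
  rw [Complex.ofReal_re] at h0
  rcases lt_or_gt_of_ne (abs_pos.1 (by linarith : 0 < |x|)) with hneg | hpos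
  · have hbel : (x : ℂ).im < ℓ (x : ℂ).re := by simpa using hℓ.pos_of_neg x hneg
    rw [abs_of_neg hneg] at h0
    have h1 : (k : ℂ) - x ≠ 0 := by
      rw [← Complex.ofReal_sub, Complex.ofReal_ne_zero]
      linarith
    have h2 : (k : ℂ) + x ≠ 0 := by
      rw [← Complex.ofReal_add, Complex.ofReal_ne_zero]
      linarith
    have hK := Kminus_below_eq_far hk hh hℓ hbel
    have hmu := mu_eq_I_mul_nu_of_real hk hh hxR
    rw [fhatExt_below hk hbel h1 h2, cauchyInt_congr hf, cauchyInt_below hℓ hfadm hbel, hfx,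
      density_eq_farDensity x₁ x₂ hK hmu (farRoot_eq_of_re_neg k (by simpa using hneg)), hK,
      symb_eq_symbFar h hmu, Complex.exp_neg, div_inv_eq_mul, mul_comm (symbFar k h x)]
  · have hab : ℓ (x : ℂ).re < (x : ℂ).im := by simpa using hℓ.neg_of_pos x hpos
    rw [fhatExt, if_pos hab.le, fhatPlus, Hplus_above hab, cauchyInt_congr hf,
      cauchyInt_above hℓ hfadm hab, Kplus_above_eq_far hk hh hℓ hab hmem]

theorem fhatExt_decay (hk : 0 < k) (hh : 0 < h) (hℓ : IsContour ℓ) (x₁ : ℝ) {α η : ℝ}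
    (hx : (x₂ = 0 ∧ α = 1 / 2) ∨ (0 < x₂ ∧ α = 1)) (hη : 0 < η) (hηα : η < α) :
    ∃ C R : ℝ, 0 < R ∧ ∀ ξ : ℝ, R ≤ |ξ| →
      ‖fhatExt k h ℓ x₁ x₂ ξ‖ ≤ C * |ξ| ^ (-(1 / 2) - η) := by
  classical
  have hx0 : 0 ≤ x₂ := by rcases hx with h | h <;> linarith [h.1]
  have hα1 : α ≤ 1 := by rcases hx with h | h <;> linarith [h.2]
  obtain ⟨R, C, hR⟩ := exists_isFar hk hh hℓ
  have hR1 := hR.one_le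
  obtain ⟨M, hM0, hM⟩ := hR.exists_norm_farDensity_le hk hh hx x₁
  -- Near infinity the density is replaced by its continuation across the real axis, so that unit
  -- discs around real points lie in its domain of holomorphy; elsewhere the original is kept. On
  -- the path nothing changes almost everywhere.
  set f : ℂ → ℂ := (strips R 2).piecewise (farDensity k h ℓ x₁ x₂) (density k h ℓ x₁ x₂) with hf
  have hfs : ∀ ξ ∈ strips R 2, f ξ = farDensity k h ℓ x₁ x₂ ξ := fun ξ hξ =>
    piecewise_eq_of_mem _ _ _ hξ
  have hfp : ∀ᵐ s : ℝ, density k h ℓ x₁ x₂ (path ℓ s) = f (path ℓ s) := by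
    have h0 : ∀ᵐ s : ℝ, s ≠ 0 := by simp [ae_iff]
    filter_upwards [h0] with s hs
    by_cases hp : path ℓ s ∈ strips R 2
    · rw [hfs _ hp, density_path_eq_farDensity hk hh hℓ x₁ x₂ hs]
    · exact (piecewise_eq_of_notMem _ _ _ hp).symm
  have hfadm : Admissible ℓ f := (density_admissible hk hh hℓ hx0).congr hfp
  have hfM : ∀ ξ ∈ strips R 2, ‖f ξ‖ ≤ M * |ξ.re| ^ (-α) := fun ξ hξ => by
    rw [hfs ξ hξ]; exact hM ξ hξ
  obtain ⟨D, hD0, hD⟩ := minusPart_decay hℓ hfadm hR1 zero_le_two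
    (fun s hs => strips_subset le_rfl one_le_two (hR.path_mem s hs))
    (((farDensity_differentiableOn hk hh hℓ x₁ x₂).mono hR.strips_subset).congr hfs) hM0 hfM
    hη.le hηα hα1
  -- The factors bound in turn the continued H⁺, the continued K⁺ (the symbol being at most 2 in
  -- modulus) and the inverse square root. Adding 2 to R puts real points strictly inside the
  -- reduced strip.
  refine ⟨(D + M) * (Real.exp C * 2) * 2, R + 2, by linarith, fun ξ hξ => ?_⟩
  have hm : (ξ : ℂ) ∈ strips R 2 := ofReal_mem_strips two_pos (by linarith)
  have hm1 : (ξ : ℂ) ∈ strips (R + 1) (2 - 1) := ofReal_mem_strips (by norm_num) (by linarith)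
  have hm3 := hR.strips_subset hm
  have hpos : 0 < |ξ| := by linarith
  have h1 := hD _ hm1
  have h2 := hfM _ hm
  rw [Complex.ofReal_re] at h1 h2
  have h3 : |ξ| ^ (-α) ≤ |ξ| ^ (-η) :=
    Real.rpow_le_rpow_of_exponent_le (by linarith) (by linarith)
  have h4 : ‖minusPart ℓ f ξ + f ξ‖ ≤ (D + M) * |ξ| ^ (-η) := by
    refine (norm_add_le _ _).trans ?_
    rw [add_mul]
    exact add_le_add h1 (h2.trans (by gcongr))
  have h5 : ‖Complex.exp (farExponent k h ℓ ξ) * symbFar k h ξ‖ ≤ Real.exp C * 2 := by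
    rw [norm_mul]
    gcongr
    · exact (Complex.norm_exp_le_exp_norm _).trans (Real.exp_le_exp.2 (hR.bound _ hm))
    · exact norm_symbFar_le hk hh hm3
  have h6 : ‖2 * Complex.I * csqrt ((k : ℂ) + ξ)‖⁻¹ ≤ 2 * |ξ| ^ (-(1 / 2) : ℝ) := by
    -- The lower bound for k - ξ is reused at -ξ to estimate k + ξ.
    have hneg : ((-ξ : ℝ) : ℂ) ∈ strips (farRadius k h) 3 :=
      ofReal_mem_strips (by norm_num) (by rw [abs_neg]; linarith [hR.radius_le])
    have h7 := half_abs_re_le_norm_sub hk hh hneg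
    rw [Complex.ofReal_re, abs_neg, Complex.ofReal_neg, sub_neg_eq_add] at h7
    have h8 := inv_sqrt_le hpos h7
    rw [norm_mul, norm_mul, Complex.norm_I, Complex.norm_ofNat, norm_csqrt, mul_one, mul_inv]
    have : 0 ≤ (√‖(k : ℂ) + ξ‖)⁻¹ := by positivity
    linarith
  rw [fhatExt_ofReal hk hh hℓ hx0 hfp (hfs _ hm) (by linarith [hR.radius_le]), norm_div, norm_mul,
    div_eq_mul_inv, sub_eq_add_neg, Real.rpow_add hpos]
  calc _ ≤ (D + M) * |ξ| ^ (-η) * (Real.exp C * 2) * (2 * |ξ| ^ (-(1 / 2) : ℝ)) := by gcongr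
    _ = _ := by ring

end

end WienerHopf

end

/-! ### Conclusion -/

theorem mainTheorem11 (k h : ℝ) (hk : 0 < k) (hh : 0 < h)
    (ℓ : ℝ → ℝ) (hℓ : WienerHopf.IsContour ℓ)
    (x₁ x₂ : ℝ) (hx : 0 < x₂ ∨ (x₂ = 0 ∧ 0 < x₁)) :
    ∃ F : ℂ → ℂ,
      Set.EqOn F (WienerHopf.fhatPlus k h ℓ x₁ x₂) (WienerHopf.closedUpper ℓ) ∧
      DifferentiableOn ℂ F (WienerHopf.cut k)ᶜ ∧
      ContinuousOn F (closure WienerHopf.quadrantPM ∪ closure WienerHopf.quadrantMP) ∧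
      (0 < x₂ → ∀ η : ℝ, 0 < η → η < 1 →
        ∃ C R : ℝ, 0 < R ∧ ∀ ξ : ℝ, R ≤ |ξ| → ‖F (ξ : ℂ)‖ ≤ C * |ξ| ^ (-(1 / 2) - η)) ∧
      (x₂ = 0 → ∀ η : ℝ, 0 < η → η < 1 / 2 →
        ∃ C R : ℝ, 0 < R ∧ ∀ ξ : ℝ, R ≤ |ξ| → ‖F (ξ : ℂ)‖ ≤ C * |ξ| ^ (-(1 / 2) - η)) := by
  have hx0 : 0 ≤ x₂ := by rcases hx with h | h <;> linarith
  refine ⟨WienerHopf.fhatExt k h ℓ x₁ x₂, fun ξ hξ => if_pos hξ, fun ξ hξ =>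
    (WienerHopf.fhatExt_differentiableAt hk hh hℓ hx0 hξ).differentiableWithinAt,
    WienerHopf.fhatExt_continuousOn hk hh hℓ hx0, fun hx2 η hη hη1 => ?_, fun hx2 η hη hη1 => ?_⟩
  · exact WienerHopf.fhatExt_decay hk hh hℓ x₁ (Or.inr ⟨hx2, rfl⟩) hη hη1
  · exact WienerHopf.fhatExt_decay hk hh hℓ x₁ (Or.inl ⟨hx2, rfl⟩) hη hη1
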